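/- **Theorem.** Let $\mathbf E$ be a Banach space, let $T_1(t),\dots,T_d(t)$, $t\ge 0$, be strongly continuous semigroups of operators on $\mathbf E$ with $\|T_j(t)\|\le 1$, and let $D_1,\dots,D_d$ be their infinitesimal generators with domains $\mathcal D(D_j)$. For $r\in\mathbb N\cup\{0\}$ let $\mathbf E^{r}$ be the space of all $f\in\mathbf E$ for which $D_{j_1}\cdots D_{j_k}f$ is defined for all $1\le k\le r$ and $1\le j_1,\dots,j_k\le d$, with the norm $$\|f\|_{\mathbf E^r}=\|f\|_{\mathbf E}+\sum_{k=1}^{r}\ \sum_{1\le j_1,\dots,j_k\le d}\|D_{j_1}\cdots D_{j_k}f\|_{\mathbf E},\qquad \mathbf E^0=\mathbf E .$$ Put $Tf(t_1,\dots,t_d)=T_1(t_1)T_2(t_2)\cdots T_d(t_d)f$ for $t_1,\dots,t_d\ge 0$. Assume: (a) $\mathbf E^1=\bigcap_{i}\mathcal D(D_i)$ is dense in $\mathbf E$; (b) $\mathbf E^1$ is invariant under $T_i(t)$ for all $1\le i\le d$ and $t\ge 0$; (c) there are real functions $\zeta_i^k\in C^\infty(U)$, $1\le i,k\le d$, on the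 open unit ball $U$ of $\mathbb R^d$ such that for all $1\le i\le d$, all $f\in\mathbf E^1$ and all $\mathbf t=(t_1,\dots,t_d)\in U$ with $t_1,\dots,t_d\ge 0$ $$D_iTf(\mathbf t)=\sum_{k=1}^d\zeta_i^k(\mathbf t)\,(\partial_kTf)(\mathbf t),$$ where $\partial_k=\partial/\partial t_k$ (one-sided at $t_k=0$). For $s\ge 0$ and $r\in\mathbb N$, $r\ge1$, define the mixed modulus of continuity $$\Omega^r(s,f)=\sum_{1\le j_1,\dots,j_r\le d}\ \sup_{0\le\tau_1,\dots,\tau_r\le s}\bigl\|(T_{j_1}(\tau_1)-I)\cdots(T_{j_r}(\tau_r)-I)f\bigr\|_{\mathbf E}.$$ For normed spaces $X,Y\subset\mathbf E$ let $$K(t,f,X,Y)=\inf\{\|f_0\|_X+t\|f_1\|_Y:\ f=f_0+f_1,\ f_0\in X,\ f_1\in Y\},$$ and let $(X,Y)^K_{\theta,q}$, $0<\theta<1$, $1\le q\le\infty$, be the space of $f\in X+Y$ for which $\bigl(\int_0^\infty(t^{-\theta}K(t,f,X,Y))^q\,\frac{dt}{t}\bigr)^{1/q}$ is finite, with this quantity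 as norm (for $q=\infty$, here and below, expressions $(\int_0^\infty\varphi(s)^q\,ds/s)^{1/q}$ are read as $\sup_{s>0}\varphi(s)$). Equivalence of two norms means that each is at most a constant times the other, the constant not depending on $f$; in particular both are finite for the same $f\in\mathbf E$, where a norm containing $\|f\|_{\mathbf E^m}$ is read as $\infty$ for $f\notin\mathbf E^m$. Then for every $r\in\mathbb N$, $r\ge 1$, the following holds. 1. There are constants $c,C>0$ such that for all $f\in\mathbf E$ and $s\ge 0$ $$c\,\Omega^r(s,f)\le K(s^r,f,\mathbf E,\mathbf E^r)\le C\bigl(\Omega^r(s,f)+\min(s^r,1)\|f\|_{\mathbf E}\bigr).$$ Let moreover $0<\alpha<r$ be real and $1\le q\le\infty$. 2. The norm of the Besov space $(\mathbf E,\mathbf E^r)^K_{\alpha/r,q}$ is equivalent to the norm $$\|f\|_{\mathbf E}+\Bigl(\int_0^\infty\bigl(s^{-\alpha}\Omega^r(s,f)\bigr)^q\frac{ds}{s}\Bigr)^{1/q}.\qquad(*)$$ 3. If $k_1,k_2$ are integers with $0\le k_1<\alpha<k_2\le r$, then, with equivalent norms, $$(\mathbf E,\mathbf E^r)^K_{\alpha/r,q}=(\mathbf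 E^{k_1},\mathbf E^{k_2})^K_{(\alpha-k_1)/(k_2-k_1),q}.$$ 4. If $\alpha$ is not an integer and $[\alpha]$ is its integer part, then $(*)$ is equivalent to the norm $$\|f\|_{\mathbf E^{[\alpha]}}+\sum_{1\le j_1,\dots,j_{[\alpha]}\le d}\Bigl(\int_0^\infty\bigl(s^{[\alpha]-\alpha}\,\Omega^1(s,D_{j_1}\cdots D_{j_{[\alpha]}}f)\bigr)^q\frac{ds}{s}\Bigr)^{1/q}.$$ 5. If $\alpha=k$ is an integer, then $(*)$ is equivalent to the norm $$\|f\|_{\mathbf E^{k-1}}+\sum_{1\le j_1,\dots,j_{k-1}\le d}\Bigl(\int_0^\infty\bigl(s^{-1}\,\Omega^2(s,D_{j_1}\cdots D_{j_{k-1}}f)\bigr)^q\frac{ds}{s}\Bigr)^{1/q}.$$ -/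

import Mathlib

open Filter Topology Set MeasureTheory
open scoped ENNReal

noncomputable section

/-- A strongly continuous semigroup of contractions on a real Banach space (a complex Banach space
is covered by restriction of scalars). Only the values at `t ≥ 0` carry meaning. -/
structure ContractionSemigroup (E : Type*) [NormedAddCommGroup E] [NormedSpace ℝ E] where
  /-- the operators of the semigroup -/
  op : ℝ → E →L[ℝ] E
  op_zero : op 0 = 1
  op_add : ∀ s t : ℝ, 0 ≤ s → 0 ≤ t → op (s + t) = op s * op t
  continuousOn_orbit : ∀ f : E, ContinuousOn (fun t => op t f) (Ici 0)
  norm_op_le : ∀ t : ℝ, 0 ≤ t → ‖op t‖ ≤ 1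

section Semigroups

variable {E : Type*} [NormedAddCommGroup E] [NormedSpace ℝ E]

/-- The infinitesimal generator: `D f = lim_{t → 0+} (T(t) f - f) / t`, defined on the set of those
`f` for which the limit exists. -/
def ContractionSemigroup.generator (S : ContractionSemigroup E) : E →ₗ.[ℝ] E where
  domain :=
    { carrier := {f | ∃ g : E, Tendsto (fun t : ℝ => t⁻¹ • (S.op t f - f)) (𝓝[>] 0) (𝓝 g)}
      zero_mem' := ⟨0, by simp⟩
      add_mem' := by
        rintro a b ⟨x, hx⟩ ⟨y, hy⟩
        refine ⟨x + y, (hx.add hy).congr fun t => ?_⟩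
        rw [← smul_add, map_add]
        congr 1
        abel
      smul_mem' := by
        rintro c a ⟨x, hx⟩
        refine ⟨c • x, (hx.const_smul c).congr fun t => ?_⟩
        rw [smul_comm, smul_sub, map_smul] }
  toFun :=
    { toFun := fun f => Classical.choose f.2
      map_add' := by
        intro a b
        refine tendsto_nhds_unique (Classical.choose_spec (a + b).2) ?_
        refine ((Classical.choose_spec a.2).add (Classical.choose_spec b.2)).congr fun t => ?_
        rw [← smul_add, Submodule.coe_add, map_add]
        congr 1
        abel
      map_smul' := by
        intro c a
        refine tendsto_nhds_unique (Classical.choose_spec (c • a).2) ?_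
        refine ((Classical.choose_spec a.2).const_smul c).congr fun t => ?_
        rw [smul_comm, smul_sub, Submodule.coe_smul, map_smul] }

open Classical in
/-- The generator as a total function; the value `0` off the domain is never used below. -/
def ContractionSemigroup.genApply (S : ContractionSemigroup E) (f : E) : E :=
  if h : f ∈ S.generator.domain then S.generator ⟨f, h⟩ else 0

theorem ContractionSemigroup.genApply_of_mem (S : ContractionSemigroup E) {f : E}
    (h : f ∈ S.generator.domain) : S.genApply f = S.generator ⟨f, h⟩ := by
  simp [ContractionSemigroup.genApply, h]

variable {d : ℕ}

/-- The abstract Sobolev space `E^r`: the vectors `f` such that `D_{j_1} ⋯ D_{j_k} f` is defined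
for all `k ≤ r` and all `j_1, …, j_k`. -/
def sobolevSpace (T : Fin d → ContractionSemigroup E) : ℕ → Submodule ℝ E
  | 0 => ⊤
  | r + 1 =>
    { carrier := {f | ∀ i, f ∈ (T i).generator.domain ∧ (T i).genApply f ∈ sobolevSpace T r}
      zero_mem' := fun i => ⟨Submodule.zero_mem _, by
        rw [(T i).genApply_of_mem (Submodule.zero_mem _)]
        have h0 : (⟨0, Submodule.zero_mem _⟩ : (T i).generator.domain) = 0 := rfl
        rw [h0, LinearPMap.map_zero]
        exact Submodule.zero_mem _⟩
      add_mem' := by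
        intro a b ha hb i
        have hm := Submodule.add_mem _ (ha i).1 (hb i).1
        refine ⟨hm, ?_⟩
        have h1 := (ha i).2
        have h2 := (hb i).2
        rw [(T i).genApply_of_mem (ha i).1] at h1
        rw [(T i).genApply_of_mem (hb i).1] at h2
        rw [(T i).genApply_of_mem hm]
        have h3 : (⟨a + b, hm⟩ : (T i).generator.domain) = ⟨a, (ha i).1⟩ + ⟨b, (hb i).1⟩ := rfl
        rw [h3, LinearPMap.map_add]
        exact Submodule.add_mem _ h1 h2
      smul_mem' := by
        intro c a ha i
        have hm := Submodule.smul_mem _ c (ha i).1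
        refine ⟨hm, ?_⟩
        have h1 := (ha i).2
        rw [(T i).genApply_of_mem (ha i).1] at h1
        rw [(T i).genApply_of_mem hm]
        have h3 : (⟨c • a, hm⟩ : (T i).generator.domain) = c • ⟨a, (ha i).1⟩ := rfl
        rw [h3, LinearPMap.map_smul]
        exact Submodule.smul_mem _ c h1 }

/-- The mixed derivative `D_{j_1} ⋯ D_{j_k} f` (the last operator acts first); meaningful for
`f ∈ E^k`. -/
def mixedDeriv (T : Fin d → ContractionSemigroup E) {k : ℕ} (j : Fin k → Fin d) (f : E) : E :=
  (List.ofFn j).foldr (fun i g => (T i).genApply g) f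

open Classical in
/-- The norm of `E^r`, namely `‖f‖ + ∑_{1 ≤ k ≤ r} ∑_{j_1, …, j_k} ‖D_{j_1} ⋯ D_{j_k} f‖`, extended
by `∞` to the vectors outside `E^r`. -/
def sobolevNorm (T : Fin d → ContractionSemigroup E) (r : ℕ) (f : E) : ℝ≥0∞ :=
  if f ∈ sobolevSpace T r then
    ‖f‖ₑ + ∑ k ∈ Finset.Icc 1 r, ∑ j : Fin k → Fin d, ‖mixedDeriv T j f‖ₑ
  else ⊤

/-- The function `Tf(t_1, …, t_d) = T_1(t_1) T_2(t_2) ⋯ T_d(t_d) f`. -/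
def orbitMap (T : Fin d → ContractionSemigroup E) (f : E) (t : Fin d → ℝ) : E :=
  (List.ofFn fun k => (T k).op (t k)).prod f

/-- The mixed modulus of continuity: the sum over `j_1, …, j_r` of the suprema, over all
`0 ≤ τ_1, …, τ_r ≤ s`, of `‖(T_{j_1}(τ_1) - I) ⋯ (T_{j_r}(τ_r) - I) f‖`. -/
def mixedModulus (T : Fin d → ContractionSemigroup E) (r : ℕ) (s : ℝ) (f : E) : ℝ≥0∞ :=
  ∑ j : Fin r → Fin d, ⨆ (τ : Fin r → ℝ) (_ : ∀ i, τ i ∈ Icc 0 s),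
    ‖(List.ofFn fun i => (T (j i)).op (τ i) - 1).prod f‖ₑ

/-- The standing assumption on the family of semigroups. The identity in `differentiation` is
required at the points of the open Euclidean unit ball where the semigroups are defined, i.e. with
nonnegative coordinates; `∂_k Tf` is the partial derivative on `[0, ∞)^d` (one-sided at `t_k = 0`),
which exists for `f ∈ E^1` because `E^1` is invariant. -/
structure SemigroupAssumption (T : Fin d → ContractionSemigroup E) : Prop where
  dense : Dense (sobolevSpace T 1 : Set E)
  invariant : ∀ (i : Fin d) (t : ℝ), 0 ≤ t → ∀ f ∈ sobolevSpace T 1,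
    (T i).op t f ∈ sobolevSpace T 1
  differentiation : ∃ ζ : Fin d → Fin d → EuclideanSpace ℝ (Fin d) → ℝ,
    (∀ i k, ContDiffOn ℝ ((⊤ : ℕ∞) : WithTop ℕ∞) (ζ i k) (Metric.ball 0 1)) ∧
    ∀ i, ∀ f ∈ sobolevSpace T 1, ∀ t ∈ Metric.ball (0 : EuclideanSpace ℝ (Fin d)) 1,
      (∀ k, 0 ≤ t k) →
        (T i).genApply (orbitMap T f t) =
          ∑ k, ζ i k t •
            derivWithin (fun u : ℝ => orbitMap T f (Function.update t k u)) (Ici 0) (t k)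

end Semigroups

/-- The norm of `L^q((0, ∞), ds/s)` of a nonnegative function, with the supremum if `q = ∞`. -/
def haarNorm (q : ℝ≥0∞) (φ : ℝ → ℝ≥0∞) : ℝ≥0∞ :=
  if q = ⊤ then ⨆ (s : ℝ) (_ : 0 < s), φ s
  else (∫⁻ s in Ioi (0 : ℝ), φ s ^ q.toReal / ENNReal.ofReal s) ^ (1 / q.toReal)

section Interpolation

variable {A : Type*} [AddCommGroup A]

/-- Peetre's K-functional of two normed spaces inside `A`. Each space is given by its norm, extended
by `∞` to the elements of `A` outside the space; the infimum is over the decompositions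
`f = f₀ + f₁` with `f₀` in the first space and `f₁` in the second one. -/
def kFunctional (N₀ N₁ : A → ℝ≥0∞) (t : ℝ) (f : A) : ℝ≥0∞ :=
  ⨅ (f₀ : A) (f₁ : A) (_ : f₀ + f₁ = f) (_ : N₀ f₀ ≠ ⊤) (_ : N₁ f₁ ≠ ⊤),
    N₀ f₀ + ENNReal.ofReal t * N₁ f₁

/-- The norm of the real interpolation space with parameters `θ`, `q`, extended by `∞` to the
elements outside that space. -/
def interpNorm (N₀ N₁ : A → ℝ≥0∞) (θ : ℝ) (q : ℝ≥0∞) (f : A) : ℝ≥0∞ :=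
  haarNorm q fun t => ENNReal.ofReal (t ^ (-θ)) * kFunctional N₀ N₁ t f

/-- Equivalence of two extended norms; in particular they are finite on the same elements. -/
def NormsEquivalent (N N' : A → ℝ≥0∞) : Prop :=
  ∃ c C : ℝ, 0 < c ∧ 0 < C ∧
    ∀ f : A, ENNReal.ofReal c * N f ≤ N' f ∧ N' f ≤ ENNReal.ofReal C * N f

end Interpolation

section Besov

variable {E : Type*} [NormedAddCommGroup E] [NormedSpace ℝ E] {d : ℕ}

/-- `‖f‖ + (∫_0^∞ (s^{-α} Ω^r(s, f))^q ds/s)^{1/q}`. -/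
def modulusNorm (T : Fin d → ContractionSemigroup E) (r : ℕ) (α : ℝ) (q : ℝ≥0∞) (f : E) : ℝ≥0∞ :=
  ‖f‖ₑ + haarNorm q fun s => ENNReal.ofReal (s ^ (-α)) * mixedModulus T r s f

/-- `‖f‖_{E^m} + ∑_{j_1, …, j_m} (∫_0^∞ (s^{-β} Ω^l(s, D_{j_1} ⋯ D_{j_m} f))^q ds/s)^{1/q}`; it is
`∞` for `f` outside `E^m`. -/
def derivModulusNorm (T : Fin d → ContractionSemigroup E) (m l : ℕ) (β : ℝ) (q : ℝ≥0∞) (f : E) :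
    ℝ≥0∞ :=
  sobolevNorm T m f + ∑ j : Fin m → Fin d,
    haarNorm q fun s => ENNReal.ofReal (s ^ (-β)) * mixedModulus T l s (mixedDeriv T j f)

end Besov

end

/-!
The upper bound of the K-functional by the modulus of continuity is the heart of the matter; the
rest is interpolation theory of the scale `E^k`.

*Smoothing.* A vector `f` is regularized by `P f = ∫ φ(x) T(s x) f dx`, with a smooth `φ` of
integral one supported in a box inside the open orthant. The differentiation formula turns `D_i`,
applied to such an integral, into a vector field acting on the orbit; integration by parts moves it
onto the kernel, so that `D_i` of a smoothed vector is `s⁻¹` times a smoothed vector with another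
kernel (`tendsto_smoothing`). This is justified first for `f ∈ E^1` and then extended by density
of `E^1` and closedness of `D_i`. On `E^1` it requires the operators `T_i(t)` to be bounded on
`E^1` locally uniformly in `t > 0`, which follows from invariance by the uniform boundedness
principle and Baire's theorem (`exists_bound_op`); this is why the box stays away from the origin.
The decomposition `f = (1 - P)^r f + (1 - (1 - P)^r) f` is then used (`exists_decomposition`). The
first term has the size of an `r`-th difference. For the second, the orbit `T(s x) f` is replaced
by a Taylor polynomial built from Steklov averages (`exists_taylor_opList`), with an error of the size
`Ω^r(s, f)`; each derivative falling on the kernel can be moved back to the monomials, where it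
gains a factor `s` (`IsKernel.exists_bound_smoothing_word`).

No commutation of the semigroups is available. It is replaced by the calculus of operators that
vanish to a given order (`VanishesToOrder`), in which `T_i(τ) = 1 + (T_i(τ) - 1)` has order zero.

*Absorption.* The estimate obtained contains the lower order terms `s^{r-l} Ω^l(s, f)`, `l < r`. By
the interpolation inequality between the norms of the spaces `E^l` (`sobolevNorm_interp`, a
consequence of Landau's inequality) they are at most a small multiple of the K-functional plus
`s^r ‖f‖`, for small `s` (`exists_absorption`), and the former is absorbed in the left-hand side.
The opposite inequality is immediate, since a difference of a differentiable vector is an integral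
of its derivative. Together they give `exists_kFunctional_equiv`.

*Interpolation.* The inequalities `K(s^r, f) ≤ C s^k ‖f‖_{E^k}` and
`s^k ‖f‖_{E^k} ≤ C (‖f‖ + s^r ‖f‖_{E^r})` place `E^k` between `E` and `E^r`. Reiteration is
then proved by the telescoping series of near-optimal decompositions at the dyadic scales
`2^n s`, Minkowski's inequality and the dilation invariance of `ds/s`
(`isDominated_rescaledInterpNorm_of_lt`). The descriptions through derivatives follow by
reiteration with the pair `(E^k, E^{k+l})`, since the modulus of order `l` of the derivatives of
order `k` is at most the K-functional of this pair, and bounds the modulus of order `k + l`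
divided by `s^k` (`normsEquivalent_modulusNorm_derivModulusNorm`).
-/

/-! ### Semigroups and their generators -/

namespace ContractionSemigroup

variable {E : Type*} [NormedAddCommGroup E] [NormedSpace ℝ E] (S : ContractionSemigroup E)

theorem norm_op_apply_le {t : ℝ} (ht : 0 ≤ t) (f : E) : ‖S.op t f‖ ≤ ‖f‖ := by
  simpa using (S.op t).le_of_opNorm_le (S.norm_op_le t ht) f

theorem op_add_apply {s t : ℝ} (hs : 0 ≤ s) (ht : 0 ≤ t) (f : E) :
    S.op (s + t) f = S.op s (S.op t f) := by
  rw [S.op_add s t hs ht]; rfl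

theorem op_comm_apply {s t : ℝ} (hs : 0 ≤ s) (ht : 0 ≤ t) (f : E) :
    S.op s (S.op t f) = S.op t (S.op s f) := by
  rw [← S.op_add_apply hs ht, add_comm, S.op_add_apply ht hs]

theorem tendsto_genApply {f : E} (h : f ∈ S.generator.domain) :
    Tendsto (fun t : ℝ => t⁻¹ • (S.op t f - f)) (𝓝[>] 0) (𝓝 (S.genApply f)) := by
  rw [S.genApply_of_mem h]
  exact Classical.choose_spec h

theorem mem_domain_of_tendsto {f g : E}
    (h : Tendsto (fun t : ℝ => t⁻¹ • (S.op t f - f)) (𝓝[>] 0) (𝓝 g)) :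
    f ∈ S.generator.domain := ⟨g, h⟩

theorem genApply_eq_of_tendsto {f g : E}
    (h : Tendsto (fun t : ℝ => t⁻¹ • (S.op t f - f)) (𝓝[>] 0) (𝓝 g)) :
    S.genApply f = g :=
  tendsto_nhds_unique (S.tendsto_genApply (S.mem_domain_of_tendsto h)) h

theorem genApply_add {f g : E} (hf : f ∈ S.generator.domain) (hg : g ∈ S.generator.domain) :
    S.genApply (f + g) = S.genApply f + S.genApply g := by
  refine S.genApply_eq_of_tendsto
    (((S.tendsto_genApply hf).add (S.tendsto_genApply hg)).congr fun t => ?_)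
  rw [← smul_add, map_add]; congr 1; abel

theorem genApply_smul {f : E} (c : ℝ) (hf : f ∈ S.generator.domain) :
    S.genApply (c • f) = c • S.genApply f := by
  refine S.genApply_eq_of_tendsto (((S.tendsto_genApply hf).const_smul c).congr fun t => ?_)
  rw [smul_comm, smul_sub, map_smul]

theorem hasDerivWithinAt_op_Ici {t : ℝ} (ht : 0 ≤ t) {f : E} (hf : f ∈ S.generator.domain) :
    HasDerivWithinAt (fun u => S.op u f) (S.op t (S.genApply f)) (Ici t) t := by
  rw [hasDerivWithinAt_iff_tendsto_slope]
  have h := ((S.op t).continuous.tendsto _).comp (S.tendsto_genApply hf)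
  have h2 : Tendsto (fun u : ℝ => u - t) (𝓝[Ici t \ {t}] t) (𝓝[>] 0) := by
    rw [Ici_sdiff_left]
    refine tendsto_nhdsWithin_iff.2 ⟨?_, ?_⟩
    · have : Tendsto (fun u : ℝ => u - t) (𝓝 t) (𝓝 (t - t)) := tendsto_id.sub_const t
      rw [sub_self] at this
      exact this.mono_left nhdsWithin_le_nhds
    · filter_upwards [self_mem_nhdsWithin] with u hu
      exact sub_pos.2 (mem_Ioi.1 hu)
  refine (h.comp h2).congr' ?_
  rw [Ici_sdiff_left]
  filter_upwards [self_mem_nhdsWithin] with u hu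
  have hu' : 0 ≤ u - t := (sub_pos.2 (mem_Ioi.1 hu)).le
  simp only [Function.comp, slope, vsub_eq_sub, map_smul, map_sub]
  rw [← S.op_add_apply ht hu', add_sub_cancel]

theorem intervalIntegrable_op {a b : ℝ} (ha : 0 ≤ a) (hb : 0 ≤ b) (f : E) :
    IntervalIntegrable (fun u => S.op u f) volume a b := by
  refine ContinuousOn.intervalIntegrable ((S.continuousOn_orbit f).mono ?_)
  intro u hu
  exact le_trans (le_inf ha hb) hu.1

variable [CompleteSpace E]

theorem integral_op_genApply {t : ℝ} (ht : 0 ≤ t) {f : E} (hf : f ∈ S.generator.domain) :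
    ∫ u in (0 : ℝ)..t, S.op u (S.genApply f) = S.op t f - f := by
  rw [intervalIntegral.integral_eq_sub_of_hasDeriv_right (f := fun u => S.op u f)]
  · simp [S.op_zero]
  · refine (S.continuousOn_orbit f).mono ?_
    rw [uIcc_of_le ht]; exact Icc_subset_Ici_self
  · intro x hx
    rw [min_eq_left ht] at hx
    exact (S.hasDerivWithinAt_op_Ici hx.1.le hf).mono Ioi_subset_Ici_self
  · exact S.intervalIntegrable_op le_rfl ht _

theorem norm_op_sub_le {t : ℝ} (ht : 0 ≤ t) {f : E} (hf : f ∈ S.generator.domain) :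
    ‖S.op t f - f‖ ≤ t * ‖S.genApply f‖ := by
  rw [← S.integral_op_genApply ht hf]
  refine (intervalIntegral.norm_integral_le_of_norm_le_const (C := ‖S.genApply f‖) ?_).trans ?_
  · intro u hu
    rw [uIoc_of_le ht] at hu
    exact S.norm_op_apply_le hu.1.le _
  · rw [sub_zero, abs_of_nonneg ht, mul_comm]

theorem hasDerivWithinAt_integral_op (g : E) {t : ℝ} (ht : 0 ≤ t) :
    HasDerivWithinAt (fun t => ∫ u in (0 : ℝ)..t, S.op u g) (S.op t g) (Ici 0) t := by
  -- the orbit is continued to the negative axis by a constant, so that it becomes continuous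
  have hc : Continuous fun u : ℝ => S.op (max u 0) g :=
    (S.continuousOn_orbit g).comp_continuous (continuous_id.max continuous_const)
      fun u => mem_Ici.2 (le_max_right _ _)
  have h := (intervalIntegral.integral_hasDerivAt_right (hc.intervalIntegrable 0 t)
    hc.stronglyMeasurable.stronglyMeasurableAtFilter hc.continuousAt).hasDerivWithinAt (s := Ici 0)
  rw [max_eq_left ht] at h
  have hcongr : ∀ t ∈ Ici (0 : ℝ),
      ∫ u in (0 : ℝ)..t, S.op u g = ∫ u in (0 : ℝ)..t, S.op (max u 0) g := by
    intro t ht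
    refine intervalIntegral.integral_congr fun u hu => ?_
    rw [uIcc_of_le (mem_Ici.1 ht)] at hu
    simp only [max_eq_left hu.1]
  exact h.congr hcongr (hcongr t ht)

theorem tendsto_of_integral_eq {f g : E}
    (h : ∀ t, 0 ≤ t → S.op t f - f = ∫ u in (0 : ℝ)..t, S.op u g) :
    Tendsto (fun t : ℝ => t⁻¹ • (S.op t f - f)) (𝓝[>] 0) (𝓝 g) := by
  have h1 := (S.hasDerivWithinAt_integral_op g le_rfl)
  rw [hasDerivWithinAt_iff_tendsto_slope, Ici_sdiff_left, S.op_zero] at h1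
  refine h1.congr' ?_
  filter_upwards [self_mem_nhdsWithin] with t ht
  simp [slope, h t (le_of_lt ht)]

theorem hasDerivWithinAt_op {t : ℝ} (ht : 0 ≤ t) {f : E} (hf : f ∈ S.generator.domain) :
    HasDerivWithinAt (fun u => S.op u f) (S.op t (S.genApply f)) (Ici 0) t := by
  have h := (S.hasDerivWithinAt_integral_op (S.genApply f) ht).add_const f
  refine h.congr (fun u hu => ?_) ?_
  · simp only [S.integral_op_genApply hu hf, sub_add_cancel]
  · simp only [S.integral_op_genApply ht hf, sub_add_cancel]

/-- The generator is a closed operator. -/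
theorem tendsto_of_closed {ι : Type*} {l : Filter ι} [l.NeBot] {x : ι → E} {f g : E}
    (hx : ∀ i, x i ∈ S.generator.domain) (hf : Tendsto x l (𝓝 f))
    (hg : Tendsto (fun i => S.genApply (x i)) l (𝓝 g)) :
    Tendsto (fun t : ℝ => t⁻¹ • (S.op t f - f)) (𝓝[>] 0) (𝓝 g) := by
  refine S.tendsto_of_integral_eq fun t ht => ?_
  have h1 : Tendsto (fun i => S.op t (x i) - x i) l (𝓝 (S.op t f - f)) :=
    (((S.op t).continuous.tendsto _).comp hf).sub hf
  refine tendsto_nhds_unique h1 ?_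
  rw [tendsto_iff_norm_sub_tendsto_zero] at hg ⊢
  have h2 := hg.const_mul t
  rw [mul_zero] at h2
  refine squeeze_zero (fun _ => norm_nonneg _) (fun i => ?_) h2
  rw [← S.integral_op_genApply ht (hx i), ← intervalIntegral.integral_sub
    (S.intervalIntegrable_op le_rfl ht _) (S.intervalIntegrable_op le_rfl ht _)]
  refine (intervalIntegral.norm_integral_le_of_norm_le_const
    (C := ‖S.genApply (x i) - g‖) ?_).trans ?_
  · intro u hu
    rw [uIoc_of_le ht] at hu
    rw [← map_sub]
    exact S.norm_op_apply_le hu.1.le _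
  · rw [sub_zero, abs_of_nonneg ht, mul_comm]

theorem op_sub_integral {h t : ℝ} (hh : 0 ≤ h) (ht : 0 ≤ t) (g : E) :
    S.op h (∫ u in (0 : ℝ)..t, S.op u g) - ∫ u in (0 : ℝ)..t, S.op u g =
      ∫ u in (0 : ℝ)..h, S.op u (S.op t g - g) := by
  have I := fun {a b : ℝ} (ha : 0 ≤ a) (hb : 0 ≤ b) => S.intervalIntegrable_op ha hb g
  have h1 : S.op h (∫ u in (0 : ℝ)..t, S.op u g) = ∫ u in h..(h + t), S.op u g := by
    rw [← (S.op h).intervalIntegral_comp_comm (I le_rfl ht)]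
    have := intervalIntegral.integral_comp_add_right (a := 0) (b := t) (fun u => S.op u g) h
    rw [zero_add, add_comm t h] at this
    rw [← this]
    refine intervalIntegral.integral_congr fun u hu => ?_
    rw [uIcc_of_le ht] at hu
    simp only [add_comm u h, S.op_add_apply hh hu.1]
  have h2 : ∫ u in (0 : ℝ)..h, S.op u (S.op t g) = ∫ u in t..(h + t), S.op u g := by
    have := intervalIntegral.integral_comp_add_right (a := 0) (b := h) (fun u => S.op u g) t
    rw [zero_add] at this
    rw [← this]
    refine intervalIntegral.integral_congr fun u hu => ?_
    rw [uIcc_of_le hh] at hu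
    simp only [S.op_add_apply hu.1 ht]
  simp only [map_sub]
  rw [intervalIntegral.integral_sub (S.intervalIntegrable_op le_rfl hh _)
    (S.intervalIntegrable_op le_rfl hh _), h1, h2]
  have hht := add_nonneg hh ht
  rw [← intervalIntegral.integral_interval_sub_left (I le_rfl hht) (I le_rfl hh),
    ← intervalIntegral.integral_interval_sub_left (I le_rfl hht) (I le_rfl ht)]
  abel

theorem tendsto_integral {t : ℝ} (ht : 0 ≤ t) (g : E) :
    Tendsto (fun h : ℝ => h⁻¹ • (S.op h (∫ u in (0 : ℝ)..t, S.op u g) -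
      ∫ u in (0 : ℝ)..t, S.op u g)) (𝓝[>] 0) (𝓝 (S.op t g - g)) :=
  S.tendsto_of_integral_eq fun _ hh => S.op_sub_integral hh ht g

/-- Landau's inequality for a contraction semigroup. -/
theorem norm_genApply_le {s : ℝ} (hs : 0 < s) {f : E} (hf : f ∈ S.generator.domain)
    (hf2 : S.genApply f ∈ S.generator.domain) :
    ‖S.genApply f‖ ≤ 2 * s⁻¹ * ‖f‖ + s * ‖S.genApply (S.genApply f)‖ := by
  -- `s • D f = (T(s) f - f) - ∫₀ˢ (T(u) D f - D f) du`
  have h1 : s • S.genApply f =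
      (S.op s f - f) - ∫ u in (0 : ℝ)..s, (S.op u (S.genApply f) - S.genApply f) := by
    rw [intervalIntegral.integral_sub (S.intervalIntegrable_op le_rfl hs.le _)
      intervalIntegrable_const, S.integral_op_genApply hs.le hf]
    simp
  have h2 : ‖S.op s f - f‖ ≤ 2 * ‖f‖ := by
    refine (norm_sub_le _ _).trans ?_
    linarith [S.norm_op_apply_le hs.le f]
  have h3 : ‖∫ u in (0 : ℝ)..s, (S.op u (S.genApply f) - S.genApply f)‖ ≤
      s * ‖S.genApply (S.genApply f)‖ * |s - 0| := by
    refine intervalIntegral.norm_integral_le_of_norm_le_const fun u hu => ?_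
    rw [uIoc_of_le hs.le] at hu
    refine (S.norm_op_sub_le hu.1.le hf2).trans ?_
    gcongr
    exact hu.2
  have h4 : s * ‖S.genApply f‖ ≤ 2 * ‖f‖ + s * ‖S.genApply (S.genApply f)‖ * s := by
    have : s * ‖S.genApply f‖ = ‖s • S.genApply f‖ := by
      rw [norm_smul, Real.norm_of_nonneg hs.le]
    rw [this, h1]
    refine (norm_sub_le _ _).trans (add_le_add h2 ?_)
    simpa [abs_of_pos hs] using h3
  have h5 : ‖S.genApply f‖ = s⁻¹ * (s * ‖S.genApply f‖) := by field_simp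
  rw [h5]
  calc s⁻¹ * (s * ‖S.genApply f‖)
      ≤ s⁻¹ * (2 * ‖f‖ + s * ‖S.genApply (S.genApply f)‖ * s) := by gcongr
    _ = _ := by field_simp

end ContractionSemigroup

/-! ### Abstract Sobolev spaces -/

section Sobolev

variable {E : Type*} [NormedAddCommGroup E] [NormedSpace ℝ E] {d : ℕ}
  (T : Fin d → ContractionSemigroup E)

theorem mem_sobolevSpace_succ {k : ℕ} {f : E} : f ∈ sobolevSpace T (k + 1) ↔
    ∀ i, f ∈ (T i).generator.domain ∧ (T i).genApply f ∈ sobolevSpace T k := Iff.rfl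

theorem mem_sobolevSpace_one {f : E} :
    f ∈ sobolevSpace T 1 ↔ ∀ i, f ∈ (T i).generator.domain := by
  rw [mem_sobolevSpace_succ]
  exact forall_congr' fun i => and_iff_left trivial

theorem sobolevSpace_antitone {k l : ℕ} (h : k ≤ l) : sobolevSpace T l ≤ sobolevSpace T k := by
  have step : ∀ k, sobolevSpace T (k + 1) ≤ sobolevSpace T k := by
    intro k
    induction k with
    | zero => exact fun _ _ => trivial
    | succ k ih =>
      intro f hf i
      exact ⟨(hf i).1, ih (hf i).2⟩
  induction h with
  | refl => exact le_rfl
  | step _ ih => exact (step _).trans ih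

theorem mixedDeriv_zero (j : Fin 0 → Fin d) (f : E) : mixedDeriv T j f = f := by
  simp [mixedDeriv]

theorem mixedDeriv_snoc {k : ℕ} (j : Fin k → Fin d) (i : Fin d) (f : E) :
    mixedDeriv T (Fin.snoc j i : Fin (k + 1) → Fin d) f = mixedDeriv T j ((T i).genApply f) := by
  unfold mixedDeriv
  rw [List.ofFn_succ']
  simp [List.concat_eq_append]

theorem sum_fin_snoc {M : Type*} [AddCommMonoid M] {k : ℕ} (F : (Fin (k + 1) → Fin d) → M) :
    ∑ j, F j = ∑ i : Fin d, ∑ j : Fin k → Fin d, F (Fin.snoc j i) := by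
  rw [← (Fin.snocEquiv fun _ : Fin (k + 1) => Fin d).sum_comp, Fintype.sum_prod_type]
  rfl

/-- The sum of the norms of all mixed derivatives of order `k`, in terms of those of order
`k - 1` of the first derivatives. -/
theorem sum_mixedDeriv_succ (k : ℕ) (F : E → ℝ≥0∞) (f : E) :
    ∑ j : Fin (k + 1) → Fin d, F (mixedDeriv T j f) =
      ∑ i, ∑ j : Fin k → Fin d, F (mixedDeriv T j ((T i).genApply f)) := by
  rw [sum_fin_snoc]
  simp_rw [mixedDeriv_snoc]

theorem sobolevNorm_of_mem {k : ℕ} {f : E} (hf : f ∈ sobolevSpace T k) :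
    sobolevNorm T k f = ∑ l ∈ Finset.range (k + 1), ∑ j : Fin l → Fin d, ‖mixedDeriv T j f‖ₑ := by
  rw [sobolevNorm, if_pos hf, Finset.sum_range_succ', add_comm]
  congr 1
  · rw [Finset.range_eq_Ico, Finset.sum_Ico_add' (fun l => ∑ j : Fin l → Fin d,
      ‖mixedDeriv T j f‖ₑ) 0 k 1]
    rfl
  · rw [Fintype.sum_unique]
    simp [mixedDeriv]

theorem sobolevNorm_of_notMem {k : ℕ} {f : E} (hf : f ∉ sobolevSpace T k) :
    sobolevNorm T k f = ⊤ := by rw [sobolevNorm, if_neg hf]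

theorem mem_of_sobolevNorm_ne_top {k : ℕ} {f : E} (h : sobolevNorm T k f ≠ ⊤) :
    f ∈ sobolevSpace T k := by
  by_contra hf
  exact h (sobolevNorm_of_notMem T hf)

theorem sobolevNorm_zero (f : E) : sobolevNorm T 0 f = ‖f‖ₑ := by
  simp [sobolevNorm, sobolevSpace]

theorem sobolevNorm_zero_eq : sobolevNorm T 0 = fun f : E => ‖f‖ₑ :=
  funext (sobolevNorm_zero T)

/-- The norm of `E^{k+1}` in terms of the norms in `E^k` of the first derivatives. -/
theorem sobolevNorm_succ {k : ℕ} {f : E} (hf : ∀ i, f ∈ (T i).generator.domain) :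
    sobolevNorm T (k + 1) f = ‖f‖ₑ + ∑ i, sobolevNorm T k ((T i).genApply f) := by
  by_cases h : f ∈ sobolevSpace T (k + 1)
  · rw [sobolevNorm_of_mem T h, Finset.sum_range_succ', add_comm]
    congr 1
    · rw [Fintype.sum_unique]
      simp [mixedDeriv]
    · simp_rw [fun i => sobolevNorm_of_mem T (h i).2]
      rw [Finset.sum_comm]
      refine Finset.sum_congr rfl fun l _ => ?_
      exact sum_mixedDeriv_succ T l (fun g => ‖g‖ₑ) f
  · rw [sobolevNorm_of_notMem T h]
    have : ∃ i, (T i).genApply f ∉ sobolevSpace T k := by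
      by_contra! hc
      exact h fun i => ⟨hf i, hc i⟩
    obtain ⟨i, hi⟩ := this
    have h1 : sobolevNorm T k ((T i).genApply f) ≤ ∑ i, sobolevNorm T k ((T i).genApply f) :=
      Finset.single_le_sum (f := fun i => sobolevNorm T k ((T i).genApply f))
        (fun _ _ => zero_le) (Finset.mem_univ i)
    rw [sobolevNorm_of_notMem T hi, top_le_iff] at h1
    rw [h1, add_top]

theorem mem_domain_of_sobolevNorm_ne_top {k : ℕ} {f : E} (h : sobolevNorm T (k + 1) f ≠ ⊤)
    (i : Fin d) : f ∈ (T i).generator.domain :=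
  (mem_of_sobolevNorm_ne_top T h i).1

theorem sobolevNorm_mono {k l : ℕ} (h : k ≤ l) (f : E) : sobolevNorm T k f ≤ sobolevNorm T l f := by
  by_cases hf : f ∈ sobolevSpace T l
  · rw [sobolevNorm_of_mem T hf, sobolevNorm_of_mem T (sobolevSpace_antitone T h hf)]
    exact Finset.sum_le_sum_of_subset (Finset.range_mono (by omega))
  · rw [sobolevNorm_of_notMem T hf]; exact le_top

theorem enorm_le_sobolevNorm (k : ℕ) (f : E) : ‖f‖ₑ ≤ sobolevNorm T k f := by
  rw [← sobolevNorm_zero T f]; exact sobolevNorm_mono T (Nat.zero_le k) f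

theorem sum_sobolevNorm_genApply_le {k : ℕ} {f : E} (hf : ∀ i, f ∈ (T i).generator.domain) :
    ∑ i, sobolevNorm T k ((T i).genApply f) ≤ sobolevNorm T (k + 1) f := by
  rw [sobolevNorm_succ T hf]; exact le_add_self

theorem sobolevNorm_add_le (k : ℕ) (f g : E) :
    sobolevNorm T k (f + g) ≤ sobolevNorm T k f + sobolevNorm T k g := by
  induction k generalizing f g with
  | zero => simp only [sobolevNorm_zero]; exact enorm_add_le f g
  | succ k ih =>
    by_cases hf : sobolevNorm T (k + 1) f = ⊤
    · rw [hf, top_add]; exact le_top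
    by_cases hg : sobolevNorm T (k + 1) g = ⊤
    · rw [hg, add_top]; exact le_top
    have hf' := mem_domain_of_sobolevNorm_ne_top T hf
    have hg' := mem_domain_of_sobolevNorm_ne_top T hg
    rw [sobolevNorm_succ T hf', sobolevNorm_succ T hg',
      sobolevNorm_succ T fun i => Submodule.add_mem _ (hf' i) (hg' i)]
    calc _ ≤ (‖f‖ₑ + ‖g‖ₑ) + ∑ i, (sobolevNorm T k ((T i).genApply f) +
          sobolevNorm T k ((T i).genApply g)) := by
          gcongr with i
          · exact enorm_add_le f g
          · rw [(T i).genApply_add (hf' i) (hg' i)]; exact ih _ _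
      _ = _ := by rw [Finset.sum_add_distrib]; abel

theorem sobolevNorm_smul_le (k : ℕ) {c : ℝ} (hc : c ≠ 0) (f : E) :
    sobolevNorm T k (c • f) ≤ ‖c‖ₑ * sobolevNorm T k f := by
  induction k generalizing f with
  | zero => simp only [sobolevNorm_zero, enorm_smul]; exact le_rfl
  | succ k ih =>
    by_cases hf : sobolevNorm T (k + 1) f = ⊤
    · rw [hf, ENNReal.mul_top (by simpa using hc)]; exact le_top
    have hf' := mem_domain_of_sobolevNorm_ne_top T hf
    rw [sobolevNorm_succ T hf', sobolevNorm_succ T fun i => Submodule.smul_mem _ c (hf' i),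
      enorm_smul, mul_add, Finset.mul_sum]
    gcongr with i
    rw [(T i).genApply_smul c (hf' i)]
    exact ih _

theorem sobolevNorm_neg_le (k : ℕ) (f : E) : sobolevNorm T k (-f) ≤ sobolevNorm T k f := by
  simpa using sobolevNorm_smul_le T k (c := -1) (by norm_num) f

theorem sobolevNorm_sub_le (k : ℕ) (f g : E) :
    sobolevNorm T k (f - g) ≤ sobolevNorm T k f + sobolevNorm T k g := by
  rw [sub_eq_add_neg]
  exact (sobolevNorm_add_le T k _ _).trans (add_le_add le_rfl (sobolevNorm_neg_le T k g))

theorem mixedDeriv_add {k : ℕ} (j : Fin k → Fin d) {f g : E} (hf : f ∈ sobolevSpace T k)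
    (hg : g ∈ sobolevSpace T k) : mixedDeriv T j (f + g) = mixedDeriv T j f + mixedDeriv T j g := by
  induction k generalizing f g with
  | zero => simp [mixedDeriv_zero]
  | succ k ih =>
    obtain ⟨j', i, rfl⟩ : ∃ (j' : Fin k → Fin d) (i : Fin d), j = Fin.snoc j' i :=
      ⟨Fin.init j, j (Fin.last k), (Fin.snoc_init_self j).symm⟩
    rw [mixedDeriv_snoc, mixedDeriv_snoc, mixedDeriv_snoc,
      (T i).genApply_add (hf i).1 (hg i).1, ih j' (hf i).2 (hg i).2]

theorem sobolevNorm_mixedDeriv_le {k l : ℕ} (j : Fin k → Fin d) {f : E}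
    (hf : f ∈ sobolevSpace T k) :
    sobolevNorm T l (mixedDeriv T j f) ≤ sobolevNorm T (k + l) f := by
  induction k generalizing f with
  | zero => rw [mixedDeriv_zero, Nat.zero_add]
  | succ k ih =>
    obtain ⟨j', i, rfl⟩ : ∃ (j' : Fin k → Fin d) (i : Fin d), j = Fin.snoc j' i :=
      ⟨Fin.init j, j (Fin.last k), (Fin.snoc_init_self j).symm⟩
    rw [mixedDeriv_snoc, show k + 1 + l = (k + l) + 1 by omega]
    refine (ih j' (hf i).2).trans (le_trans ?_
      (sum_sobolevNorm_genApply_le T fun i => (hf i).1))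
    exact Finset.single_le_sum (f := fun i => sobolevNorm T (k + l) ((T i).genApply f))
      (fun _ _ => zero_le) (Finset.mem_univ i)

variable [CompleteSpace E]

/-- The space `E^k` is complete, in the form of countable subadditivity of its norm: the
generators are closed operators. -/
theorem sobolevNorm_le_tsum (k : ℕ) {x : ℕ → E} {f : E}
    (h : Tendsto (fun n => ∑ i ∈ Finset.range n, x i) atTop (𝓝 f)) :
    sobolevNorm T k f ≤ ∑' n, sobolevNorm T k (x n) := by
  induction k generalizing x f with
  | zero =>
    simp only [sobolevNorm_zero]
    refine le_of_tendsto ((continuous_enorm.tendsto f).comp h) (Eventually.of_forall fun n => ?_)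
    exact (enorm_sum_le _ _).trans (ENNReal.sum_le_tsum _)
  | succ k ih =>
    by_cases ht : ∑' n, sobolevNorm T (k + 1) (x n) = ⊤
    · rw [ht]; exact le_top
    have hx : ∀ n i, x n ∈ (T i).generator.domain := fun n =>
      mem_domain_of_sobolevNorm_ne_top T (ENNReal.ne_top_of_tsum_ne_top ht n)
    have hsum : ∀ i, Summable fun n => (T i).genApply (x n) := by
      intro i
      refine Summable.of_enorm (ne_top_of_le_ne_top ht (ENNReal.tsum_le_tsum fun n => ?_))
      refine ((enorm_le_sobolevNorm T k _).trans ?_).trans (sum_sobolevNorm_genApply_le T (hx n))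
      exact Finset.single_le_sum (f := fun i => sobolevNorm T k ((T i).genApply (x n)))
        (fun _ _ => zero_le) (Finset.mem_univ i)
    have hpart : ∀ i n, (∑ m ∈ Finset.range n, x m) ∈ (T i).generator.domain :=
      fun i n => Submodule.sum_mem _ fun m _ => hx m i
    have hgen : ∀ i n, (T i).genApply (∑ m ∈ Finset.range n, x m) =
        ∑ m ∈ Finset.range n, (T i).genApply (x m) := by
      intro i n
      induction n with
      | zero =>
        simpa using (T i).genApply_smul 0 (Submodule.zero_mem (T i).generator.domain)
      | succ n ihn =>
        rw [Finset.sum_range_succ, (T i).genApply_add (hpart i n) (hx n i), ihn,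
          Finset.sum_range_succ]
    have hlim : ∀ i, Tendsto (fun n => ∑ m ∈ Finset.range n, (T i).genApply (x m)) atTop
        (𝓝 (∑' m, (T i).genApply (x m))) := fun i => (hsum i).hasSum.tendsto_sum_nat
    have hclosed := fun i => (T i).tendsto_of_closed (hpart i) h
      ((hlim i).congr fun n => (hgen i n).symm)
    rw [sobolevNorm_succ T fun i => (T i).mem_domain_of_tendsto (hclosed i)]
    calc _ ≤ ∑' n, ‖x n‖ₑ + ∑ i, ∑' n, sobolevNorm T k ((T i).genApply (x n)) := by
          gcongr with i
          · refine le_of_tendsto ((continuous_enorm.tendsto f).comp h)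
              (Eventually.of_forall fun n => ?_)
            exact (enorm_sum_le _ _).trans (ENNReal.sum_le_tsum _)
          · rw [(T i).genApply_eq_of_tendsto (hclosed i)]
            exact ih (hlim i)
      _ = ∑' n, sobolevNorm T (k + 1) (x n) := by
          simp_rw [fun n => sobolevNorm_succ T (k := k) (hx n)]
          rw [ENNReal.tsum_add, Summable.tsum_finsetSum fun _ _ => ENNReal.summable]

/-- One step of the interpolation inequality between the Sobolev norms. -/
theorem sobolevNorm_interp_step (k : ℕ) : ∃ C : ℝ, 1 ≤ C ∧ ∀ (s : ℝ), 0 < s → s ≤ 1 → ∀ f : E,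
    sobolevNorm T (k + 1) f ≤ ENNReal.ofReal C * (ENNReal.ofReal s⁻¹ * sobolevNorm T k f +
      ENNReal.ofReal s * sobolevNorm T (k + 2) f) := by
  have triv : ∀ {C s : ℝ}, 1 ≤ C → 0 < s → ∀ {a b : ℝ≥0∞}, b = ⊤ → ∀ {c : ℝ≥0∞},
      c ≤ ENNReal.ofReal C * (a + ENNReal.ofReal s * b) := by
    intro C s hC hs a b hb c
    have h1 : ENNReal.ofReal C ≠ 0 := by simp; linarith
    have h2 : ENNReal.ofReal s ≠ 0 := by simpa using hs
    rw [hb, ENNReal.mul_top h2, add_top, ENNReal.mul_top h1]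
    exact le_top
  induction k with
  | zero =>
    refine ⟨1 + 2 * d, by linarith [(Nat.cast_nonneg d : (0 : ℝ) ≤ d)], fun s hs hs1 f => ?_⟩
    by_cases hf : sobolevNorm T (0 + 2) f = ⊤
    · exact triv (by linarith [(Nat.cast_nonneg d : (0 : ℝ) ≤ d)]) hs hf
    have hf' := mem_domain_of_sobolevNorm_ne_top T hf
    have hf2 := mem_of_sobolevNorm_ne_top T hf
    have hD : ∀ i, ‖(T i).genApply f‖ₑ ≤ ENNReal.ofReal (2 * s⁻¹) * ‖f‖ₑ +
        ENNReal.ofReal s * sobolevNorm T 1 ((T i).genApply f) := by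
      intro i
      have h1 := (T i).norm_genApply_le hs (hf' i) ((hf2 i).2 i).1
      have h2 : ‖(T i).genApply ((T i).genApply f)‖ₑ ≤ sobolevNorm T 1 ((T i).genApply f) := by
        refine (enorm_le_sobolevNorm T 0 _).trans (le_trans ?_
          (sum_sobolevNorm_genApply_le T fun l => ((hf2 i).2 l).1))
        exact Finset.single_le_sum
          (f := fun l => sobolevNorm T 0 ((T l).genApply ((T i).genApply f)))
          (fun _ _ => zero_le) (Finset.mem_univ i)
      refine le_trans ?_ (add_le_add le_rfl (mul_le_mul_right h2 _))
      simp only [← ofReal_norm]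
      rw [← ENNReal.ofReal_mul (by positivity), ← ENNReal.ofReal_mul (by positivity),
        ← ENNReal.ofReal_add (by positivity) (by positivity)]
      exact ENNReal.ofReal_le_ofReal h1
    have hs' : 1 ≤ s⁻¹ := (one_le_inv₀ hs).2 hs1
    rw [sobolevNorm_succ T hf', sobolevNorm_zero]
    simp only [sobolevNorm_zero]
    have hone : (1 : ℝ≥0∞) ≤ ENNReal.ofReal (1 + 2 * d) := by
      rw [← ENNReal.ofReal_one]
      exact ENNReal.ofReal_le_ofReal (by linarith [(Nat.cast_nonneg d : (0 : ℝ) ≤ d)])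
    calc ‖f‖ₑ + ∑ i, ‖(T i).genApply f‖ₑ
        ≤ ENNReal.ofReal s⁻¹ * ‖f‖ₑ + ∑ i, (ENNReal.ofReal (2 * s⁻¹) * ‖f‖ₑ +
            ENNReal.ofReal s * sobolevNorm T 1 ((T i).genApply f)) := by
          gcongr with i
          · refine le_mul_of_one_le_left' ?_
            rw [← ENNReal.ofReal_one]
            exact ENNReal.ofReal_le_ofReal hs'
          · exact hD i
      _ = ENNReal.ofReal (1 + 2 * d) * (ENNReal.ofReal s⁻¹ * ‖f‖ₑ) +
            ENNReal.ofReal s * ∑ i, sobolevNorm T 1 ((T i).genApply f) := by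
          rw [Finset.sum_add_distrib, ← add_assoc, Finset.mul_sum, Finset.sum_const,
            Finset.card_univ, Fintype.card_fin, nsmul_eq_mul,
            ENNReal.ofReal_add zero_le_one (by positivity), ENNReal.ofReal_mul zero_le_two,
            ENNReal.ofReal_mul zero_le_two, ENNReal.ofReal_natCast, ENNReal.ofReal_one]
          ring
      _ ≤ _ := by
          rw [mul_add]
          exact add_le_add le_rfl ((mul_le_mul_right (sum_sobolevNorm_genApply_le T hf') _).trans
            (le_mul_of_one_le_left' hone))
  | succ k ih =>
    obtain ⟨C, hC, ih⟩ := ih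
    refine ⟨1 + C, by linarith, fun s hs hs1 f => ?_⟩
    by_cases hf : sobolevNorm T (k + 1 + 2) f = ⊤
    · exact triv (by linarith) hs hf
    have hf' := mem_domain_of_sobolevNorm_ne_top T hf
    have hs' : 1 ≤ s⁻¹ := (one_le_inv₀ hs).2 hs1
    rw [sobolevNorm_succ T hf']
    calc _ ≤ ENNReal.ofReal s⁻¹ * sobolevNorm T (k + 1) f +
          ∑ i, ENNReal.ofReal C * (ENNReal.ofReal s⁻¹ * sobolevNorm T k ((T i).genApply f) +
          ENNReal.ofReal s * sobolevNorm T (k + 2) ((T i).genApply f)) := by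
          gcongr with i
          · refine le_trans (enorm_le_sobolevNorm T (k + 1) f) (le_mul_of_one_le_left' ?_)
            rw [← ENNReal.ofReal_one]
            exact ENNReal.ofReal_le_ofReal hs'
          · exact ih s hs hs1 _
      _ = ENNReal.ofReal s⁻¹ * sobolevNorm T (k + 1) f +
          ENNReal.ofReal C * (ENNReal.ofReal s⁻¹ * ∑ i, sobolevNorm T k ((T i).genApply f) +
          ENNReal.ofReal s * ∑ i, sobolevNorm T (k + 2) ((T i).genApply f)) := by
          rw [← Finset.mul_sum, Finset.sum_add_distrib, ← Finset.mul_sum, ← Finset.mul_sum]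
      _ ≤ (ENNReal.ofReal s⁻¹ * sobolevNorm T (k + 1) f +
            ENNReal.ofReal s * sobolevNorm T (k + 1 + 2) f) +
          ENNReal.ofReal C * (ENNReal.ofReal s⁻¹ * sobolevNorm T (k + 1) f +
          ENNReal.ofReal s * sobolevNorm T (k + 1 + 2) f) := by
          gcongr
          · exact le_self_add
          · exact sum_sobolevNorm_genApply_le T hf'
          · exact sum_sobolevNorm_genApply_le T hf'
      _ = _ := by
          rw [ENNReal.ofReal_add zero_le_one (by linarith), ENNReal.ofReal_one]
          ring

/-- The interpolation inequality between the Sobolev norms. -/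
theorem sobolevNorm_interp (r : ℕ) : ∀ k ≤ r, ∃ C : ℝ, 1 ≤ C ∧ ∀ (s : ℝ), 0 < s → s ≤ 1 →
    ∀ f : E, sobolevNorm T k f ≤ ENNReal.ofReal C * (ENNReal.ofReal (s⁻¹ ^ k) * ‖f‖ₑ +
      ENNReal.ofReal (s ^ (r - k)) * sobolevNorm T r f) := by
  -- the case `k = r` is trivial
  have top : ∀ r, ∀ (s : ℝ), 0 < s → s ≤ 1 → ∀ f : E, sobolevNorm T r f ≤ ENNReal.ofReal 1 *
      (ENNReal.ofReal (s⁻¹ ^ r) * ‖f‖ₑ + ENNReal.ofReal (s ^ (r - r)) * sobolevNorm T r f) := by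
    intro r s _ _ f
    simp
  induction r with
  | zero =>
    intro k hk
    obtain rfl : k = 0 := by omega
    exact ⟨1, le_rfl, top 0⟩
  | succ r ih =>
    -- the inequality for `k = r`, by absorption of `‖f‖_{E^r}` in the left-hand side
    have key : ∃ C : ℝ, 1 ≤ C ∧ ∀ (s : ℝ), 0 < s → s ≤ 1 →
        ∀ f : E, sobolevNorm T r f ≤ ENNReal.ofReal C * (ENNReal.ofReal (s⁻¹ ^ r) * ‖f‖ₑ +
          ENNReal.ofReal s * sobolevNorm T (r + 1) f) := by
      cases r with
      | zero =>
        refine ⟨1, le_rfl, fun s _ _ f => ?_⟩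
        simp [sobolevNorm_zero]
      | succ m =>
        obtain ⟨C, hC, hstep⟩ := sobolevNorm_interp_step T m
        obtain ⟨C', hC', hih⟩ := ih m (Nat.le_succ m)
        have hC0 : 0 < C := by linarith
        have hC'0 : 0 < C' := by linarith
        set δ : ℝ := (2 * C * C')⁻¹ with hδ
        have hCC : 1 ≤ C * C' := one_le_mul_of_one_le_of_one_le hC hC'
        have hδ0 : 0 < δ := by positivity
        have hδ1 : δ ≤ 1 := inv_le_one_of_one_le₀ (by nlinarith)
        refine ⟨2 * C * C' * (δ⁻¹ ^ m), ?_, fun s hs hs1 f => ?_⟩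
        · have : 1 ≤ δ⁻¹ ^ m := one_le_pow₀ ((one_le_inv₀ hδ0).2 hδ1)
          nlinarith
        by_cases hf : sobolevNorm T (m + 1 + 1) f = ⊤
        · have h1 : ENNReal.ofReal s ≠ 0 := by simpa using hs
          have h2 : ENNReal.ofReal (2 * C * C' * (δ⁻¹ ^ m)) ≠ 0 := by
            simp only [ne_eq, ENNReal.ofReal_eq_zero, not_le]; positivity
          rw [hf, ENNReal.mul_top h1, add_top, ENNReal.mul_top h2]
          exact le_top
        have hfr := ne_top_of_le_ne_top hf (sobolevNorm_mono T (Nat.le_succ (m + 1)) f)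
        have hfm := ne_top_of_le_ne_top hfr (sobolevNorm_mono T (Nat.le_succ m) f)
        have h1 := hstep s hs hs1 f
        have h2 := hih (δ * s) (by positivity) (by nlinarith) f
        rw [show m + 1 - m = 1 by omega, pow_one] at h2
        lift sobolevNorm T (m + 1) f to NNReal using hfr with a
        lift sobolevNorm T m f to NNReal using hfm with b
        lift sobolevNorm T (m + 1 + 1) f to NNReal using hf with c
        have hn : ‖f‖ₑ = ENNReal.ofReal ‖f‖ := (ofReal_norm f).symm
        rw [hn] at h2 ⊢
        simp only [← ENNReal.ofReal_coe_nnreal] at h1 h2 ⊢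
        rw [← ENNReal.ofReal_mul (by positivity), ← ENNReal.ofReal_mul (by positivity),
          ← ENNReal.ofReal_add (by positivity) (by positivity), ← ENNReal.ofReal_mul hC0.le,
          ENNReal.ofReal_le_ofReal_iff (by positivity)] at h1
        rw [← ENNReal.ofReal_mul (by positivity), ← ENNReal.ofReal_mul (by positivity),
          ← ENNReal.ofReal_add (by positivity) (by positivity), ← ENNReal.ofReal_mul hC'0.le,
          ENNReal.ofReal_le_ofReal_iff (by positivity)] at h2
        rw [← ENNReal.ofReal_mul (by positivity), ← ENNReal.ofReal_mul (by positivity),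
          ← ENNReal.ofReal_add (by positivity) (by positivity),
          ← ENNReal.ofReal_mul (by positivity)]
        refine ENNReal.ofReal_le_ofReal ?_
        have h3 : (a : ℝ) ≤ C * (s⁻¹ * (C' * ((δ * s)⁻¹ ^ m * ‖f‖ + δ * s * a)) + s * c) :=
          h1.trans (by gcongr)
        have h4 : C * (s⁻¹ * (C' * ((δ * s)⁻¹ ^ m * ‖f‖ + δ * s * a)) + s * c) =
            C * C' * δ⁻¹ ^ m * (s⁻¹ ^ (m + 1) * ‖f‖) + C * s * c + (C * C' * δ) * a := by
          rw [mul_inv, mul_pow, pow_succ s⁻¹]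
          field_simp
          ring
        have h5 : C * C' * δ = 1 / 2 := by rw [hδ]; field_simp
        rw [h4, h5] at h3
        have h6 : (a : ℝ) ≤ 2 * (C * C' * δ⁻¹ ^ m * (s⁻¹ ^ (m + 1) * ‖f‖) + C * s * c) := by
          linarith
        refine h6.trans ?_
        have h7 : C * s * c ≤ C * C' * δ⁻¹ ^ m * (s * c) := by
          have : 1 ≤ δ⁻¹ ^ m := one_le_pow₀ ((one_le_inv₀ hδ0).2 hδ1)
          have : C ≤ C * C' * δ⁻¹ ^ m := by
            rw [mul_assoc]
            exact le_mul_of_one_le_right hC0.le (one_le_mul_of_one_le_of_one_le hC' this)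
          rw [mul_assoc C]
          exact mul_le_mul_of_nonneg_right this (by positivity)
        linarith
    intro k hk
    rcases Nat.lt_or_ge r k with hlt | hle
    · obtain rfl : k = r + 1 := by omega
      exact ⟨1, le_rfl, top (r + 1)⟩
    obtain ⟨C, hC, hkey⟩ := key
    obtain ⟨C', hC', hih⟩ := ih k hle
    refine ⟨C' * (1 + C), by nlinarith, fun s hs hs1 f => ?_⟩
    have hs' : 1 ≤ s⁻¹ := (one_le_inv₀ hs).2 hs1
    have e1 : ENNReal.ofReal (s ^ (r - k)) * ENNReal.ofReal (s⁻¹ ^ r) =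
        ENNReal.ofReal (s⁻¹ ^ k) := by
      rw [← ENNReal.ofReal_mul (by positivity)]
      congr 1
      obtain ⟨m, rfl⟩ := Nat.exists_eq_add_of_le hle
      rw [Nat.add_sub_cancel_left, pow_add, mul_comm (s⁻¹ ^ k), ← mul_assoc, ← mul_pow,
        mul_inv_cancel₀ hs.ne', one_pow, one_mul]
    have e2 : ENNReal.ofReal (s ^ (r - k)) * ENNReal.ofReal s =
        ENNReal.ofReal (s ^ (r + 1 - k)) := by
      rw [← ENNReal.ofReal_mul (by positivity), ← pow_succ]
      congr 2
      omega
    calc sobolevNorm T k f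
        ≤ ENNReal.ofReal C' * (ENNReal.ofReal (s⁻¹ ^ k) * ‖f‖ₑ +
          ENNReal.ofReal (s ^ (r - k)) * sobolevNorm T r f) := hih s hs hs1 f
      _ ≤ ENNReal.ofReal C' * (ENNReal.ofReal (s⁻¹ ^ k) * ‖f‖ₑ +
          ENNReal.ofReal (s ^ (r - k)) * (ENNReal.ofReal C * (ENNReal.ofReal (s⁻¹ ^ r) * ‖f‖ₑ +
          ENNReal.ofReal s * sobolevNorm T (r + 1) f))) := by
          gcongr
          exact hkey s hs hs1 f
      _ = ENNReal.ofReal C' * (ENNReal.ofReal (s⁻¹ ^ k) * ‖f‖ₑ + ENNReal.ofReal C *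
          ((ENNReal.ofReal (s ^ (r - k)) * ENNReal.ofReal (s⁻¹ ^ r)) * ‖f‖ₑ +
          (ENNReal.ofReal (s ^ (r - k)) * ENNReal.ofReal s) * sobolevNorm T (r + 1) f)) := by
          ring
      _ = ENNReal.ofReal C' * (ENNReal.ofReal (s⁻¹ ^ k) * ‖f‖ₑ + ENNReal.ofReal C *
          (ENNReal.ofReal (s⁻¹ ^ k) * ‖f‖ₑ +
          ENNReal.ofReal (s ^ (r + 1 - k)) * sobolevNorm T (r + 1) f)) := by rw [e1, e2]
      _ ≤ ENNReal.ofReal C' * ((ENNReal.ofReal (s⁻¹ ^ k) * ‖f‖ₑ +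
          ENNReal.ofReal (s ^ (r + 1 - k)) * sobolevNorm T (r + 1) f) + ENNReal.ofReal C *
          (ENNReal.ofReal (s⁻¹ ^ k) * ‖f‖ₑ +
          ENNReal.ofReal (s ^ (r + 1 - k)) * sobolevNorm T (r + 1) f)) := by
          gcongr
          exact le_self_add
      _ = _ := by
          rw [ENNReal.ofReal_mul (by linarith), ENNReal.ofReal_add zero_le_one (by linarith),
            ENNReal.ofReal_one]
          ring

end Sobolev

/-! ### Moduli of continuity and operators of a given order of vanishing -/

section Modulus

variable {E : Type*} [NormedAddCommGroup E] [NormedSpace ℝ E] {d : ℕ}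
  (T : Fin d → ContractionSemigroup E)

/-- A recursive form of the mixed modulus of continuity: the supremum, over all indices and all
steps in `[0, s]`, of the norm of the `n`-fold differences of `f`; for `n = 0` it is the norm. -/
noncomputable def supModulus (s : ℝ) : ℕ → E → ℝ≥0∞
  | 0, f => ‖f‖ₑ
  | n + 1, f => ⨆ (i : Fin d) (τ : ℝ) (_ : τ ∈ Icc 0 s), supModulus s n ((T i).op τ f - f)

theorem supModulus_zero (s : ℝ) (f : E) : supModulus T s 0 f = ‖f‖ₑ := rfl

theorem supModulus_diff_le {s τ : ℝ} (hτ : τ ∈ Icc 0 s) (n : ℕ) (i : Fin d) (f : E) :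
    supModulus T s n ((T i).op τ f - f) ≤ supModulus T s (n + 1) f :=
  le_iSup_of_le i (le_iSup_of_le τ (le_iSup_of_le hτ le_rfl))

theorem supModulus_succ_le {s : ℝ} {n : ℕ} {f : E} {B : ℝ≥0∞}
    (h : ∀ i, ∀ τ ∈ Icc 0 s, supModulus T s n ((T i).op τ f - f) ≤ B) :
    supModulus T s (n + 1) f ≤ B :=
  iSup_le fun i => iSup_le fun τ => iSup_le fun hτ => h i τ hτ

theorem supModulus_add_le (s : ℝ) (n : ℕ) (f g : E) :
    supModulus T s n (f + g) ≤ supModulus T s n f + supModulus T s n g := by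
  induction n generalizing f g with
  | zero => exact enorm_add_le f g
  | succ n ih =>
    refine supModulus_succ_le T fun i τ hτ => ?_
    have : (T i).op τ (f + g) - (f + g) = ((T i).op τ f - f) + ((T i).op τ g - g) := by
      rw [map_add]; abel
    rw [this]
    exact (ih _ _).trans
      (add_le_add (supModulus_diff_le T hτ n i f) (supModulus_diff_le T hτ n i g))

theorem supModulus_smul_le (s : ℝ) (n : ℕ) (c : ℝ) (f : E) :
    supModulus T s n (c • f) ≤ ‖c‖ₑ * supModulus T s n f := by
  induction n generalizing f with
  | zero => exact (enorm_smul c f).le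
  | succ n ih =>
    refine supModulus_succ_le T fun i τ hτ => ?_
    rw [map_smul, ← smul_sub]
    exact (ih _).trans (mul_le_mul_right (supModulus_diff_le T hτ n i f) _)

theorem supModulus_neg_le (s : ℝ) (n : ℕ) (f : E) :
    supModulus T s n (-f) ≤ supModulus T s n f := by
  simpa using supModulus_smul_le T s n (-1) f

theorem supModulus_sub_le (s : ℝ) (n : ℕ) (f g : E) :
    supModulus T s n (f - g) ≤ supModulus T s n f + supModulus T s n g := by
  rw [sub_eq_add_neg]
  exact (supModulus_add_le T s n _ _).trans (add_le_add le_rfl (supModulus_neg_le T s n g))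

theorem supModulus_succ_le_two_mul (s : ℝ) (n : ℕ) (f : E) :
    supModulus T s (n + 1) f ≤ 2 * supModulus T s n f := by
  induction n generalizing f with
  | zero =>
    refine supModulus_succ_le T fun i τ hτ => (enorm_sub_le).trans ?_
    rw [two_mul]
    refine add_le_add ?_ le_rfl
    rw [supModulus_zero, enorm_le_iff_norm_le]
    exact (T i).norm_op_apply_le hτ.1 f
  | succ n ih =>
    refine supModulus_succ_le T fun i τ hτ => (ih _).trans ?_
    exact mul_le_mul_right (supModulus_diff_le T hτ n i f) _

theorem supModulus_add_right_le (s : ℝ) (n m : ℕ) (f : E) :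
    supModulus T s (n + m) f ≤ 2 ^ m * supModulus T s n f := by
  induction m with
  | zero => simp
  | succ m ih =>
    rw [← add_assoc, pow_succ', mul_assoc]
    exact (supModulus_succ_le_two_mul T s (n + m) f).trans (mul_le_mul_right ih _)

theorem supModulus_le_enorm (s : ℝ) (n : ℕ) (f : E) :
    supModulus T s n f ≤ 2 ^ n * ‖f‖ₑ := by
  simpa [supModulus_zero] using supModulus_add_right_le T s 0 n f

theorem supModulus_op_le {s τ : ℝ} (hτ : τ ∈ Icc 0 s) (n : ℕ) (i : Fin d) (f : E) :
    supModulus T s n ((T i).op τ f) ≤ 3 * supModulus T s n f := by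
  have h : (T i).op τ f = f + ((T i).op τ f - f) := by abel
  rw [h]
  refine (supModulus_add_le T s n _ _).trans ?_
  have h2 := (supModulus_diff_le T hτ n i f).trans (supModulus_succ_le_two_mul T s n f)
  calc _ ≤ supModulus T s n f + 2 * supModulus T s n f := add_le_add le_rfl h2
    _ = 3 * supModulus T s n f := by ring

theorem supModulus_sum_le {ι : Type*} (u : Finset ι) (s : ℝ) (n : ℕ) (F : ι → E) :
    supModulus T s n (∑ i ∈ u, F i) ≤ ∑ i ∈ u, supModulus T s n (F i) := by
  classical
  induction u using Finset.induction_on with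
  | empty =>
    simp only [Finset.sum_empty]
    simpa using supModulus_smul_le T s n 0 (0 : E)
  | insert a u ha ih =>
    rw [Finset.sum_insert ha, Finset.sum_insert ha]
    exact (supModulus_add_le T s n _ _).trans (add_le_add le_rfl ih)

theorem supModulus_integral_le [CompleteSpace E] {X : Type*} [MeasurableSpace X] {μ : Measure X}
    (s : ℝ) (n : ℕ) {F : X → E} (hF : Integrable F μ) :
    supModulus T s n (∫ x, F x ∂μ) ≤ ∫⁻ x, supModulus T s n (F x) ∂μ := by
  induction n generalizing F with
  | zero => exact enorm_integral_le_lintegral_enorm F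
  | succ n ih =>
    refine supModulus_succ_le T fun i τ hτ => ?_
    have hF' : Integrable (fun x => (T i).op τ (F x)) μ :=
      ((T i).op τ).integrable_comp hF
    rw [← ((T i).op τ).integral_comp_comm hF, ← integral_sub hF' hF]
    exact (ih (hF'.sub hF)).trans (lintegral_mono fun x => supModulus_diff_le T hτ n i (F x))

theorem prod_ofFn_snoc {n : ℕ} (j : Fin n → Fin d) (i : Fin d) (τ : Fin n → ℝ) (t : ℝ) (f : E) :
    (List.ofFn fun l => (T ((Fin.snoc j i : Fin (n + 1) → Fin d) l)).op
        ((Fin.snoc τ t : Fin (n + 1) → ℝ) l) - 1).prod f =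
      (List.ofFn fun l => (T (j l)).op (τ l) - 1).prod ((T i).op t f - f) := by
  rw [List.ofFn_succ']
  simp [List.concat_eq_append]

theorem mixedModulus_le (s : ℝ) (n : ℕ) (f : E) :
    mixedModulus T n s f ≤ (d : ℝ≥0∞) ^ n * supModulus T s n f := by
  have key : ∀ (n : ℕ) (f : E) (j : Fin n → Fin d) (τ : Fin n → ℝ), (∀ i, τ i ∈ Icc 0 s) →
      ‖(List.ofFn fun i => (T (j i)).op (τ i) - 1).prod f‖ₑ ≤ supModulus T s n f := by
    intro n
    induction n with
    | zero => intro f j τ _; simp [supModulus_zero]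
    | succ n ih =>
      intro f j τ hτ
      have h := prod_ofFn_snoc T (Fin.init j) (j (Fin.last n)) (Fin.init τ) (τ (Fin.last n)) f
      rw [Fin.snoc_init_self, Fin.snoc_init_self] at h
      rw [h]
      exact (ih _ _ _ fun i => hτ i.castSucc).trans (supModulus_diff_le T (hτ _) n _ f)
  calc mixedModulus T n s f ≤ ∑ _j : Fin n → Fin d, supModulus T s n f :=
        Finset.sum_le_sum fun j _ => iSup_le fun τ => iSup_le fun hτ => key n f j τ hτ
    _ = _ := by simp

theorem supModulus_le_mixedModulus (s : ℝ) (n : ℕ) (f : E) :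
    supModulus T s n f ≤ mixedModulus T n s f := by
  induction n generalizing f with
  | zero =>
    rw [mixedModulus, Fintype.sum_unique]
    refine le_iSup_of_le Fin.elim0 (le_iSup_of_le (fun i => i.elim0) ?_)
    simp [supModulus_zero]
  | succ n ih =>
    refine supModulus_succ_le T fun i τ hτ => (ih _).trans ?_
    rw [mixedModulus, mixedModulus, sum_fin_snoc]
    refine le_trans ?_ (Finset.single_le_sum (fun _ _ => zero_le) (Finset.mem_univ i))
    refine Finset.sum_le_sum fun j _ => iSup_le fun σ => iSup_le fun hσ => ?_
    refine le_iSup_of_le (Fin.snoc σ τ) (le_iSup_of_le (fun l => ?_) ?_)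
    · refine Fin.lastCases ?_ (fun l => ?_) l
      · rw [Fin.snoc_last]; exact hτ
      · rw [Fin.snoc_castSucc]; exact hσ l
    · rw [prod_ofFn_snoc]

theorem mixedModulus_mono {s s' : ℝ} (h : s ≤ s') (n : ℕ) (f : E) :
    mixedModulus T n s f ≤ mixedModulus T n s' f := by
  refine Finset.sum_le_sum fun j _ => iSup_le fun τ => iSup_le fun hτ => ?_
  exact le_iSup_of_le τ (le_iSup_of_le (fun i => ⟨(hτ i).1, (hτ i).2.trans h⟩) le_rfl)

/-- The bounded operator `A` vanishes to order `n` at the scale `s`, with constant `C`: it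
behaves like `C` times an `n`-fold difference with steps in `[0, s]`. -/
def VanishesToOrder (s : ℝ) (n : ℕ) (C : NNReal) (A : E →L[ℝ] E) : Prop :=
  ∀ m f, supModulus T s m (A f) ≤ C * supModulus T s (m + n) f

variable {T}

namespace VanishesToOrder

variable {s : ℝ} {n m : ℕ} {C C' : NNReal} {A B : E →L[ℝ] E}

theorem one : VanishesToOrder T s 0 1 (1 : E →L[ℝ] E) := fun m f => by simp

theorem mono (h : VanishesToOrder T s n C A) (hC : C ≤ C') : VanishesToOrder T s n C' A :=
  fun m f => (h m f).trans (by gcongr)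

theorem mul (hA : VanishesToOrder T s n C A) (hB : VanishesToOrder T s m C' B) :
    VanishesToOrder T s (n + m) (C * C') (A * B) := fun l f => by
  refine (hA l (B f)).trans ?_
  rw [ENNReal.coe_mul, mul_assoc, ← add_assoc]
  exact mul_le_mul_right (hB _ f) _

theorem add (hA : VanishesToOrder T s n C A) (hB : VanishesToOrder T s n C' B) :
    VanishesToOrder T s n (C + C') (A + B) := fun l f => by
  rw [ENNReal.coe_add, add_mul]
  exact (supModulus_add_le T s l _ _).trans (add_le_add (hA l f) (hB l f))

theorem sub (hA : VanishesToOrder T s n C A) (hB : VanishesToOrder T s n C' B) :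
    VanishesToOrder T s n (C + C') (A - B) := fun l f => by
  rw [ENNReal.coe_add, add_mul]
  exact (supModulus_sub_le T s l _ _).trans (add_le_add (hA l f) (hB l f))

theorem pow (hA : VanishesToOrder T s n C A) (k : ℕ) :
    VanishesToOrder T s (k * n) (C ^ k) (A ^ k) := by
  induction k with
  | zero => simpa using one
  | succ k ih =>
    rw [pow_succ, pow_succ, Nat.succ_mul]
    exact ih.mul hA

theorem sum {ι : Type*} (u : Finset ι) {c : ι → NNReal} {A : ι → E →L[ℝ] E}
    (h : ∀ i ∈ u, VanishesToOrder T s n (c i) (A i)) :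
    VanishesToOrder T s n (∑ i ∈ u, c i) (∑ i ∈ u, A i) := fun l f => by
  rw [sum_apply, ENNReal.ofNNReal_finsetSum, Finset.sum_mul]
  exact (supModulus_sum_le T u s l _).trans (Finset.sum_le_sum fun i hi => h i hi l f)

theorem op {τ : ℝ} (hτ : τ ∈ Icc 0 s) (i : Fin d) : VanishesToOrder T s 0 3 ((T i).op τ) :=
  fun m f => by simpa using supModulus_op_le T hτ m i f

theorem op_sub_one {τ : ℝ} (hτ : τ ∈ Icc 0 s) (i : Fin d) :
    VanishesToOrder T s 1 1 ((T i).op τ - 1) := fun m f => by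
  simpa using supModulus_diff_le T hτ m i f

end VanishesToOrder

variable (T) [CompleteSpace E]

/-- A difference of a differentiable vector is at most the step times the derivative; no
commutation of the semigroups is needed. -/
theorem supModulus_succ_le_genApply {s : ℝ} (n : ℕ) {f : E}
    (hf : ∀ i, f ∈ (T i).generator.domain) :
    supModulus T s (n + 1) f ≤
      ENNReal.ofReal (3 * s) * ∑ i, supModulus T s n ((T i).genApply f) := by
  refine supModulus_succ_le T fun i τ hτ => ?_
  rw [← (T i).integral_op_genApply hτ.1 (hf i), intervalIntegral.integral_of_le hτ.1]
  refine (supModulus_integral_le T s n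
    ((T i).intervalIntegrable_op le_rfl hτ.1 _).1).trans ?_
  calc ∫⁻ u in Ioc 0 τ, supModulus T s n ((T i).op u ((T i).genApply f))
      ≤ ∫⁻ u in Ioc 0 τ, 3 * supModulus T s n ((T i).genApply f) :=
        setLIntegral_mono' measurableSet_Ioc fun u hu =>
          supModulus_op_le T ⟨hu.1.le, hu.2.trans hτ.2⟩ n i _
    _ = ENNReal.ofReal (3 * τ) * supModulus T s n ((T i).genApply f) := by
        rw [setLIntegral_const, Real.volume_Ioc, sub_zero,
          ENNReal.ofReal_mul (by norm_num : (0 : ℝ) ≤ 3), ENNReal.ofReal_ofNat]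
        ring
    _ ≤ _ := by
        gcongr
        · exact hτ.2
        · exact Finset.single_le_sum (f := fun i => supModulus T s n ((T i).genApply f))
            (fun _ _ => zero_le) (Finset.mem_univ i)

/-- The modulus of order `n + m` is bounded by the moduli of order `n` of the derivatives of
order `m`. -/
theorem supModulus_add_le_mixedDeriv {s : ℝ} (hs : 0 ≤ s) (n m : ℕ) {f : E}
    (hf : f ∈ sobolevSpace T m) :
    supModulus T s (n + m) f ≤ ENNReal.ofReal ((3 * s) ^ m) *
      ∑ j : Fin m → Fin d, supModulus T s n (mixedDeriv T j f) := by
  induction m generalizing f with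
  | zero => simp [mixedDeriv_zero]
  | succ m ih =>
    rw [← add_assoc, sum_mixedDeriv_succ T m (supModulus T s n) f]
    refine (supModulus_succ_le_genApply T (n + m) fun i => (hf i).1).trans ?_
    rw [pow_succ', ENNReal.ofReal_mul (p := 3 * s) (by positivity), mul_assoc]
    refine mul_le_mul_right ?_ _
    rw [Finset.mul_sum]
    exact Finset.sum_le_sum fun i _ => ih (hf i).2

theorem supModulus_le_sobolevNorm {s : ℝ} (hs : 0 ≤ s) (m : ℕ) {f : E}
    (hf : f ∈ sobolevSpace T m) :
    supModulus T s m f ≤ ENNReal.ofReal ((3 * s) ^ m) * sobolevNorm T m f := by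
  have h := supModulus_add_le_mixedDeriv T hs 0 m hf
  rw [Nat.zero_add] at h
  refine h.trans (mul_le_mul_right ?_ _)
  rw [sobolevNorm_of_mem T hf]
  exact Finset.single_le_sum (f := fun l => ∑ j : Fin l → Fin d, ‖mixedDeriv T j f‖ₑ)
    (fun _ _ => zero_le) (Finset.self_mem_range_succ m)

end Modulus

/-! ### Taylor expansion of an orbit up to the modulus of continuity -/

namespace ContractionSemigroup

variable {E : Type*} [NormedAddCommGroup E] [NormedSpace ℝ E]
  (S : ContractionSemigroup E)

/-- The Steklov average `s⁻¹ ∫₀ˢ T(u) du`. -/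
noncomputable def steklov {s : ℝ} (hs : 0 < s) : E →L[ℝ] E :=
  LinearMap.mkContinuous
    { toFun := fun g => s⁻¹ • ∫ u in (0 : ℝ)..s, S.op u g
      map_add' := fun f g => by
        simp only [map_add]
        rw [intervalIntegral.integral_add (S.intervalIntegrable_op le_rfl hs.le _)
          (S.intervalIntegrable_op le_rfl hs.le _), smul_add]
      map_smul' := fun c g => by
        simp only [map_smul, intervalIntegral.integral_smul, RingHom.id_apply]
        rw [smul_comm] } 1 fun g => by
      have h : ‖∫ u in (0 : ℝ)..s, S.op u g‖ ≤ ‖g‖ * |s - 0| :=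
        intervalIntegral.norm_integral_le_of_norm_le_const fun u hu => by
          rw [uIoc_of_le hs.le] at hu
          exact S.norm_op_apply_le hu.1.le g
      rw [sub_zero, abs_of_pos hs] at h
      simp only [LinearMap.coe_mk, AddHom.coe_mk, norm_smul, norm_inv, Real.norm_of_nonneg hs.le]
      calc s⁻¹ * ‖∫ u in (0 : ℝ)..s, S.op u g‖ ≤ s⁻¹ * (‖g‖ * s) := by gcongr
        _ = 1 * ‖g‖ := by field_simp

theorem steklov_apply {s : ℝ} (hs : 0 < s) (g : E) :
    S.steklov hs g = s⁻¹ • ∫ u in (0 : ℝ)..s, S.op u g := rfl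

/-- Taylor's formula for an orbit. -/
theorem norm_op_sub_taylor_le (n : ℕ) (y : ℕ → E)
    (hy : ∀ l < n, y l ∈ S.generator.domain ∧ S.genApply (y l) = y (l + 1)) {t : ℝ} (ht : 0 ≤ t) :
    ‖S.op t (y 0) - ∑ l ∈ Finset.range n, (t ^ l / l.factorial) • y l‖ ≤ t ^ n * ‖y n‖ := by
  induction n generalizing y t with
  | zero => simpa using S.norm_op_apply_le ht (y 0)
  | succ n ih =>
    have h0 := hy 0 (Nat.succ_pos n)
    set h : ℝ → E := fun x => S.op x (y 0) -
      ∑ l ∈ Finset.range (n + 1), (x ^ l / l.factorial) • y l with hh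
    set h' : ℝ → E := fun x => S.op x (y 1) -
      ∑ l ∈ Finset.range n, (x ^ l / l.factorial) • y (l + 1) with hh'
    have hder : ∀ x ∈ Ico 0 t, HasDerivWithinAt h (h' x) (Ici x) x := by
      intro x hx
      have h1 := S.hasDerivWithinAt_op_Ici hx.1 h0.1
      rw [h0.2, zero_add] at h1
      refine h1.sub ?_
      have h2 : ∀ l ∈ Finset.range (n + 1), HasDerivAt (fun x : ℝ => (x ^ l / l.factorial) • y l)
          (((l * x ^ (l - 1)) / l.factorial) • y l) x := fun l _ =>
        ((hasDerivAt_pow l x).div_const _).smul_const _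
      have h3 := (HasDerivAt.fun_sum h2).hasDerivWithinAt (s := Ici x)
      refine h3.congr_deriv ?_
      rw [Finset.sum_range_succ']
      simp only [Nat.cast_zero, zero_mul, zero_div, zero_smul, add_zero]
      refine Finset.sum_congr rfl fun l _ => ?_
      congr 1
      rw [Nat.factorial_succ, Nat.add_sub_cancel]
      push_cast
      field_simp
    have hcont : ContinuousOn h (Icc 0 t) := by
      refine ((S.continuousOn_orbit _).mono Icc_subset_Ici_self).sub ?_
      fun_prop
    have hb : ∀ x ∈ Ico 0 t, ‖h' x‖ ≤ t ^ n * ‖y (n + 1)‖ := by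
      intro x hx
      refine (ih (fun l => y (l + 1)) (fun l hl => hy (l + 1) (by omega)) hx.1).trans ?_
      gcongr
      · exact hx.1
      · exact hx.2.le
    have h00 : h 0 = 0 := by
      simp [hh, S.op_zero, Finset.sum_range_succ']
    have := norm_image_sub_le_of_norm_deriv_right_le_segment hcont hder hb t ⟨ht, le_rfl⟩
    rw [h00, sub_zero, sub_zero] at this
    refine this.trans (le_of_eq ?_)
    ring

variable [CompleteSpace E]

theorem tendsto_steklov {s : ℝ} (hs : 0 < s) (g : E) :
    Tendsto (fun h : ℝ => h⁻¹ • (S.op h (S.steklov hs g) - S.steklov hs g)) (𝓝[>] 0)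
      (𝓝 (s⁻¹ • (S.op s g - g))) := by
  refine ((S.tendsto_integral hs.le g).const_smul s⁻¹).congr fun h => ?_
  rw [steklov_apply, smul_comm, smul_sub s⁻¹, map_smul]

theorem commute_op_steklov {s : ℝ} (hs : 0 < s) {t : ℝ} (ht : 0 ≤ t) :
    Commute (S.op t) (S.steklov hs) := by
  ext g
  simp only [mul_apply_eq_comp, steklov_apply, map_smul]
  rw [← (S.op t).intervalIntegral_comp_comm (S.intervalIntegrable_op le_rfl hs.le g)]
  congr 1
  refine intervalIntegral.integral_congr fun u hu => ?_
  rw [uIcc_of_le hs.le] at hu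
  exact S.op_comm_apply ht hu.1 g

end ContractionSemigroup

section Taylor

variable {E : Type*} [NormedAddCommGroup E] [NormedSpace ℝ E] {d : ℕ}
  (T : Fin d → ContractionSemigroup E)

/-- The product of the semigroup operators along a list of indices. -/
noncomputable def opList (t : Fin d → ℝ) (L : List (Fin d)) : E →L[ℝ] E :=
  (L.map fun k => (T k).op (t k)).prod

theorem opList_nil (t : Fin d → ℝ) : opList T t [] = 1 := rfl

theorem opList_cons (t : Fin d → ℝ) (k : Fin d) (L : List (Fin d)) :
    opList T t (k :: L) = (T k).op (t k) * opList T t L := by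
  simp [opList]

theorem norm_opList_apply_le {t : Fin d → ℝ} (ht : ∀ k, 0 ≤ t k) (L : List (Fin d)) (f : E) :
    ‖opList T t L f‖ ≤ ‖f‖ := by
  induction L with
  | nil => simp [opList_nil]
  | cons k L ih =>
    rw [opList_cons, mul_apply_eq_comp]
    exact ((T k).norm_op_apply_le (ht k) _).trans ih

theorem orbitMap_eq (f : E) (t : Fin d → ℝ) :
    orbitMap T f t = opList T t (List.finRange d) f := by
  rw [orbitMap, opList, ← List.ofFn_eq_map]

/-- A product of the semigroup operators differs from the identity by an operator of order one. -/
theorem exists_vanishesToOrder_opList (L : List (Fin d)) :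
    ∃ C : NNReal, ∀ (s : ℝ) (t : Fin d → ℝ), (∀ k, t k ∈ Icc 0 s) →
      VanishesToOrder T s 0 C (opList T t L) ∧ VanishesToOrder T s 1 C (opList T t L - 1) := by
  induction L with
  | nil =>
    refine ⟨1, fun s t _ => ⟨VanishesToOrder.one, fun m f => ?_⟩⟩
    rw [opList_nil, sub_self]
    simpa using (supModulus_smul_le T s m 0 (0 : E)).trans (by simp)
  | cons k L ih =>
    obtain ⟨C, hC⟩ := ih
    refine ⟨3 * C + 1, fun s t ht => ?_⟩
    obtain ⟨h0, h1⟩ := hC s t ht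
    have hop : VanishesToOrder T s 0 3 ((T k).op (t k)) := VanishesToOrder.op (ht k) k
    have hd : VanishesToOrder T s 1 1 ((T k).op (t k) - 1) := VanishesToOrder.op_sub_one (ht k) k
    rw [opList_cons]
    refine ⟨(by simpa using hop.mul h0 : VanishesToOrder T s 0 (3 * C) _).mono le_self_add, ?_⟩
    have h2 : (T k).op (t k) * opList T t L - 1 =
        (T k).op (t k) * (opList T t L - 1) + ((T k).op (t k) - 1) := by
      rw [mul_sub, mul_one]; abel
    rw [h2]
    exact (by simpa using hop.mul h1 : VanishesToOrder T s 1 (3 * C) _).add hd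

variable [CompleteSpace E]

theorem vanishesToOrder_steklov {s : ℝ} (hs : 0 < s) (i : Fin d) :
    VanishesToOrder T s 0 3 ((T i).steklov hs) := fun m f => by
  rw [ContractionSemigroup.steklov_apply, intervalIntegral.integral_of_le hs.le]
  refine (supModulus_smul_le T s m _ _).trans ?_
  refine (mul_le_mul_right (supModulus_integral_le T s m
    ((T i).intervalIntegrable_op le_rfl hs.le _).1) _).trans ?_
  calc _ ≤ ‖s⁻¹‖ₑ * ∫⁻ u in Ioc 0 s, 3 * supModulus T s m f :=
        mul_le_mul_right (setLIntegral_mono' measurableSet_Ioc fun u hu =>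
          supModulus_op_le T ⟨hu.1.le, hu.2⟩ m i _) _
    _ = (‖s⁻¹‖ₑ * ENNReal.ofReal s) * (3 * supModulus T s m f) := by
        rw [setLIntegral_const, Real.volume_Ioc, sub_zero]; ring
    _ = _ := by
        rw [Real.enorm_eq_ofReal (by positivity), ← ENNReal.ofReal_mul (by positivity),
          inv_mul_cancel₀ hs.ne']
        simp

theorem vanishesToOrder_one_sub_steklov {s : ℝ} (hs : 0 < s) (i : Fin d) :
    VanishesToOrder T s 1 1 (1 - (T i).steklov hs) := fun m f => by
  have hI := (T i).intervalIntegrable_op le_rfl hs.le f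
  have h : (1 - (T i).steklov hs : E →L[ℝ] E) f =
      -(s⁻¹ • ∫ u in Ioc 0 s, ((T i).op u f - f)) := by
    rw [← intervalIntegral.integral_of_le hs.le,
      intervalIntegral.integral_sub hI intervalIntegrable_const]
    simp only [sub_apply, one_apply_eq_self,
      ContractionSemigroup.steklov_apply, intervalIntegral.integral_const, sub_zero, smul_sub,
      smul_smul, inv_mul_cancel₀ hs.ne', one_smul, neg_sub]
  rw [h]
  refine (supModulus_neg_le T s m _).trans ((supModulus_smul_le T s m _ _).trans ?_)
  refine (mul_le_mul_right (supModulus_integral_le T s m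
    (hI.sub intervalIntegrable_const).1) _).trans ?_
  calc _ ≤ ‖s⁻¹‖ₑ * ∫⁻ u in Ioc 0 s, supModulus T s (m + 1) f :=
        mul_le_mul_right (setLIntegral_mono' measurableSet_Ioc fun u hu =>
          supModulus_diff_le T ⟨hu.1.le, hu.2⟩ m i _) _
    _ = (‖s⁻¹‖ₑ * ENNReal.ofReal s) * supModulus T s (m + 1) f := by
        rw [setLIntegral_const, Real.volume_Ioc, sub_zero]; ring
    _ = _ := by
        rw [Real.enorm_eq_ofReal (by positivity), ← ENNReal.ofReal_mul (by positivity),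
          inv_mul_cancel₀ hs.ne']
        simp

/-- On `[0, s]` the orbit of `f` under a single semigroup is a polynomial of degree `< n` up to
the modulus of continuity of order `n`; the coefficient of `t ^ l` is a difference quotient of
order `l`. -/
theorem exists_taylor_op (n : ℕ) : ∃ C : NNReal, ∀ (i : Fin d) (s : ℝ), 0 < s → ∀ f : E,
    ∃ y : ℕ → E, (∀ l ≤ n, ∀ m, supModulus T s m (y l) ≤
        C * ENNReal.ofReal (s⁻¹ ^ l) * supModulus T s (m + l) f) ∧
      ∀ t ∈ Icc 0 s, ‖(T i).op t f - ∑ l ∈ Finset.range n, (t ^ l / l.factorial) • y l‖ₑ ≤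
        C * supModulus T s n f := by
  -- constants for `1 - B ^ n` and for `Z = ∑ (1 - B ^ n) ^ i`, where `B` is the Steklov average
  set c₁ : NNReal := ∑ i ∈ Finset.range n, 3 ^ i with hc₁
  set c₀ : NNReal := ∑ i ∈ Finset.range n, (1 + 3 ^ n) ^ i with hc₀
  set c₂ : NNReal := 3 ^ n * c₀ with hc₂
  refine ⟨c₂ + c₁ ^ n, fun i s hs f => ?_⟩
  set B : E →L[ℝ] E := (T i).steklov hs with hB
  set D : E →L[ℝ] E := (T i).op s - 1 with hD
  set Z : E →L[ℝ] E := ∑ i ∈ Finset.range n, (1 - B ^ n) ^ i with hZ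
  have vB : VanishesToOrder T s 0 3 B := vanishesToOrder_steklov T hs i
  have vD : VanishesToOrder T s 1 1 D := VanishesToOrder.op_sub_one ⟨hs.le, le_rfl⟩ i
  have vBn : ∀ k, VanishesToOrder T s 0 (3 ^ k) (B ^ k) := fun k => by simpa using vB.pow k
  have vZ : VanishesToOrder T s 0 c₀ Z :=
    VanishesToOrder.sum _ fun k _ => by simpa using (VanishesToOrder.one.sub (vBn n)).pow k
  have v1 : VanishesToOrder T s 1 c₁ (1 - B ^ n) := by
    have h := (vanishesToOrder_one_sub_steklov T hs i).mul
      (VanishesToOrder.sum (Finset.range n) fun k _ => vBn k)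
    rw [← hB, mul_neg_geom_sum] at h
    simpa using h
  have vn : VanishesToOrder T s n (c₁ ^ n) ((1 - B ^ n) ^ n) := by simpa using v1.pow n
  have hcomm : Commute D B := ((T i).commute_op_steklov hs hs.le).sub_left (Commute.one_left B)
  set y : ℕ → E := fun l => s⁻¹ ^ l • (D ^ l * (B ^ (n - l) * Z)) f with hy
  have hy0 : y 0 = f - ((1 - B ^ n) ^ n) f := by
    have h1 : B ^ n * Z = 1 - (1 - B ^ n) ^ n := by
      have := mul_neg_geom_sum (1 - B ^ n) n
      rwa [sub_sub_cancel] at this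
    simp only [hy, pow_zero, one_smul, one_mul, Nat.sub_zero, h1]
    simp
  have hgen : ∀ l < n, y l ∈ (T i).generator.domain ∧ (T i).genApply (y l) = y (l + 1) := by
    intro l hl
    have h1 : y l = B (s⁻¹ ^ l • (D ^ l * (B ^ (n - (l + 1)) * Z)) f) := by
      rw [map_smul, ← mul_apply_eq_comp, ← mul_assoc, ← mul_assoc,
        ← (hcomm.pow_left l).eq, mul_assoc (D ^ l), ← pow_succ',
        show n - (l + 1) + 1 = n - l by omega, mul_assoc]
    have h2 := (T i).tendsto_steklov hs (s⁻¹ ^ l • (D ^ l * (B ^ (n - (l + 1)) * Z)) f)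
    rw [← hB, ← h1] at h2
    refine ⟨(T i).mem_domain_of_tendsto h2, ((T i).genApply_eq_of_tendsto h2).trans ?_⟩
    simp only [hy]
    rw [pow_succ', pow_succ' D, mul_smul, map_smul, ← smul_sub, mul_assoc D]
    rfl
  have hbound : ∀ l ≤ n, ∀ m, supModulus T s m (y l) ≤
      c₂ * ENNReal.ofReal (s⁻¹ ^ l) * supModulus T s (m + l) f := by
    intro l hl m
    have h := ((vD.pow l).mul ((vBn (n - l)).mul vZ)) m f
    rw [one_pow, one_mul, add_zero, add_zero, mul_one] at h
    refine (supModulus_smul_le T s m _ _).trans ((mul_le_mul_right h _).trans ?_)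
    rw [Real.enorm_eq_ofReal (by positivity), mul_comm (c₂ : ℝ≥0∞), mul_assoc]
    have hc : (3 : NNReal) ^ (n - l) * c₀ ≤ c₂ :=
      mul_le_mul_left (pow_le_pow_right₀ (by norm_num) (Nat.sub_le n l)) _
    gcongr
  refine ⟨y, fun l hl m => (hbound l hl m).trans ?_, fun t ht => ?_⟩
  · gcongr
    exact le_self_add
  have h1 : ‖(T i).op t (f - y 0)‖ₑ ≤ (c₁ ^ n : NNReal) * supModulus T s n f := by
    have h2 := vn 0 f
    rw [supModulus_zero, Nat.zero_add] at h2
    refine le_trans ?_ h2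
    rw [hy0, sub_sub_cancel, enorm_le_iff_norm_le]
    exact (T i).norm_op_apply_le ht.1 _
  have h2 : ‖(T i).op t (y 0) - ∑ l ∈ Finset.range n, (t ^ l / l.factorial) • y l‖ₑ ≤
      c₂ * supModulus T s n f := by
    have h3 := (T i).norm_op_sub_taylor_le n y hgen ht.1
    have h4 := hbound n le_rfl 0
    rw [supModulus_zero, Nat.zero_add] at h4
    calc _ ≤ ENNReal.ofReal (s ^ n) * ‖y n‖ₑ := by
          rw [← ofReal_norm, ← ofReal_norm, ← ENNReal.ofReal_mul (by positivity)]
          refine ENNReal.ofReal_le_ofReal (h3.trans ?_)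
          gcongr
          · exact ht.1
          · exact ht.2
      _ ≤ ENNReal.ofReal (s ^ n) * (c₂ * ENNReal.ofReal (s⁻¹ ^ n) * supModulus T s n f) := by
          gcongr
      _ = (ENNReal.ofReal (s ^ n) * ENNReal.ofReal (s⁻¹ ^ n)) * (c₂ * supModulus T s n f) := by
          ring
      _ = _ := by
          rw [← ENNReal.ofReal_mul (by positivity), ← mul_pow, mul_inv_cancel₀ hs.ne']
          simp
  have h5 : (T i).op t f - ∑ l ∈ Finset.range n, (t ^ l / l.factorial) • y l =
      ((T i).op t (y 0) - ∑ l ∈ Finset.range n, (t ^ l / l.factorial) • y l) +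
        (T i).op t (f - y 0) := by
    rw [map_sub]; abel
  rw [h5, ENNReal.coe_add, add_mul]
  exact (enorm_add_le _ _).trans (add_le_add h2 h1)

/-- On `[0, s]^d` the orbit of `f` is a combination of fixed monomials up to the modulus of
continuity of order `n`, and the coefficient of a monomial is controlled by the modulus of
continuity whose order is the degree. -/
theorem exists_taylor_opList (n : ℕ) (L : List (Fin d)) :
    ∃ (ι : Type) (_ : Fintype ι) (u : ι → (Fin d → ℝ) → ℝ) (deg : ι → ℕ) (C : NNReal),
      (∀ a, ContDiff ℝ ((⊤ : ℕ∞) : WithTop ℕ∞) (u a)) ∧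
      (∀ a (s : ℝ) (t : Fin d → ℝ), (∀ k, t k ∈ Icc 0 s) → |u a t| ≤ s ^ deg a) ∧
      ∀ (s : ℝ), 0 < s → ∀ f : E, ∃ x : ι → E,
        (∀ a m, supModulus T s m (x a) ≤
          C * ENNReal.ofReal (s⁻¹ ^ deg a) * supModulus T s (m + deg a) f) ∧
        ∀ t : Fin d → ℝ, (∀ k, t k ∈ Icc 0 s) →
          ‖opList T t L f - ∑ a, u a t • x a‖ₑ ≤ C * supModulus T s n f := by
  induction L with
  | nil =>
    refine ⟨Unit, inferInstance, fun _ _ => 1, fun _ => 0, 1, fun _ => contDiff_const,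
      fun _ s t _ => by simp, fun s hs f => ⟨fun _ => f, fun _ m => by simp, fun t ht => ?_⟩⟩
    simp [opList_nil]
  | cons k L ih =>
    obtain ⟨ι, _, u, deg, C, hu, hub, ih⟩ := ih
    obtain ⟨C₁, hC₁⟩ := exists_taylor_op T n
    refine ⟨ι × Fin n, inferInstance,
      fun a t => u a.1 t * (t k ^ (a.2 : ℕ) / (a.2 : ℕ).factorial),
      fun a => deg a.1 + a.2, C₁ * C + (∑ a, C₁ * C * 2 ^ deg a) + C, fun a => ?_,
      fun a s t ht => ?_, fun s hs f => ?_⟩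
    · exact (hu a.1).mul (((contDiff_apply ℝ ℝ k).pow _).div_const _)
    · rw [abs_mul, pow_add]
      refine mul_le_mul (hub a.1 s t ht) ?_ (abs_nonneg _) ?_
      · rw [abs_of_nonneg (div_nonneg (pow_nonneg (ht k).1 _) (Nat.cast_nonneg _))]
        refine (div_le_self (pow_nonneg (ht k).1 _) ?_).trans
          (pow_le_pow_left₀ (ht k).1 (ht k).2 _)
        exact_mod_cast Nat.one_le_iff_ne_zero.2 (Nat.factorial_ne_zero _)
      · exact pow_nonneg ((ht k).1.trans (ht k).2) _
    · obtain ⟨x, hx, hrem⟩ := ih s hs f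
      choose y hy hyrem using fun a => hC₁ k s hs (x a)
      refine ⟨fun a => y a.1 a.2, fun a m => ?_, fun t ht => ?_⟩
      · refine (hy a.1 a.2 a.2.2.le m).trans ((mul_le_mul_right (hx a.1 _) _).trans ?_)
        calc _ = ((C₁ * C : NNReal) : ℝ≥0∞) * (ENNReal.ofReal (s⁻¹ ^ deg a.1) *
              ENNReal.ofReal (s⁻¹ ^ (a.2 : ℕ))) * supModulus T s (m + a.2 + deg a.1) f := by
              rw [ENNReal.coe_mul]; ring
          _ = ((C₁ * C : NNReal) : ℝ≥0∞) * ENNReal.ofReal (s⁻¹ ^ (deg a.1 + a.2)) *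
              supModulus T s (m + (deg a.1 + a.2)) f := by
              rw [← ENNReal.ofReal_mul (by positivity), ← pow_add,
                show m + (a.2 : ℕ) + deg a.1 = m + (deg a.1 + a.2) by omega]
          _ ≤ _ := by
              gcongr
              rw [add_assoc]
              exact le_self_add
      · have hsplit : opList T t (k :: L) f - ∑ a : ι × Fin n,
            (u a.1 t * (t k ^ (a.2 : ℕ) / (a.2 : ℕ).factorial)) • y a.1 a.2 =
            (T k).op (t k) (opList T t L f - ∑ a, u a t • x a) +
            ∑ a, u a t • ((T k).op (t k) (x a) -
              ∑ l ∈ Finset.range n, (t k ^ l / l.factorial) • y a l) := by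
          rw [opList_cons, mul_apply_eq_comp, Fintype.sum_prod_type]
          simp only [map_sub, map_sum, map_smul, smul_sub, Finset.sum_sub_distrib,
            Finset.sum_range, Finset.smul_sum, mul_smul]
          abel
        rw [hsplit, ENNReal.coe_add, add_mul, add_comm]
        refine (enorm_add_le _ _).trans (add_le_add ?_ ?_)
        · rw [ENNReal.coe_add, add_mul]
          refine le_trans ?_ le_add_self
          rw [ENNReal.ofNNReal_finsetSum, Finset.sum_mul]
          refine (enorm_sum_le _ _).trans (Finset.sum_le_sum fun a _ => ?_)
          rw [enorm_smul]
          have h1 : ‖u a t‖ₑ ≤ ENNReal.ofReal (s ^ deg a) := by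
            rw [← ofReal_norm]
            exact ENNReal.ofReal_le_ofReal (hub a s t ht)
          calc _ ≤ ENNReal.ofReal (s ^ deg a) * (C₁ * (C * ENNReal.ofReal (s⁻¹ ^ deg a) *
                (2 ^ deg a * supModulus T s n f))) := by
                gcongr
                exact (hyrem a (t k) (ht k)).trans (mul_le_mul_right ((hx a n).trans
                  (mul_le_mul_right (supModulus_add_right_le T s n _ f) _)) _)
            _ = (ENNReal.ofReal (s ^ deg a) * ENNReal.ofReal (s⁻¹ ^ deg a)) *
                ((C₁ * C * 2 ^ deg a) * supModulus T s n f) := by ring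
            _ = _ := by
                rw [← ENNReal.ofReal_mul (by have := hs.le; positivity), ← mul_pow,
                  mul_inv_cancel₀ hs.ne']
                simp
        · refine le_trans ?_ (hrem t ht)
          rw [enorm_le_iff_norm_le]
          exact (T k).norm_op_apply_le (ht k).1 _

end Taylor

/-! ### Orbits of differentiable vectors -/

section Orbit

variable {E : Type*} [NormedAddCommGroup E] [NormedSpace ℝ E] {d : ℕ}
  (T : Fin d → ContractionSemigroup E)

theorem ContractionSemigroup.continuousOn_op_apply (S : ContractionSemigroup E) {X : Type*}
    [TopologicalSpace X] {s : Set X} {a : X → ℝ} {g : X → E} (ha : ContinuousOn a s)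
    (ha0 : ∀ x ∈ s, 0 ≤ a x) (hg : ContinuousOn g s) :
    ContinuousOn (fun x => S.op (a x) (g x)) s := by
  intro x hx
  have h1 : Tendsto (fun y => S.op (a y) (g x)) (𝓝[s] x) (𝓝 (S.op (a x) (g x))) :=
    ((S.continuousOn_orbit (g x)).comp ha ha0) x hx
  have h2 : Tendsto (fun y => S.op (a y) (g y) - S.op (a y) (g x)) (𝓝[s] x) (𝓝 0) := by
    have h3 : Tendsto (fun y => ‖g y - g x‖) (𝓝[s] x) (𝓝 0) :=
      tendsto_iff_norm_sub_tendsto_zero.1 (hg x hx)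
    refine squeeze_zero_norm' ?_ h3
    filter_upwards [self_mem_nhdsWithin] with y hy
    rw [← map_sub]
    exact S.norm_op_apply_le (ha0 y hy) _
  simpa [ContinuousWithinAt] using h2.add h1

theorem continuousOn_opList (L : List (Fin d)) (f : E) :
    ContinuousOn (fun t => opList T t L f) {t : Fin d → ℝ | ∀ k, 0 ≤ t k} := by
  induction L with
  | nil => exact continuousOn_const
  | cons k L ih =>
    simp only [opList_cons, mul_apply_eq_comp]
    exact (T k).continuousOn_op_apply (continuous_apply k).continuousOn (fun t ht => ht k) ih

theorem opList_append (t : Fin d → ℝ) (L L' : List (Fin d)) :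
    opList T t (L ++ L') = opList T t L * opList T t L' := by
  simp [opList]

theorem opList_update_of_notMem (t : Fin d → ℝ) (k : Fin d) (u : ℝ) {L : List (Fin d)}
    (hk : k ∉ L) : opList T (Function.update t k u) L = opList T t L := by
  unfold opList
  congr 1
  refine List.map_congr_left fun l hl => ?_
  rw [Function.update_of_ne]
  rintro rfl
  exact hk hl

theorem exists_finRange_split (k : Fin d) : ∃ L L' : List (Fin d), k ∉ L ∧ k ∉ L' ∧
    List.finRange d = L ++ k :: L' := by
  obtain ⟨L, L', h⟩ := List.append_of_mem (List.mem_finRange k)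
  have hn := List.nodup_finRange d
  rw [h] at hn
  have h1 := List.nodup_append.1 hn
  have h2 := List.nodup_cons.1 h1.2.1
  refine ⟨L, L', fun hk => ?_, h2.1, h⟩
  exact h1.2.2 k hk k (by simp) rfl

/-- The partial derivative of the orbit map on the orthant, one-sided at the boundary. -/
noncomputable def orbitDeriv (f : E) (k : Fin d) (t : Fin d → ℝ) : E :=
  derivWithin (fun u : ℝ => orbitMap T f (Function.update t k u)) (Ici 0) (t k)

/-- The norm of `E^1` as a real number. -/
noncomputable def graphNorm (f : E) : ℝ := ‖f‖ + ∑ j, ‖(T j).genApply f‖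

theorem graphNorm_nonneg (f : E) : 0 ≤ graphNorm T f := by unfold graphNorm; positivity

theorem norm_genApply_le_graphNorm (f : E) (j : Fin d) : ‖(T j).genApply f‖ ≤ graphNorm T f :=
  (Finset.single_le_sum (f := fun j => ‖(T j).genApply f‖) (fun _ _ => norm_nonneg _)
    (Finset.mem_univ j)).trans (le_add_of_nonneg_left (norm_nonneg f))

variable {T}

/-- A generator is bounded by its difference quotients, which are defined on the whole space. -/
theorem norm_genApply_le_of_forall (i : Fin d) {f : E} (hf : f ∈ (T i).generator.domain) {B : ℝ}
    (h : ∀ h : ℝ, 0 < h → ‖h⁻¹ • ((T i).op h f - f)‖ ≤ B) : ‖(T i).genApply f‖ ≤ B := by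
  refine le_of_tendsto ((T i).tendsto_genApply hf).norm ?_
  filter_upwards [self_mem_nhdsWithin] with t ht using h t ht

theorem opList_mem (hT : SemigroupAssumption T) {t : Fin d → ℝ} (ht : ∀ k, 0 ≤ t k)
    (L : List (Fin d)) {f : E} (hf : f ∈ sobolevSpace T 1) :
    opList T t L f ∈ sobolevSpace T 1 := by
  induction L with
  | nil => exact hf
  | cons k L ih =>
    rw [opList_cons]
    exact hT.invariant k (t k) (ht k) _ ih

variable [CompleteSpace E]

/-- The partial derivatives of an orbit of a vector of `E^1`. The lists are the indices before and
after `k`; they do not depend on the vector. -/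
theorem exists_hasDerivWithinAt_orbitMap (hT : SemigroupAssumption T) (k : Fin d) :
    ∃ L L' : List (Fin d), ∀ f ∈ sobolevSpace T 1, ∀ t : Fin d → ℝ, (∀ k, 0 ≤ t k) →
      HasDerivWithinAt (fun u : ℝ => orbitMap T f (Function.update t k u))
        (orbitDeriv T f k t) (Ici 0) (t k) ∧
      orbitDeriv T f k t =
        opList T t L ((T k).op (t k) ((T k).genApply (opList T t L' f))) := by
  obtain ⟨L, L', hL, hL', hsplit⟩ := exists_finRange_split k
  refine ⟨L, L', fun f hf t ht => ?_⟩
  have hmem := (mem_sobolevSpace_one T).1 (opList_mem hT ht L' hf) k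
  have h1 : ∀ u, orbitMap T f (Function.update t k u) =
      opList T t L ((T k).op u (opList T t L' f)) := by
    intro u
    rw [orbitMap_eq, hsplit, opList_append, opList_cons, opList_update_of_notMem T t k u hL,
      opList_update_of_notMem T t k u hL', Function.update_self]
    rfl
  have h2 := (opList T t L).hasFDerivAt.comp_hasDerivWithinAt (t k)
    ((T k).hasDerivWithinAt_op (ht k) hmem)
  have h3 : HasDerivWithinAt (fun u : ℝ => orbitMap T f (Function.update t k u))
      (opList T t L ((T k).op (t k) ((T k).genApply (opList T t L' f)))) (Ici 0) (t k) :=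
    h2.congr (fun u _ => h1 u) (h1 _)
  have h4 := h3.derivWithin (uniqueDiffOn_Ici (0 : ℝ) (t k) (ht k))
  rw [orbitDeriv, h4]
  exact ⟨h3, rfl⟩

/-! ### Boundedness of the semigroups on `E^1`, away from the origin -/

variable (T) in
/-- The joint graph of the generators. -/
def jointGraph : Submodule ℝ (E × (Fin d → E)) where
  carrier := {p | ∀ i, p.1 ∈ (T i).generator.domain ∧ (T i).genApply p.1 = p.2 i}
  add_mem' := fun {a b} ha hb i => ⟨Submodule.add_mem _ (ha i).1 (hb i).1, by
    rw [Prod.fst_add, (T i).genApply_add (ha i).1 (hb i).1, (ha i).2, (hb i).2]; rfl⟩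
  zero_mem' := fun i => ⟨Submodule.zero_mem _, by
    simpa using (T i).genApply_smul 0 (Submodule.zero_mem (T i).generator.domain)⟩
  smul_mem' := fun c {a} ha i => ⟨Submodule.smul_mem _ c (ha i).1, by
    rw [Prod.smul_fst, (T i).genApply_smul c (ha i).1, (ha i).2]; rfl⟩

instance completeSpace_jointGraph : CompleteSpace (jointGraph T) := by
  refine IsClosed.completeSpace_coe (hs := ?_)
  refine isClosed_of_closure_subset fun p hp => ?_
  obtain ⟨x, hx, hlim⟩ := mem_closure_iff_seq_limit.1 hp
  intro i
  have h1 : Tendsto (fun n => (x n).1) atTop (𝓝 p.1) := (continuous_fst.tendsto p).comp hlim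
  have h2 : Tendsto (fun n => (x n).2 i) atTop (𝓝 (p.2 i)) :=
    (((continuous_apply i).comp continuous_snd).tendsto p).comp hlim
  have h3 := (T i).tendsto_of_closed (fun n => (hx n i).1) h1
    (h2.congr fun n => ((hx n i).2).symm)
  exact ⟨(T i).mem_domain_of_tendsto h3, (T i).genApply_eq_of_tendsto h3⟩

theorem norm_smul_op_sub_le (i : Fin d) {h : ℝ} (hh : 0 < h) {f : E}
    (hf : f ∈ (T i).generator.domain) : ‖h⁻¹ • ((T i).op h f - f)‖ ≤ ‖(T i).genApply f‖ := by
  rw [norm_smul, norm_inv, Real.norm_of_nonneg hh.le, inv_mul_le_iff₀ hh]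
  exact (T i).norm_op_sub_le hh.le hf

/-- For fixed `τ` the operator `T_i(τ)` is bounded on `E^1`, in terms of difference quotients. -/
theorem exists_bound_diffQuot (hT : SemigroupAssumption T) (i : Fin d) {τ : ℝ} (hτ : 0 ≤ τ) :
    ∃ C : ℝ, ∀ (j : Fin d) (h : ℝ), 0 < h → ∀ x : jointGraph T,
      ‖h⁻¹ • ((T j).op h ((T i).op τ x.1.1) - (T i).op τ x.1.1)‖ ≤ C * ‖x‖ := by
  let A : Fin d × Ioi (0 : ℝ) → jointGraph T →L[ℝ] E := fun p =>
    ((p.2 : ℝ)⁻¹ • (((T p.1).op p.2 - 1) * (T i).op τ)) ∘L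
      (ContinuousLinearMap.fst ℝ E (Fin d → E) ∘L (jointGraph T).subtypeL)
  have hA : ∀ p x, A p x =
      (p.2 : ℝ)⁻¹ • ((T p.1).op p.2 ((T i).op τ x.1.1) - (T i).op τ x.1.1) := fun p x => rfl
  obtain ⟨C, hC⟩ := banach_steinhaus (g := A) fun x => by
    have hx : x.1.1 ∈ sobolevSpace T 1 := (mem_sobolevSpace_one T).2 fun l => (x.2 l).1
    refine ⟨graphNorm T ((T i).op τ x.1.1), fun p => ?_⟩
    rw [hA]
    exact (norm_smul_op_sub_le p.1 p.2.2
      ((mem_sobolevSpace_one T).1 (hT.invariant i τ hτ _ hx) p.1)).trans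
      (norm_genApply_le_graphNorm T _ _)
  exact ⟨C, fun j h hh x => by
    have := (A (j, ⟨h, hh⟩)).le_of_opNorm_le (hC _) x
    rwa [hA] at this⟩

/-- The operators `T_i(τ)` are bounded on `E^1`, uniformly for `τ` in a compact subset of
`(0, ∞)`: by Baire's theorem they are so in some interval next to the origin. -/
theorem exists_bound_op (hT : SemigroupAssumption T) (i : Fin d) {a b : ℝ} (ha : 0 < a) :
    ∃ M : ℝ, 0 ≤ M ∧ ∀ τ ∈ Icc a b, ∀ f ∈ sobolevSpace T 1,
      graphNorm T ((T i).op τ f) ≤ M * graphNorm T f := by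
  let B : ℕ → Set ℝ := fun n => {τ | ∀ (j : Fin d) (h : ℝ), 0 < h → ∀ x : jointGraph T,
    ‖h⁻¹ • ((T j).op h ((T i).op (max τ 0) x.1.1) - (T i).op (max τ 0) x.1.1)‖ ≤ n * ‖x‖}
  have hBc : ∀ n, IsClosed (B n) := by
    intro n
    have hcont : ∀ g : E, Continuous fun τ : ℝ => (T i).op (max τ 0) g := fun g =>
      ((T i).continuousOn_orbit g).comp_continuous (continuous_id.max continuous_const)
        fun u => mem_Ici.2 (le_max_right _ _)
    simp only [B, Set.ofPred_forall]
    refine isClosed_iInter fun j => isClosed_iInter fun h => isClosed_iInter fun _ =>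
      isClosed_iInter fun x => isClosed_le ?_ continuous_const
    exact ((((T j).op h).continuous.comp (hcont _)).sub (hcont _)).const_smul h⁻¹ |>.norm
  have hBu : ⋃ n, B n = univ := by
    refine eq_univ_of_forall fun τ => mem_iUnion.2 ?_
    obtain ⟨C, hC⟩ := exists_bound_diffQuot hT i (le_max_right τ 0)
    obtain ⟨n, hn⟩ := exists_nat_ge C
    exact ⟨n, fun j h hh x => (hC j h hh x).trans (by gcongr)⟩
  have hdense := dense_iUnion_interior_of_closed hBc hBu
  obtain ⟨c, hcI, hca⟩ := hdense.exists_mem_open isOpen_Ioo (nonempty_Ioo.2 ha)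
  obtain ⟨n, hn⟩ := mem_iUnion.1 hcI
  -- an element of `E^1` as an element of the joint graph
  have lift : ∀ f ∈ sobolevSpace T 1, ∃ x : jointGraph T, x.1.1 = f ∧ ‖x‖ ≤ graphNorm T f := by
    intro f hf
    refine ⟨⟨(f, fun l => (T l).genApply f), fun l =>
      ⟨(mem_sobolevSpace_one T).1 hf l, rfl⟩⟩, rfl, ?_⟩
    refine max_le ?_ ((pi_norm_le_iff_of_nonneg (graphNorm_nonneg T f)).2 fun l =>
      norm_genApply_le_graphNorm T f l)
    exact le_add_of_nonneg_right (Finset.sum_nonneg fun _ _ => norm_nonneg _)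
  suffices H : ∃ M : ℝ, 0 ≤ M ∧ ∀ τ ∈ Icc a b ∩ Icc a b, ∀ f ∈ sobolevSpace T 1,
      graphNorm T ((T i).op τ f) ≤ M * graphNorm T f by rwa [inter_self] at H
  refine (isCompact_Icc (a := a) (b := b)).induction_on
    (p := fun s => ∃ M : ℝ, 0 ≤ M ∧ ∀ τ ∈ s ∩ Icc a b, ∀ f ∈ sobolevSpace T 1,
      graphNorm T ((T i).op τ f) ≤ M * graphNorm T f) ?_ ?_ ?_ ?_
  · exact ⟨0, le_rfl, fun τ hτ => hτ.1.elim⟩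
  · rintro s t hst ⟨M, hM0, hM⟩
    exact ⟨M, hM0, fun τ hτ => hM τ ⟨hst hτ.1, hτ.2⟩⟩
  · rintro s t ⟨M, hM0, hM⟩ ⟨M', hM0', hM'⟩
    refine ⟨max M M', le_max_of_le_left hM0, fun τ hτ f hf => ?_⟩
    rcases hτ.1 with h | h
    · exact (hM τ ⟨h, hτ.2⟩ f hf).trans
        (mul_le_mul_of_nonneg_right (le_max_left _ _) (graphNorm_nonneg T f))
    · exact (hM' τ ⟨h, hτ.2⟩ f hf).trans
        (mul_le_mul_of_nonneg_right (le_max_right _ _) (graphNorm_nonneg T f))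
  · intro τ₀ hτ₀
    set u := τ₀ - c with hu
    have hu0 : 0 ≤ u := by
      have := hca.2; have := hτ₀.1; rw [hu]; linarith
    obtain ⟨C, hC⟩ := exists_bound_diffQuot hT i hu0
    have hC' : ∀ f ∈ sobolevSpace T 1,
        graphNorm T ((T i).op u f) ≤ (1 + d * |C|) * graphNorm T f := by
      intro f hf
      obtain ⟨x, rfl, hx⟩ := lift f hf
      have h1 : ∀ j, ‖(T j).genApply ((T i).op u x.1.1)‖ ≤ |C| * graphNorm T x.1.1 := fun j =>
        norm_genApply_le_of_forall j
          ((mem_sobolevSpace_one T).1 (hT.invariant i u hu0 _ hf) j) fun h hh =>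
          (hC j h hh x).trans ((mul_le_mul_of_nonneg_right (le_abs_self C) (norm_nonneg x)).trans
            (mul_le_mul_of_nonneg_left hx (abs_nonneg C)))
      have h2 : ‖(T i).op u x.1.1‖ ≤ graphNorm T x.1.1 := ((T i).norm_op_apply_le hu0 _).trans
        (le_add_of_nonneg_right (Finset.sum_nonneg fun _ _ => norm_nonneg _))
      calc graphNorm T ((T i).op u x.1.1) ≤
            graphNorm T x.1.1 + ∑ _j : Fin d, |C| * graphNorm T x.1.1 :=
            add_le_add h2 (Finset.sum_le_sum fun j _ => h1 j)
        _ = _ := by simp; ring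
    refine ⟨(fun τ => τ - u) ⁻¹' (interior (B n) ∩ Ioi 0), mem_nhdsWithin_of_mem_nhds ?_,
      (1 + d * n) * (1 + d * |C|), by positivity, fun τ hτ f hf => ?_⟩
    · refine (continuous_id.sub continuous_const).continuousAt.preimage_mem_nhds ?_
      have : τ₀ - u = c := by rw [hu]; ring
      change _ ∈ 𝓝 (τ₀ - u)
      rw [this]
      exact inter_mem (isOpen_interior.mem_nhds hn) (Ioi_mem_nhds hca.1)
    · obtain ⟨⟨hτB, hτ0⟩, hτab⟩ := hτ
      have hσ : 0 ≤ τ - u := le_of_lt hτ0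
      have hsplit : (T i).op τ f = (T i).op (τ - u) ((T i).op u f) := by
        rw [← (T i).op_add_apply hσ hu0, sub_add_cancel]
      have hg := hT.invariant i u hu0 f hf
      obtain ⟨x, hx1, hx⟩ := lift _ hg
      have h1 : ∀ j, ‖(T j).genApply ((T i).op τ f)‖ ≤ n * graphNorm T ((T i).op u f) := by
        intro j
        have hmem := (mem_sobolevSpace_one T).1 (hT.invariant i (τ - u) hσ _ hg) j
        rw [hsplit]
        refine norm_genApply_le_of_forall j hmem fun h hh => ?_
        have := interior_subset hτB j h hh x
        rw [max_eq_left hσ, hx1] at this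
        exact this.trans (by gcongr)
      have h2 : ‖(T i).op τ f‖ ≤ graphNorm T ((T i).op u f) := by
        rw [hsplit]
        exact ((T i).norm_op_apply_le hσ _).trans
          (le_add_of_nonneg_right (Finset.sum_nonneg fun _ _ => norm_nonneg _))
      calc graphNorm T ((T i).op τ f) ≤ graphNorm T ((T i).op u f) +
            ∑ _j : Fin d, n * graphNorm T ((T i).op u f) :=
            add_le_add h2 (Finset.sum_le_sum fun j _ => h1 j)
        _ = (1 + d * n) * graphNorm T ((T i).op u f) := by simp; ring
        _ ≤ (1 + d * n) * ((1 + d * |C|) * graphNorm T f) := by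
            gcongr
            exact hC' f hf
        _ = _ := by ring

theorem exists_bound_opList (hT : SemigroupAssumption T) {a b : ℝ} (ha : 0 < a)
    (L : List (Fin d)) : ∃ M : ℝ, 0 ≤ M ∧ ∀ t : Fin d → ℝ, (∀ k, t k ∈ Icc a b) →
      ∀ f ∈ sobolevSpace T 1, graphNorm T (opList T t L f) ≤ M * graphNorm T f := by
  induction L with
  | nil => exact ⟨1, zero_le_one, fun t _ f _ => by simp [opList_nil]⟩
  | cons k L ih =>
    obtain ⟨M, hM0, hM⟩ := ih
    obtain ⟨M', hM0', hM'⟩ := exists_bound_op hT k ha (b := b)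
    refine ⟨M' * M, by positivity, fun t ht f hf => ?_⟩
    rw [opList_cons, mul_apply_eq_comp, mul_assoc]
    exact (hM' _ (ht k) _ (opList_mem hT (fun k => ha.le.trans (ht k).1) L hf)).trans
      (mul_le_mul_of_nonneg_left (hM t ht f hf) hM0')

theorem exists_bound_orbitDeriv (hT : SemigroupAssumption T) {a b : ℝ} (ha : 0 < a)
    (k : Fin d) : ∃ M : ℝ, ∀ t : Fin d → ℝ, (∀ k, t k ∈ Icc a b) →
      ∀ f ∈ sobolevSpace T 1, ‖orbitDeriv T f k t‖ ≤ M * graphNorm T f := by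
  obtain ⟨L, L', h⟩ := exists_hasDerivWithinAt_orbitMap hT k
  obtain ⟨M, _, hM⟩ := exists_bound_opList hT ha L' (b := b)
  refine ⟨M, fun t ht f hf => ?_⟩
  have ht0 : ∀ k, 0 ≤ t k := fun k => ha.le.trans (ht k).1
  rw [(h f hf t ht0).2]
  exact (norm_opList_apply_le T ht0 L _).trans (((T k).norm_op_apply_le (ht0 k) _).trans
    ((norm_genApply_le_graphNorm T _ k).trans (hM t ht f hf)))

end Orbit

/-! ### Smoothing operators -/

section Smoothing

variable {d : ℕ}

/-- The box, inside the open orthant, that carries the smoothing kernels. -/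
def kernelBox (d : ℕ) : Set (Fin d → ℝ) := Icc (fun _ => 1 / 4) (fun _ => 3 / 4)

theorem isCompact_kernelBox : IsCompact (kernelBox d) := isCompact_Icc

theorem measurableSet_kernelBox : MeasurableSet (kernelBox d) := measurableSet_Icc

theorem smul_mem_of_mem_kernelBox {s : ℝ} (hs : 0 ≤ s) {x : Fin d → ℝ} (hx : x ∈ kernelBox d)
    (k : Fin d) : (s • x) k ∈ Icc (s * (1 / 4)) s := by
  have h1 : (1 : ℝ) / 4 ≤ x k := hx.1 k
  have h2 : x k ≤ 3 / 4 := hx.2 k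
  simp only [Pi.smul_apply, smul_eq_mul]
  exact ⟨by gcongr, by nlinarith⟩

theorem smul_nonneg_of_mem_kernelBox {s : ℝ} (hs : 0 ≤ s) {x : Fin d → ℝ} (hx : x ∈ kernelBox d)
    (k : Fin d) : 0 ≤ (s • x) k :=
  le_trans (by positivity) (smul_mem_of_mem_kernelBox hs hx k).1

/-- A smooth kernel `G (s, x)`, depending on the scale `s`, that vanishes for `x` outside the
box. -/
structure IsKernel (G : ℝ × (Fin d → ℝ) → ℝ) : Prop where
  smooth : ContDiff ℝ ((⊤ : ℕ∞) : WithTop ℕ∞) G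
  eq_zero : ∀ s, ∀ x ∉ kernelBox d, G (s, x) = 0

/-- The operator `f ↦ ∫ G(s, x) T(s x) f dx` as a function. -/
noncomputable def smoothing {E : Type*} [NormedAddCommGroup E] [NormedSpace ℝ E]
    (T : Fin d → ContractionSemigroup E) (G : ℝ × (Fin d → ℝ) → ℝ) (s : ℝ) (f : E) : E :=
  ∫ x, G (s, x) • orbitMap T f (s • x)

/-- The derivative of a kernel in the direction of the `k`-th coordinate. -/
noncomputable def kernelDeriv (k : Fin d) (G : ℝ × (Fin d → ℝ) → ℝ) (p : ℝ × (Fin d → ℝ)) : ℝ :=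
  fderiv ℝ G p (0, Pi.single k 1)

/-- The kernel multiplied by a function of the unscaled variable. -/
def kernelMul (η : (Fin d → ℝ) → ℝ) (G : ℝ × (Fin d → ℝ) → ℝ) (p : ℝ × (Fin d → ℝ)) : ℝ :=
  η (p.1 • p.2) * G p

/-- The formal adjoint of the vector field `∑ ζ_k ∂_k`, acting on kernels. -/
noncomputable def kernelAdjoint (ζ : Fin d → (Fin d → ℝ) → ℝ) (G : ℝ × (Fin d → ℝ) → ℝ)
    (p : ℝ × (Fin d → ℝ)) : ℝ :=
  -∑ k, kernelDeriv k (kernelMul (ζ k) G) p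

namespace IsKernel

variable {G : ℝ × (Fin d → ℝ) → ℝ}

theorem mul (hG : IsKernel G) {η : (Fin d → ℝ) → ℝ}
    (hη : ContDiff ℝ ((⊤ : ℕ∞) : WithTop ℕ∞) η) : IsKernel (kernelMul η G) where
  smooth := (hη.comp (contDiff_fst.smul contDiff_snd)).mul hG.smooth
  eq_zero s x hx := by simp [kernelMul, hG.eq_zero s x hx]

theorem deriv (hG : IsKernel G) (k : Fin d) : IsKernel (kernelDeriv k G) where
  smooth := (hG.smooth.fderiv_right (by simp)).clm_apply contDiff_const
  eq_zero s x hx := by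
    have h : G =ᶠ[𝓝 (s, x)] fun _ => 0 := by
      have : (univ ×ˢ (kernelBox d)ᶜ : Set (ℝ × (Fin d → ℝ))) ∈ 𝓝 (s, x) :=
        (isOpen_univ.prod isCompact_kernelBox.isClosed.isOpen_compl).mem_nhds ⟨mem_univ _, hx⟩
      filter_upwards [this] with p hp using hG.eq_zero p.1 p.2 hp.2
    rw [kernelDeriv, h.fderiv_eq]
    simp

theorem adjoint (hG : IsKernel G) {ζ : Fin d → (Fin d → ℝ) → ℝ}
    (hζ : ∀ k, ContDiff ℝ ((⊤ : ℕ∞) : WithTop ℕ∞) (ζ k)) : IsKernel (kernelAdjoint ζ G) where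
  smooth := (ContDiff.sum fun k _ => ((hG.mul (hζ k)).deriv k).smooth).neg
  eq_zero s x hx := by
    simp [kernelAdjoint, ((hG.mul (hζ _)).deriv _).eq_zero s x hx]

theorem continuous (hG : IsKernel G) (s : ℝ) : Continuous fun x => G (s, x) :=
  hG.smooth.continuous.comp (by fun_prop)

theorem support_subset (hG : IsKernel G) (s : ℝ) {F : Type*} [NormedAddCommGroup F]
    [NormedSpace ℝ F] (g : (Fin d → ℝ) → F) :
    Function.support (fun x => G (s, x) • g x) ⊆ kernelBox d := by
  intro x hx
  by_contra h
  exact hx (by simp [hG.eq_zero s x h])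

theorem tsupport_subset (hG : IsKernel G) (s : ℝ) :
    tsupport (fun x => G (s, x)) ⊆ kernelBox d := by
  refine closure_minimal (fun x hx => ?_) isCompact_kernelBox.isClosed
  by_contra h
  exact hx (hG.eq_zero s x h)

theorem exists_bound (hG : IsKernel G) :
    ∃ C : ℝ, 0 ≤ C ∧ ∀ s ∈ Icc (0 : ℝ) 1, ∀ x, |G (s, x)| ≤ C := by
  obtain ⟨C, hC⟩ := (isCompact_Icc.prod isCompact_kernelBox).exists_bound_of_continuousOn
    (f := G) (s := Icc (0 : ℝ) 1 ×ˢ kernelBox d) hG.smooth.continuous.continuousOn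
  refine ⟨max C 0, le_max_right _ _, fun s hs x => ?_⟩
  by_cases hx : x ∈ kernelBox d
  · exact (hC (s, x) ⟨hs, hx⟩).trans (le_max_left _ _)
  · rw [hG.eq_zero s x hx, abs_zero]; exact le_max_right _ _

theorem hasLineDerivAt (hG : IsKernel G) (s : ℝ) (x : Fin d → ℝ) (k : Fin d) :
    HasLineDerivAt ℝ (fun x => G (s, x)) (kernelDeriv k G (s, x)) x (Pi.single k 1) := by
  have h1 : HasFDerivAt G (fderiv ℝ G (s, x)) (s, x) :=
    (hG.smooth.differentiable (by simp) (s, x)).hasFDerivAt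
  have h2 : HasFDerivAt (fun y : Fin d → ℝ => (s, y))
      (ContinuousLinearMap.inr ℝ ℝ (Fin d → ℝ)) x := hasFDerivAt_prodMk_right s x
  exact (h1.comp x h2).hasLineDerivAt (Pi.single k 1)

/-- Integration of a kernel against a function that is bounded on the box. -/
theorem integrable_smul (hG : IsKernel G) (s : ℝ) {F : Type*} [NormedAddCommGroup F]
    [NormedSpace ℝ F] {g : (Fin d → ℝ) → F}
    (hg : AEStronglyMeasurable g (volume.restrict (kernelBox d))) {C : ℝ}
    (hC : ∀ x ∈ kernelBox d, ‖g x‖ ≤ C) : Integrable fun x => G (s, x) • g x := by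
  rw [← integrableOn_iff_integrable_of_support_subset (hG.support_subset s g)]
  obtain ⟨B, hB⟩ := isCompact_kernelBox.exists_bound_of_continuousOn
    (hG.continuous s).continuousOn (s := kernelBox d)
  have : IsFiniteMeasure (volume.restrict (kernelBox d)) :=
    ⟨by simpa using isCompact_kernelBox.measure_lt_top⟩
  refine Integrable.of_bound (μ := volume.restrict (kernelBox d)) ?_ (B * C) ?_
  · exact ((hG.continuous s).aestronglyMeasurable).smul hg
  · refine (ae_restrict_iff' measurableSet_kernelBox).2 (Eventually.of_forall fun x hx => ?_)
    rw [norm_smul]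
    exact mul_le_mul (hB x hx) (hC x hx) (norm_nonneg _) ((norm_nonneg _).trans (hB x hx))

theorem lintegral_enorm_smul_le (hG : IsKernel G) {s C : ℝ} (hC : ∀ x, |G (s, x)| ≤ C)
    {F : Type*} [NormedAddCommGroup F] [NormedSpace ℝ F] {g : (Fin d → ℝ) → F} {N : F → ℝ≥0∞}
    (hN : ∀ (c : ℝ) (y : F), N (c • y) ≤ ‖c‖ₑ * N y) {B : ℝ≥0∞}
    (hB : ∀ x ∈ kernelBox d, N (g x) ≤ B) :
    ∫⁻ x, N (G (s, x) • g x) ≤ ENNReal.ofReal C * volume (kernelBox d) * B := by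
  have h : ∀ x, N (G (s, x) • g x) ≤
      (kernelBox d).indicator (fun _ => ENNReal.ofReal C * B) x := by
    intro x
    by_cases hx : x ∈ kernelBox d
    · rw [indicator_of_mem hx]
      refine (hN _ _).trans (mul_le_mul' ?_ (hB x hx))
      rw [← ofReal_norm]
      exact ENNReal.ofReal_le_ofReal (hC x)
    · rw [hG.eq_zero s x hx, indicator_of_notMem hx]
      simpa using hN 0 (g x)
  refine (lintegral_mono h).trans (le_of_eq ?_)
  rw [lintegral_indicator measurableSet_kernelBox, setLIntegral_const]
  ring

end IsKernel

variable {E : Type*} [NormedAddCommGroup E] [NormedSpace ℝ E]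
  {T : Fin d → ContractionSemigroup E} {G : ℝ × (Fin d → ℝ) → ℝ}

theorem continuousOn_orbitMap_smul (f : E) {s : ℝ} (hs : 0 ≤ s) :
    ContinuousOn (fun x => orbitMap T f (s • x)) (kernelBox d) := by
  simp only [orbitMap_eq]
  exact (continuousOn_opList T _ f).comp (continuous_const_smul s).continuousOn
    fun x hx => smul_nonneg_of_mem_kernelBox hs hx

theorem norm_orbitMap_le (f : E) {t : Fin d → ℝ} (ht : ∀ k, 0 ≤ t k) :
    ‖orbitMap T f t‖ ≤ ‖f‖ := by
  rw [orbitMap_eq]; exact norm_opList_apply_le T ht _ f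

theorem IsKernel.integrable_orbit (hG : IsKernel G) (f : E) {s : ℝ} (hs : 0 ≤ s) :
    Integrable fun x => G (s, x) • orbitMap T f (s • x) :=
  hG.integrable_smul s
    ((continuousOn_orbitMap_smul f hs).aestronglyMeasurable measurableSet_kernelBox)
    fun _ hx => norm_orbitMap_le f (smul_nonneg_of_mem_kernelBox hs hx)

theorem orbitMap_add (f g : E) (t : Fin d → ℝ) :
    orbitMap T (f + g) t = orbitMap T f t + orbitMap T g t := by simp [orbitMap]

theorem orbitMap_smul (c : ℝ) (f : E) (t : Fin d → ℝ) :
    orbitMap T (c • f) t = c • orbitMap T f t := by simp [orbitMap]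

/-- The operator `f ↦ ∫ G(s, x) T(s x) f dx`. -/
noncomputable def smoothingOp (T : Fin d → ContractionSemigroup E) (hG : IsKernel G) {s : ℝ}
    (hs : 0 ≤ s) : E →L[ℝ] E :=
  LinearMap.mkContinuous
    { toFun := smoothing T G s
      map_add' := fun f g => by
        simp only [smoothing, orbitMap_add, smul_add]
        exact integral_add (hG.integrable_orbit f hs) (hG.integrable_orbit g hs)
      map_smul' := fun c f => by
        simp only [smoothing, orbitMap_smul, RingHom.id_apply]
        rw [← integral_smul]
        simp_rw [smul_comm c] } (∫ x, |G (s, x)|) fun f => by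
      have hi : Integrable fun x => |G (s, x)| := by
        have := (hG.integrable_smul s (g := fun _ => (1 : ℝ))
          aestronglyMeasurable_const (C := 1) (by simp)).abs
        simpa using this
      rw [← integral_mul_const]
      refine norm_integral_le_of_norm_le (hi.mul_const _) (Eventually.of_forall fun x => ?_)
      by_cases hx : x ∈ kernelBox d
      · rw [norm_smul, Real.norm_eq_abs]
        exact mul_le_mul_of_nonneg_left
          (norm_orbitMap_le f (smul_nonneg_of_mem_kernelBox hs hx)) (abs_nonneg _)
      · simp [hG.eq_zero s x hx]

theorem smoothingOp_apply (hG : IsKernel G) {s : ℝ} (hs : 0 ≤ s) (f : E) :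
    smoothingOp T hG hs f = smoothing T G s f := rfl

/-- The smooth form of the commutation assumption: the coefficients are smooth on the whole space
and the identity holds in a neighbourhood of the origin of the orthant. -/
theorem exists_smooth_coefficients (hT : SemigroupAssumption T) :
    ∃ (ζ : Fin d → Fin d → (Fin d → ℝ) → ℝ) (s₀ : ℝ), 0 < s₀ ∧ s₀ ≤ 1 ∧
      (∀ i k, ContDiff ℝ ((⊤ : ℕ∞) : WithTop ℕ∞) (ζ i k)) ∧
      ∀ i, ∀ f ∈ sobolevSpace T 1, ∀ t : Fin d → ℝ, (∀ k, t k ∈ Icc 0 s₀) →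
        (T i).genApply (orbitMap T f t) = ∑ k, ζ i k t • orbitDeriv T f k t := by
  obtain ⟨ζ, hζ, h⟩ := hT.differentiation
  let χ : ContDiffBump (0 : EuclideanSpace ℝ (Fin d)) := ⟨1 / 2, 3 / 4, by norm_num, by norm_num⟩
  let e : (Fin d → ℝ) ≃L[ℝ] EuclideanSpace ℝ (Fin d) := (EuclideanSpace.equiv (Fin d) ℝ).symm
  have hcont : Continuous e := e.continuous
  obtain ⟨ε, hε, hball⟩ := Metric.mem_nhds_iff.1
    (hcont.continuousAt.preimage_mem_nhds (by
      rw [map_zero]; exact Metric.closedBall_mem_nhds (0 : EuclideanSpace ℝ (Fin d))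
        (by norm_num : (0 : ℝ) < 1 / 2)) : e ⁻¹' Metric.closedBall 0 (1 / 2) ∈ 𝓝 0)
  refine ⟨fun i k t => χ (e t) * ζ i k (e t), min (ε / 2) 1, by positivity, min_le_right _ _,
    fun i k => ?_, fun i f hf t ht => ?_⟩
  · have h1 : ContDiff ℝ ((⊤ : ℕ∞) : WithTop ℕ∞) fun y => χ y * ζ i k y := by
      rw [contDiff_iff_contDiffAt]
      intro y
      by_cases hy : y ∈ tsupport χ
      · refine χ.contDiff.contDiffAt.mul ((hζ i k).contDiffAt (Metric.isOpen_ball.mem_nhds ?_))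
        rw [χ.tsupport_eq] at hy
        exact Metric.closedBall_subset_ball (by norm_num) hy
      · have : (fun y => χ y * ζ i k y) =ᶠ[𝓝 y] fun _ => 0 := by
          filter_upwards [(isClosed_tsupport χ).isOpen_compl.mem_nhds hy] with z hz
          rw [image_eq_zero_of_notMem_tsupport hz, zero_mul]
        exact contDiffAt_const.congr_of_eventuallyEq this
    exact h1.comp e.contDiff
  · have hmem : e t ∈ Metric.closedBall (0 : EuclideanSpace ℝ (Fin d)) (1 / 2) := by
      refine hball ?_
      rw [mem_ball_zero_iff]
      refine lt_of_le_of_lt ((pi_norm_le_iff_of_nonneg (r := ε / 2) (by positivity)).2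
        fun k => ?_) (by linarith)
      rw [Real.norm_of_nonneg (ht k).1]
      exact (ht k).2.trans (min_le_left _ _)
    have h1 : χ (e t) = 1 := χ.one_of_mem_closedBall hmem
    have h2 := h i f hf (e t) (Metric.closedBall_subset_ball (by norm_num) hmem)
      fun k => (ht k).1
    simp only [h1, one_mul]
    exact h2

variable [CompleteSpace E]

theorem aestronglyMeasurable_orbitDeriv (hT : SemigroupAssumption T) {f : E}
    (hf : f ∈ sobolevSpace T 1) (k : Fin d) {s : ℝ} (hs : 0 ≤ s) :
    AEStronglyMeasurable (fun x => orbitDeriv T f k (s • x))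
      (volume.restrict (kernelBox d)) := by
  obtain ⟨L, L', h⟩ := exists_hasDerivWithinAt_orbitMap hT k
  -- difference quotients with steps `1 / (n + 1)`
  let e : ℕ → ℝ := fun n => ((n : ℝ) + 1)⁻¹
  have he : ∀ n, 0 < e n := fun n => by positivity
  refine aestronglyMeasurable_of_tendsto_ae atTop (f := fun n x => (e n)⁻¹ •
    (orbitMap T f (Function.update (s • x) k ((s • x) k + e n)) - orbitMap T f (s • x)))
    (fun n => ?_) ?_
  · refine ContinuousOn.aestronglyMeasurable ?_ measurableSet_kernelBox
    refine ContinuousOn.const_smul (ContinuousOn.sub ?_ (continuousOn_orbitMap_smul f hs)) _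
    simp only [orbitMap_eq]
    refine (continuousOn_opList T _ f).comp (Continuous.continuousOn ?_) fun x hx l => ?_
    · exact (continuous_const_smul s).update k (by fun_prop)
    · have hx0 := smul_nonneg_of_mem_kernelBox hs hx
      by_cases hl : l = k
      · subst hl
        rw [Function.update_self]
        exact add_nonneg (hx0 l) (he n).le
      · rw [Function.update_of_ne hl]; exact hx0 l
  · refine (ae_restrict_iff' measurableSet_kernelBox).2 (Eventually.of_forall fun x hx => ?_)
    have hx0 := smul_nonneg_of_mem_kernelBox hs hx
    have h1 := ((h f hf _ hx0).1.mono (Ici_subset_Ici.2 (hx0 k)))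
    rw [hasDerivWithinAt_iff_tendsto_slope, Ici_sdiff_left] at h1
    have h2 : Tendsto (fun n => (s • x) k + e n) atTop (𝓝[>] ((s • x) k)) := by
      refine tendsto_nhdsWithin_iff.2 ⟨?_, Eventually.of_forall fun n => ?_⟩
      · have h3 : Tendsto e atTop (𝓝 0) := by
          simpa [e, one_div] using tendsto_one_div_add_atTop_nhds_zero_nat (𝕜 := ℝ)
        simpa using h3.const_add ((s • x) k)
      · exact lt_add_of_pos_right _ (he n)
    refine (h1.comp h2).congr fun n => ?_
    simp only [slope, Function.comp, vsub_eq_sub, add_sub_cancel_left, Function.update_eq_self]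

theorem norm_orbitDeriv_bound (hT : SemigroupAssumption T) {f : E} (hf : f ∈ sobolevSpace T 1)
    (k : Fin d) {s : ℝ} (hs : 0 < s) :
    ∃ C : ℝ, ∀ x ∈ kernelBox d, ‖orbitDeriv T f k (s • x)‖ ≤ C := by
  obtain ⟨M, hM⟩ := exists_bound_orbitDeriv hT (a := s * (1 / 4)) (b := s) (by positivity) k
  exact ⟨M * graphNorm T f, fun x hx => hM _ (smul_mem_of_mem_kernelBox hs.le hx) f hf⟩

theorem integrable_smul_orbitDeriv (hT : SemigroupAssumption T) (hG : IsKernel G) {f : E}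
    (hf : f ∈ sobolevSpace T 1) (k : Fin d) {s : ℝ} (hs : 0 < s) :
    Integrable fun x => G (s, x) • orbitDeriv T f k (s • x) := by
  obtain ⟨C, hC⟩ := norm_orbitDeriv_bound hT hf k hs
  exact hG.integrable_smul s (aestronglyMeasurable_orbitDeriv hT hf k hs.le) hC

/-- Integration by parts in the variable `x_k`. -/
theorem integral_smul_orbitDeriv (hT : SemigroupAssumption T) (hG : IsKernel G) {f : E}
    (hf : f ∈ sobolevSpace T 1) (k : Fin d) {s : ℝ} (hs : 0 < s) :
    ∫ x, G (s, x) • orbitDeriv T f k (s • x) = -(s⁻¹ • smoothing T (kernelDeriv k G) s f) := by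
  obtain ⟨L, L', h⟩ := exists_hasDerivWithinAt_orbitMap hT k
  have hline : ∀ x ∈ kernelBox d, HasLineDerivAt ℝ (fun x => orbitMap T f (s • x))
      (s • orbitDeriv T f k (s • x)) x (Pi.single k 1) := by
    intro x hx
    have hx0 := smul_nonneg_of_mem_kernelBox hs.le hx
    have hpos : 0 < (s • x) k :=
      lt_of_lt_of_le (by positivity) (smul_mem_of_mem_kernelBox hs.le hx k).1
    have h1 := (h f hf _ hx0).1.hasDerivAt (Ici_mem_nhds hpos)
    have h2 : HasDerivAt (fun τ : ℝ => (s • x) k + s * τ) s 0 := by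
      simpa using ((hasDerivAt_id (0 : ℝ)).const_mul s).const_add ((s • x) k)
    have h3 := HasDerivAt.scomp (0 : ℝ) (h := fun τ : ℝ => (s • x) k + s * τ) (by simpa using h1) h2
    refine h3.congr_of_eventuallyEq (Eventually.of_forall fun τ => ?_)
    simp only [Function.comp]
    congr 1
    ext l
    by_cases hl : l = k
    · subst hl; simp; ring
    · simp [hl]
  have key := integral_bilinear_hasLineDerivAt_right_eq_neg_left_of_integrable (μ := volume)
    (B := (ContinuousLinearMap.lsmul ℝ ℝ : ℝ →L[ℝ] E →L[ℝ] E))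
    (f := fun x => G (s, x)) (f' := fun x => kernelDeriv k G (s, x))
    (g := fun x => orbitMap T f (s • x)) (g' := fun x => s • orbitDeriv T f k (s • x))
    (v := Pi.single k 1)
    ((hG.deriv k).integrable_orbit f hs.le)
    (by
      simp only [ContinuousLinearMap.lsmul_apply, smul_comm _ s]
      exact (integrable_smul_orbitDeriv hT hG hf k hs).smul s)
    (hG.integrable_orbit f hs.le) (fun x _ => hG.hasLineDerivAt s x k)
    (fun x hx => hline x (hG.tsupport_subset s hx))
  simp only [ContinuousLinearMap.lsmul_apply, smul_comm _ s] at key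
  rw [integral_smul] at key
  rw [smoothing, ← smul_neg, ← key, smul_smul, inv_mul_cancel₀ hs.ne', one_smul]

/-- The generator `D_i` applied to a smoothed vector of `E^1`. -/
theorem tendsto_smoothing_of_mem (hT : SemigroupAssumption T) (hG : IsKernel G) (i : Fin d)
    {ζ : Fin d → (Fin d → ℝ) → ℝ} (hζ : ∀ k, ContDiff ℝ ((⊤ : ℕ∞) : WithTop ℕ∞) (ζ k)) {s : ℝ}
    (hs : 0 < s) {f : E} (hf : f ∈ sobolevSpace T 1)
    (h : ∀ t : Fin d → ℝ, (∀ k, t k ∈ Icc 0 s) →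
      (T i).genApply (orbitMap T f t) = ∑ k, ζ k t • orbitDeriv T f k t) :
    Tendsto (fun h : ℝ => h⁻¹ • ((T i).op h (smoothing T G s f) - smoothing T G s f)) (𝓝[>] 0)
      (𝓝 (s⁻¹ • smoothing T (kernelAdjoint ζ G) s f)) := by
  have hmem : ∀ x ∈ kernelBox d, orbitMap T f (s • x) ∈ (T i).generator.domain := fun x hx => by
    rw [orbitMap_eq]
    exact (mem_sobolevSpace_one T).1
      (opList_mem hT (smul_nonneg_of_mem_kernelBox hs.le hx) _ hf) i
  have hint := hG.integrable_orbit (T := T) f hs.le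
  -- the generator passes under the integral, by dominated convergence
  have h1 : Tendsto (fun h : ℝ => h⁻¹ • ((T i).op h (smoothing T G s f) - smoothing T G s f))
      (𝓝[>] 0) (𝓝 (∫ x, G (s, x) • (T i).genApply (orbitMap T f (s • x)))) := by
    have heq : ∀ h : ℝ, ∫ x, G (s, x) • h⁻¹ • ((T i).op h (orbitMap T f (s • x)) -
        orbitMap T f (s • x)) =
        h⁻¹ • ((T i).op h (smoothing T G s f) - smoothing T G s f) := by
      intro h
      rw [smoothing, ← ((T i).op h).integral_comp_comm hint,
        ← integral_sub (((T i).op h).integrable_comp hint) hint, ← integral_smul]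
      refine integral_congr_ae (Eventually.of_forall fun x => ?_)
      simp only [map_smul, smul_sub, smul_comm h⁻¹]
    obtain ⟨M, hM0, hM⟩ := exists_bound_opList hT (a := s * (1 / 4)) (b := s) (by positivity)
      (List.finRange d)
    refine Tendsto.congr heq ?_
    refine tendsto_integral_filter_of_dominated_convergence
      (fun x => |G (s, x)| * (M * graphNorm T f)) ?_ ?_ ?_ ?_
    · refine Eventually.of_forall fun h => ?_
      have := ((((T i).op h).integrable_comp hint).sub hint).smul h⁻¹
      refine (this.aestronglyMeasurable).congr (Eventually.of_forall fun x => ?_)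
      simp only [Pi.smul_apply, Pi.sub_apply, map_smul, smul_sub, smul_comm h⁻¹]
    · filter_upwards [self_mem_nhdsWithin] with h hh
      refine Eventually.of_forall fun x => ?_
      by_cases hx : x ∈ kernelBox d
      · rw [norm_smul, Real.norm_eq_abs]
        refine mul_le_mul_of_nonneg_left ?_ (abs_nonneg _)
        refine (norm_smul_op_sub_le i hh (hmem x hx)).trans
          ((norm_genApply_le_graphNorm T _ i).trans ?_)
        rw [orbitMap_eq]
        exact hM _ (smul_mem_of_mem_kernelBox hs.le hx) f hf
      · simp [hG.eq_zero s x hx]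
    · have := (hG.integrable_smul s (g := fun _ => (1 : ℝ))
        aestronglyMeasurable_const (C := 1) (by simp)).abs
      simpa using this.mul_const (M * graphNorm T f)
    · refine Eventually.of_forall fun x => ?_
      by_cases hx : x ∈ kernelBox d
      · exact ((T i).tendsto_genApply (hmem x hx)).const_smul (G (s, x))
      · simp [hG.eq_zero s x hx]
  convert h1 using 2
  have h2 : ∀ x, G (s, x) • (T i).genApply (orbitMap T f (s • x)) =
      ∑ k, kernelMul (ζ k) G (s, x) • orbitDeriv T f k (s • x) := by
    intro x
    by_cases hx : x ∈ kernelBox d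
    · rw [h (s • x) fun k => ⟨smul_nonneg_of_mem_kernelBox hs.le hx k,
        (smul_mem_of_mem_kernelBox hs.le hx k).2⟩, Finset.smul_sum]
      refine Finset.sum_congr rfl fun k _ => ?_
      rw [smul_smul, kernelMul, mul_comm]
    · simp [kernelMul, hG.eq_zero s x hx]
  simp_rw [h2]
  rw [integral_finsetSum _ fun k _ =>
    integrable_smul_orbitDeriv hT (hG.mul (hζ k)) hf k hs]
  simp_rw [fun k => integral_smul_orbitDeriv hT (hG.mul (hζ k)) hf k hs]
  rw [Finset.sum_neg_distrib, ← Finset.smul_sum, ← smul_neg]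
  congr 1
  simp only [smoothing, kernelAdjoint, neg_smul, Finset.sum_smul]
  rw [integral_neg, integral_finsetSum _ fun k _ =>
    ((hG.mul (hζ k)).deriv k).integrable_orbit f hs.le]

/-- A generator applied to a smoothing operator gives a smoothing operator. -/
theorem tendsto_smoothing (hT : SemigroupAssumption T) (hG : IsKernel G) (i : Fin d)
    {ζ : Fin d → (Fin d → ℝ) → ℝ} (hζ : ∀ k, ContDiff ℝ ((⊤ : ℕ∞) : WithTop ℕ∞) (ζ k)) {s : ℝ}
    (hs : 0 < s)
    (h : ∀ f ∈ sobolevSpace T 1, ∀ t : Fin d → ℝ, (∀ k, t k ∈ Icc 0 s) →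
      (T i).genApply (orbitMap T f t) = ∑ k, ζ k t • orbitDeriv T f k t) (f : E) :
    Tendsto (fun h : ℝ => h⁻¹ • ((T i).op h (smoothing T G s f) - smoothing T G s f)) (𝓝[>] 0)
      (𝓝 (s⁻¹ • smoothing T (kernelAdjoint ζ G) s f)) := by
  -- by density of `E^1` and closedness of the generator
  obtain ⟨x, hx, hlim⟩ := mem_closure_iff_seq_limit.1 (hT.dense f)
  have hx' := fun n => tendsto_smoothing_of_mem hT hG i hζ hs (hx n) (h _ (hx n))
  refine (T i).tendsto_of_closed (l := atTop) (x := fun n => smoothing T G s (x n))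
    (fun n => (T i).mem_domain_of_tendsto (hx' n)) ?_ ?_
  · exact ((smoothingOp T hG hs.le).continuous.tendsto f).comp hlim
  · simp_rw [fun n => (T i).genApply_eq_of_tendsto (hx' n)]
    exact (((smoothingOp T (hG.adjoint hζ) hs.le).continuous.tendsto f).comp hlim).const_smul
      s⁻¹

end Smoothing

/-! ### The smoothing operators and the modulus of continuity -/

section Estimates

variable {d : ℕ}

/-- The formal adjoints of the vector fields `∑_k ζ_i^k ∂_k` applied in succession to a kernel. -/
noncomputable def kernelWord (ζ : Fin d → Fin d → (Fin d → ℝ) → ℝ) (I : List (Fin d))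
    (G : ℝ × (Fin d → ℝ) → ℝ) : ℝ × (Fin d → ℝ) → ℝ :=
  I.foldr (fun i H => kernelAdjoint (ζ i) H) G

variable {ζ : Fin d → Fin d → (Fin d → ℝ) → ℝ} {G : ℝ × (Fin d → ℝ) → ℝ}

theorem IsKernel.word (hG : IsKernel G)
    (hζ : ∀ i k, ContDiff ℝ ((⊤ : ℕ∞) : WithTop ℕ∞) (ζ i k)) (I : List (Fin d)) :
    IsKernel (kernelWord ζ I G) := by
  induction I with
  | nil => exact hG
  | cons i I ih => exact ih.adjoint (hζ i)

theorem kernelWord_append_singleton (I : List (Fin d)) (i : Fin d) :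
    kernelWord ζ (I ++ [i]) G = kernelWord ζ I (kernelAdjoint (ζ i) G) := by
  simp [kernelWord]

theorem IsKernel.enorm_integral_le (hG : IsKernel G) {s C : ℝ} (hC : ∀ x, |G (s, x)| ≤ C)
    {F : Type*} [NormedAddCommGroup F] [NormedSpace ℝ F] {g : (Fin d → ℝ) → F} {B : ℝ≥0∞}
    (hB : ∀ x ∈ kernelBox d, ‖g x‖ₑ ≤ B) :
    ‖∫ x, G (s, x) • g x‖ₑ ≤ ENNReal.ofReal C * volume (kernelBox d) * B :=
  (enorm_integral_le_lintegral_enorm _).trans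
    (hG.lintegral_enorm_smul_le hC (fun c y => (enorm_smul c y).le) hB)

/-- The scalar form of the integration by parts: the kernel `kernelAdjoint ζ G` tested against
`u (s x)` is `s` times `G` tested against `(∑ ζ_k ∂_k u) (s x)`. -/
theorem IsKernel.integral_kernelAdjoint_mul (hG : IsKernel G) {η : Fin d → (Fin d → ℝ) → ℝ}
    (hη : ∀ k, ContDiff ℝ ((⊤ : ℕ∞) : WithTop ℕ∞) (η k)) {u : (Fin d → ℝ) → ℝ}
    (hu : ContDiff ℝ ((⊤ : ℕ∞) : WithTop ℕ∞) u) (s : ℝ) :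
    ∫ x, kernelAdjoint η G (s, x) • u (s • x) =
      s * ∫ x, G (s, x) • ∑ k, η k (s • x) * fderiv ℝ u (s • x) (Pi.single k 1) := by
  have hint : ∀ {H : ℝ × (Fin d → ℝ) → ℝ}, IsKernel H → ∀ {v : (Fin d → ℝ) → ℝ}, Continuous v →
      Integrable fun x => H (s, x) • v (s • x) := by
    intro H hH v hv
    have hc : Continuous fun x : Fin d → ℝ => v (s • x) := hv.comp (continuous_const_smul s)
    obtain ⟨B, hB⟩ := isCompact_kernelBox.exists_bound_of_continuousOn
      hc.continuousOn (s := kernelBox d)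
    exact hH.integrable_smul s hc.aestronglyMeasurable hB
  have hdu : ∀ k, Continuous fun t => fderiv ℝ u t (Pi.single k 1) := fun k =>
    (hu.continuous_fderiv (by simp)).clm_apply continuous_const
  have hline : ∀ (x : Fin d → ℝ) (k : Fin d), HasLineDerivAt ℝ (fun x => u (s • x))
      (s • fderiv ℝ u (s • x) (Pi.single k 1)) x (Pi.single k 1) := by
    intro x k
    have h1 : HasFDerivAt u (fderiv ℝ u (s • x)) (s • x) :=
      (hu.differentiable (by simp) (s • x)).hasFDerivAt
    have h2 : HasFDerivAt (fun x : Fin d → ℝ => s • x)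
        (s • ContinuousLinearMap.id ℝ (Fin d → ℝ)) x := (hasFDerivAt_id x).const_smul s
    have h3 := (h1.comp x h2).hasLineDerivAt (Pi.single k 1)
    have e : ((fderiv ℝ u (s • x)).comp (s • ContinuousLinearMap.id ℝ (Fin d → ℝ)))
        (Pi.single k 1) = s • fderiv ℝ u (s • x) (Pi.single k 1) := by simp
    rw [e] at h3
    exact h3
  have key : ∀ k, ∫ x, kernelDeriv k (kernelMul (η k) G) (s, x) • u (s • x) =
      -(s * ∫ x, kernelMul (η k) G (s, x) • fderiv ℝ u (s • x) (Pi.single k 1)) := by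
    intro k
    have hM := hG.mul (hη k)
    have h := integral_bilinear_hasLineDerivAt_right_eq_neg_left_of_integrable (μ := volume)
      (B := (ContinuousLinearMap.lsmul ℝ ℝ : ℝ →L[ℝ] ℝ →L[ℝ] ℝ))
      (f := fun x => kernelMul (η k) G (s, x))
      (f' := fun x => kernelDeriv k (kernelMul (η k) G) (s, x))
      (g := fun x => u (s • x)) (g' := fun x => s • fderiv ℝ u (s • x) (Pi.single k 1))
      (v := Pi.single k 1) (hint (hM.deriv k) hu.continuous)
      (by
        simp only [ContinuousLinearMap.lsmul_apply, smul_comm _ s]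
        exact (hint hM (hdu k)).smul s)
      (hint hM hu.continuous) (fun x _ => hM.hasLineDerivAt s x k) (fun x _ => hline x k)
    simp only [ContinuousLinearMap.lsmul_apply, smul_comm _ s] at h
    rw [integral_smul, smul_eq_mul s] at h
    rw [h, neg_neg]
  have h1 : ∀ x, kernelAdjoint η G (s, x) • u (s • x) =
      -∑ k, kernelDeriv k (kernelMul (η k) G) (s, x) • u (s • x) := by
    intro x
    rw [kernelAdjoint, neg_smul, Finset.sum_smul]
  have h2 : ∀ x, G (s, x) • ∑ k, η k (s • x) * fderiv ℝ u (s • x) (Pi.single k 1) =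
      ∑ k, kernelMul (η k) G (s, x) • fderiv ℝ u (s • x) (Pi.single k 1) := by
    intro x
    rw [Finset.smul_sum]
    refine Finset.sum_congr rfl fun k _ => ?_
    simp only [kernelMul, smul_eq_mul]
    ring
  simp_rw [h1, h2]
  rw [integral_neg, integral_finsetSum _ fun k _ =>
      hint ((hG.mul (hη k)).deriv k) hu.continuous,
    integral_finsetSum _ fun k _ => hint (hG.mul (hη k)) (hdu k), Finset.mul_sum,
    ← Finset.sum_neg_distrib]
  refine Finset.sum_congr rfl fun k _ => ?_
  rw [key k, neg_neg]

/-- Derivatives that fell on the kernel are moved back to a fixed smooth function of `s x`, each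
of them with a gain of a factor `s`. -/
theorem IsKernel.exists_bound_integral_word (hG : IsKernel G)
    (hζ : ∀ i k, ContDiff ℝ ((⊤ : ℕ∞) : WithTop ℕ∞) (ζ i k)) (I : List (Fin d))
    {u : (Fin d → ℝ) → ℝ} (hu : ContDiff ℝ ((⊤ : ℕ∞) : WithTop ℕ∞) u) :
    ∃ C : NNReal, ∀ s : ℝ, 0 < s → s ≤ 1 →
      ‖∫ x, kernelWord ζ I G (s, x) • u (s • x)‖ₑ ≤ C * ENNReal.ofReal (s ^ I.length) := by
  induction I generalizing u with
  | nil =>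
    obtain ⟨C, hC0, hC⟩ := (hG.mul hu).exists_bound
    refine ⟨(C.toNNReal) * (volume (kernelBox d)).toNNReal, fun s hs hs1 => ?_⟩
    have h := (hG.mul hu).enorm_integral_le (hC s ⟨hs.le, hs1⟩)
      (g := fun _ => (1 : ℝ)) (B := 1) (by simp)
    have h2 : ∀ x, kernelMul u G (s, x) • (1 : ℝ) = kernelWord ζ [] G (s, x) • u (s • x) := by
      intro x; simp [kernelMul, kernelWord, mul_comm]
    simp_rw [h2] at h
    rw [ENNReal.coe_mul, ENNReal.coe_toNNReal isCompact_kernelBox.measure_lt_top.ne]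
    simpa [ENNReal.ofReal] using h
  | cons i I ih =>
    obtain ⟨C, hC⟩ := ih (u := fun t => ∑ k, ζ i k t * fderiv ℝ u t (Pi.single k 1))
      (ContDiff.sum fun k _ => (hζ i k).mul ((hu.fderiv_right (by simp)).clm_apply contDiff_const))
    refine ⟨C, fun s hs hs1 => ?_⟩
    have h := (hG.word hζ I).integral_kernelAdjoint_mul (hζ i) hu s
    change ‖∫ x, kernelAdjoint (ζ i) (kernelWord ζ I G) (s, x) • u (s • x)‖ₑ ≤ _
    rw [h, enorm_mul, Real.enorm_eq_ofReal hs.le, List.length_cons, pow_succ',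
      ENNReal.ofReal_mul hs.le, mul_left_comm]
    exact mul_le_mul_right (hC s hs hs1) _

variable {E : Type*} [NormedAddCommGroup E] [NormedSpace ℝ E] [CompleteSpace E]
  (T : Fin d → ContractionSemigroup E)

/-- The moduli of continuity of all orders up to `m`, with their natural weights. -/
noncomputable def weightedModulus (m : ℕ) (s : ℝ) (f : E) : ℝ≥0∞ :=
  ∑ l ∈ Finset.range (m + 1), ENNReal.ofReal (s ^ (m - l)) * supModulus T s l f

/-- A derivative of order `m` of a smoothed vector, multiplied by `s ^ m`: the Taylor polynomial
of the orbit is integrated by parts, and the remainder is a modulus of continuity. -/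
theorem IsKernel.exists_bound_smoothing_word (hG : IsKernel G)
    (hζ : ∀ i k, ContDiff ℝ ((⊤ : ℕ∞) : WithTop ℕ∞) (ζ i k)) (I : List (Fin d)) :
    ∃ C : NNReal, ∀ s : ℝ, 0 < s → s ≤ 1 → ∀ f : E,
      ‖smoothing T (kernelWord ζ I G) s f‖ₑ ≤ C * weightedModulus T I.length s f := by
  set m := I.length with hm
  obtain ⟨ι, _, u, deg, C₀, hu, hub, hx⟩ := exists_taylor_opList T m (List.finRange d)
  choose C₁ hC₁ using fun a => hG.exists_bound_integral_word hζ I (hu a)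
  have hH := hG.word hζ I
  obtain ⟨C₂, hC₂0, hC₂⟩ := hH.exists_bound
  obtain ⟨V, hVcoe⟩ : ∃ V : NNReal, (V : ℝ≥0∞) = ENNReal.ofReal C₂ * volume (kernelBox d) := by
    refine ⟨C₂.toNNReal * (volume (kernelBox d)).toNNReal, ?_⟩
    rw [ENNReal.coe_mul, ENNReal.coe_toNNReal isCompact_kernelBox.measure_lt_top.ne]
    rfl
  refine ⟨V * C₀ + ∑ a, (C₁ a + V * 2 ^ (deg a - m)) * C₀, fun s hs hs1 f => ?_⟩
  obtain ⟨x, hxb, hrem⟩ := hx s hs f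
  have hbox : ∀ y ∈ kernelBox d, ∀ k, (s • y) k ∈ Icc 0 s := fun y hy k =>
    ⟨smul_nonneg_of_mem_kernelBox hs.le hy k, (smul_mem_of_mem_kernelBox hs.le hy k).2⟩
  have hle : ∀ l ≤ m, ENNReal.ofReal (s ^ (m - l)) * supModulus T s l f ≤
      weightedModulus T m s f := fun l hl =>
    Finset.single_le_sum (f := fun l => ENNReal.ofReal (s ^ (m - l)) * supModulus T s l f)
      (fun _ _ => zero_le) (Finset.mem_range.2 (Nat.lt_succ_of_le hl))
  have hlem : supModulus T s m f ≤ weightedModulus T m s f := by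
    simpa using hle m le_rfl
  have hinta : ∀ a, Integrable fun y => kernelWord ζ I G (s, y) • u a (s • y) := fun a =>
    hH.integrable_smul s (C := s ^ deg a)
      (((hu a).continuous.comp (continuous_const_smul s)).aestronglyMeasurable)
      fun y hy => hub a s _ (hbox y hy)
  have hinto := hH.integrable_orbit (T := T) f hs.le
  have hsplit : smoothing T (kernelWord ζ I G) s f =
      (∫ y, kernelWord ζ I G (s, y) • (orbitMap T f (s • y) - ∑ a, u a (s • y) • x a)) +
      ∑ a, (∫ y, kernelWord ζ I G (s, y) • u a (s • y)) • x a := by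
    simp only [smul_sub, Finset.smul_sum]
    rw [integral_sub hinto (integrable_finsetSum _ fun a _ => by
        simpa [mul_smul] using (hinta a).smul_const (x a)), integral_finsetSum _ fun a _ => by
        simpa [mul_smul] using (hinta a).smul_const (x a)]
    simp only [← integral_smul_const, smul_assoc]
    rw [smoothing, sub_add_cancel]
  rw [hsplit, ENNReal.coe_add, add_mul]
  refine (enorm_add_le _ _).trans (add_le_add ?_ ?_)
  · refine (hH.enorm_integral_le (hC₂ s ⟨hs.le, hs1⟩) (B := C₀ * supModulus T s m f)
      fun y hy => ?_).trans ?_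
    · rw [orbitMap_eq]; exact hrem _ (hbox y hy)
    · rw [← hVcoe, ENNReal.coe_mul, mul_assoc]
      gcongr
  · rw [ENNReal.ofNNReal_finsetSum, Finset.sum_mul]
    refine (enorm_sum_le _ _).trans (Finset.sum_le_sum fun a _ => ?_)
    rw [enorm_smul]
    have hxa := hxb a 0
    rw [supModulus_zero, Nat.zero_add] at hxa
    have hcancel : ∀ n, ENNReal.ofReal (s ^ n) * ENNReal.ofReal (s⁻¹ ^ n) = 1 := fun n => by
      rw [← ENNReal.ofReal_mul (by positivity), ← mul_pow, mul_inv_cancel₀ hs.ne', one_pow,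
        ENNReal.ofReal_one]
    rw [ENNReal.coe_mul, ENNReal.coe_add, add_mul, add_mul]
    rcases le_total (deg a) m with h | h
    · refine le_trans ?_ le_self_add
      calc _ ≤ (C₁ a * ENNReal.ofReal (s ^ m)) * (C₀ * ENNReal.ofReal (s⁻¹ ^ deg a) *
            supModulus T s (deg a) f) := mul_le_mul' (hC₁ a s hs hs1) hxa
        _ = C₁ a * C₀ * ((ENNReal.ofReal (s ^ deg a) * ENNReal.ofReal (s⁻¹ ^ deg a)) *
            (ENNReal.ofReal (s ^ (m - deg a)) * supModulus T s (deg a) f)) := by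
            have : s ^ m = s ^ deg a * s ^ (m - deg a) := by rw [← pow_add]; congr 1; omega
            rw [this, ENNReal.ofReal_mul (by positivity)]
            ring
        _ ≤ _ := by
            rw [hcancel, one_mul]
            exact mul_le_mul_right (hle _ h) _
    · refine le_trans ?_ le_add_self
      have h1 : ‖∫ y, kernelWord ζ I G (s, y) • u a (s • y)‖ₑ ≤
          V * ENNReal.ofReal (s ^ deg a) := by
        rw [hVcoe]
        refine hH.enorm_integral_le (hC₂ s ⟨hs.le, hs1⟩) fun y hy => ?_
        rw [← ofReal_norm]
        exact ENNReal.ofReal_le_ofReal (hub a s _ (hbox y hy))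
      have h2 : supModulus T s (deg a) f ≤ 2 ^ (deg a - m) * supModulus T s m f := by
        have := supModulus_add_right_le T s m (deg a - m) f
        rwa [show m + (deg a - m) = deg a by omega] at this
      calc _ ≤ (V * ENNReal.ofReal (s ^ deg a)) * (C₀ * ENNReal.ofReal (s⁻¹ ^ deg a) *
            (2 ^ (deg a - m) * supModulus T s m f)) := by
            refine mul_le_mul' h1 (hxa.trans ?_)
            gcongr
        _ = (ENNReal.ofReal (s ^ deg a) * ENNReal.ofReal (s⁻¹ ^ deg a)) *
            ((V * 2 ^ (deg a - m)) * C₀ * supModulus T s m f) := by ring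
        _ ≤ _ := by
            rw [hcancel, one_mul]
            push_cast
            gcongr

variable {T}

/-- The norm in `E^k` of a smoothed vector, in terms of the words in the adjoint vector fields. -/
theorem sobolevNorm_smoothing_le (hT : SemigroupAssumption T)
    (hζ : ∀ i k, ContDiff ℝ ((⊤ : ℕ∞) : WithTop ℕ∞) (ζ i k)) {s : ℝ} (hs : 0 < s)
    (h : ∀ i, ∀ f ∈ sobolevSpace T 1, ∀ t : Fin d → ℝ, (∀ k, t k ∈ Icc 0 s) →
      (T i).genApply (orbitMap T f t) = ∑ k, ζ i k t • orbitDeriv T f k t) (f : E) (k : ℕ)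
    {G : ℝ × (Fin d → ℝ) → ℝ} (hG : IsKernel G) {Y : ℝ≥0∞}
    (hY : ∀ I : List (Fin d), I.length ≤ k →
      ‖smoothing T (kernelWord ζ I G) s f‖ₑ ≤ ENNReal.ofReal (s ^ I.length) * Y) :
    sobolevNorm T k (smoothing T G s f) ≤ (1 + d) ^ k * Y := by
  induction k generalizing G Y with
  | zero => simpa [sobolevNorm_zero, kernelWord] using hY [] le_rfl
  | succ k ih =>
    have hD := fun i => tendsto_smoothing hT hG i (hζ i) hs (h i) f
    rw [sobolevNorm_succ T fun i => (T i).mem_domain_of_tendsto (hD i)]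
    have h0 : ‖smoothing T G s f‖ₑ ≤ Y := by simpa [kernelWord] using hY [] (Nat.zero_le _)
    have h1 : ∀ i, sobolevNorm T k ((T i).genApply (smoothing T G s f)) ≤ (1 + d) ^ k * Y := by
      intro i
      rw [(T i).genApply_eq_of_tendsto (hD i)]
      refine (sobolevNorm_smul_le T k (inv_ne_zero hs.ne') _).trans ?_
      have h2 := ih (hG.adjoint (hζ i)) (Y := ENNReal.ofReal s * Y) fun I hI => by
        have := hY (I ++ [i]) (by simpa using hI)
        rw [kernelWord_append_singleton, List.length_append, List.length_singleton, pow_succ,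
          ENNReal.ofReal_mul (by positivity), mul_assoc] at this
        exact this
      refine (mul_le_mul_right h2 _).trans (le_of_eq ?_)
      rw [Real.enorm_eq_ofReal (by positivity)]
      calc _ = (ENNReal.ofReal s⁻¹ * ENNReal.ofReal s) * ((1 + d) ^ k * Y) := by ring
        _ = _ := by
          rw [← ENNReal.ofReal_mul (by positivity), inv_mul_cancel₀ hs.ne', ENNReal.ofReal_one,
            one_mul]
    calc _ ≤ Y + ∑ _i : Fin d, ((1 + d : ℝ≥0∞) ^ k * Y) :=
          add_le_add h0 (Finset.sum_le_sum fun i _ => h1 i)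
      _ ≤ (1 + d : ℝ≥0∞) ^ k * Y + d * ((1 + d : ℝ≥0∞) ^ k * Y) := by
          rw [Finset.sum_const, Finset.card_univ, Fintype.card_fin, nsmul_eq_mul]
          gcongr
          exact le_mul_of_one_le_left' (one_le_pow₀ le_self_add)
      _ = _ := by ring

/-- There is a kernel of integral one. -/
theorem exists_kernel (d : ℕ) : ∃ φ : (Fin d → ℝ) → ℝ, IsKernel (fun p => φ p.2) ∧
    Integrable φ ∧ ∫ x, φ x = 1 := by
  let b : ContDiffBump (fun _ => 1 / 2 : Fin d → ℝ) := ⟨1 / 8, 1 / 4, by norm_num, by norm_num⟩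
  refine ⟨b.normed volume, ⟨b.contDiff_normed.comp contDiff_snd, fun s x hx => ?_⟩,
    b.integrable_normed, b.integral_normed⟩
  by_contra h
  have h1 : x ∈ Function.support (b.normed volume) := h
  rw [b.support_normed_eq, mem_ball_iff_norm] at h1
  refine hx ⟨fun k => ?_, fun k => ?_⟩
  all_goals
    have h2 := (norm_le_pi_norm (x - fun _ => 1 / 2) k).trans h1.le
    rw [Pi.sub_apply, Real.norm_eq_abs, abs_le] at h2
    have h3 : b.rOut = 1 / 4 := rfl
    rw [h3] at h2
    linarith [h2.1, h2.2]

/-- The smoothing operators have order zero. -/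
theorem IsKernel.exists_vanishesToOrder (hG : IsKernel G) :
    ∃ C : NNReal, ∀ s : ℝ, ∀ hs : 0 < s, s ≤ 1 →
      VanishesToOrder T s 0 C (smoothingOp T hG hs.le) := by
  obtain ⟨C, hC⟩ := exists_vanishesToOrder_opList T (List.finRange d)
  obtain ⟨C₂, hC₂0, hC₂⟩ := hG.exists_bound
  refine ⟨C₂.toNNReal * (volume (kernelBox d)).toNNReal * C, fun s hs hs1 m f => ?_⟩
  rw [smoothingOp_apply, smoothing]
  refine (supModulus_integral_le T s m (hG.integrable_orbit f hs.le)).trans ?_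
  refine (hG.lintegral_enorm_smul_le (hC₂ s ⟨hs.le, hs1⟩) (supModulus_smul_le T s m)
    (B := C * supModulus T s m f) fun x hx => ?_).trans (le_of_eq ?_)
  · rw [orbitMap_eq]
    exact (hC s (s • x) fun k => ⟨smul_nonneg_of_mem_kernelBox hs.le hx k,
      (smul_mem_of_mem_kernelBox hs.le hx k).2⟩).1 m f
  · rw [ENNReal.coe_mul, ENNReal.coe_mul,
      ENNReal.coe_toNNReal isCompact_kernelBox.measure_lt_top.ne, add_zero, ← mul_assoc]
    rfl

/-- With a kernel of integral one, `1 - P` is an average of first order differences. -/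
theorem exists_vanishesToOrder_one_sub {φ : (Fin d → ℝ) → ℝ} (hφ : IsKernel fun p => φ p.2)
    (hi : Integrable φ) (h1 : ∫ x, φ x = 1) :
    ∃ C : NNReal, ∀ s : ℝ, ∀ hs : 0 < s, s ≤ 1 →
      VanishesToOrder T s 1 C (1 - smoothingOp T hφ hs.le) := by
  obtain ⟨C, hC⟩ := exists_vanishesToOrder_opList T (List.finRange d)
  obtain ⟨C₂, hC₂0, hC₂⟩ := hφ.exists_bound
  refine ⟨C₂.toNNReal * (volume (kernelBox d)).toNNReal * C, fun s hs hs1 m f => ?_⟩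
  have hio := hφ.integrable_orbit (T := T) f hs.le
  have hic : Integrable fun x => φ x • f := hi.smul_const f
  have h2 : (1 - smoothingOp T hφ hs.le : E →L[ℝ] E) f =
      -∫ x, φ x • (orbitMap T f (s • x) - f) := by
    simp only [smul_sub]
    rw [integral_sub hio hic, integral_smul_const, h1, one_smul, neg_sub]
    rfl
  have hid : Integrable fun x => φ x • (orbitMap T f (s • x) - f) := by
    simp only [smul_sub]
    exact hio.sub hic
  rw [h2]
  refine (supModulus_neg_le T s m _).trans ((supModulus_integral_le T s m hid).trans ?_)
  refine (hφ.lintegral_enorm_smul_le (hC₂ s ⟨hs.le, hs1⟩) (supModulus_smul_le T s m)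
    (B := C * supModulus T s (m + 1) f) fun x hx => ?_).trans (le_of_eq ?_)
  · rw [orbitMap_eq]
    exact (hC s (s • x) fun k => ⟨smul_nonneg_of_mem_kernelBox hs.le hx k,
      (smul_mem_of_mem_kernelBox hs.le hx k).2⟩).2 m f
  · rw [ENNReal.coe_mul, ENNReal.coe_mul,
      ENNReal.coe_toNNReal isCompact_kernelBox.measure_lt_top.ne, ← mul_assoc]
    rfl

/-- Every vector is, at each small scale `s`, the sum of a vector of the size of its modulus of
continuity and a vector of `E^r` controlled by the moduli of all orders up to `r`. -/
theorem exists_decomposition (hT : SemigroupAssumption T) (r : ℕ) :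
    ∃ (C : NNReal) (s₀ : ℝ), 0 < s₀ ∧ s₀ ≤ 1 ∧ ∀ s : ℝ, 0 < s → s ≤ s₀ → ∀ f : E,
      ∃ f₀ f₁ : E, f₀ + f₁ = f ∧ ‖f₀‖ₑ ≤ C * supModulus T s r f ∧
        ENNReal.ofReal (s ^ r) * sobolevNorm T r f₁ ≤ C * weightedModulus T r s f := by
  obtain ⟨ζ, s₀, hs₀, hs₀1, hζ, h⟩ := exists_smooth_coefficients hT
  obtain ⟨φ, hφ, hi, h1⟩ := exists_kernel d
  obtain ⟨C₁, hC₁⟩ := exists_vanishesToOrder_one_sub (T := T) hφ hi h1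
  obtain ⟨C₀, hC₀⟩ := hφ.exists_vanishesToOrder (T := T)
  choose C₂ hC₂ using fun I => hφ.exists_bound_smoothing_word T hζ I
  -- one constant for all words of length at most `r`
  obtain ⟨C₃, hC₃⟩ : ∃ C₃ : NNReal, ∀ I : List (Fin d), I.length ≤ r → C₂ I ≤ C₃ := by
    have hfin : {I : List (Fin d) | I.length ≤ r}.Finite := List.finite_length_le (Fin d) r
    obtain ⟨M, hM⟩ := (hfin.image C₂).bddAbove
    exact ⟨M, fun I hI => hM ⟨I, hI, rfl⟩⟩
  set c : NNReal := ∑ i ∈ Finset.range r, (1 + C₀) ^ i with hc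
  refine ⟨C₁ ^ r + (1 + d) ^ r * C₃ * c, s₀, hs₀, hs₀1, fun s hs hss f => ?_⟩
  have hs1 := hss.trans hs₀1
  set P := smoothingOp T hφ hs.le with hP
  set Z : E →L[ℝ] E := ∑ i ∈ Finset.range r, (1 - P) ^ i with hZ
  have vZ : VanishesToOrder T s 0 c Z := VanishesToOrder.sum _ fun i _ => by
    simpa using (VanishesToOrder.one.sub (hC₀ s hs hs1)).pow i
  have vr : VanishesToOrder T s r (C₁ ^ r) ((1 - P) ^ r) := by simpa using (hC₁ s hs hs1).pow r
  have hPZ : P * Z = 1 - (1 - P) ^ r := by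
    have := mul_neg_geom_sum (1 - P) r
    rwa [sub_sub_cancel] at this
  refine ⟨((1 - P) ^ r) f, P (Z f), ?_, ?_, ?_⟩
  · rw [← mul_apply_eq_comp, hPZ]
    simp
  · have := vr 0 f
    rw [supModulus_zero, Nat.zero_add] at this
    refine this.trans ?_
    gcongr
    exact le_self_add
  · have hcancel : ENNReal.ofReal (s ^ r) * ENNReal.ofReal (s⁻¹ ^ r) = 1 := by
      rw [← ENNReal.ofReal_mul (by positivity), ← mul_pow, mul_inv_cancel₀ hs.ne', one_pow,
        ENNReal.ofReal_one]
    have hw : weightedModulus T r s (Z f) ≤ c * weightedModulus T r s f := by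
      rw [weightedModulus, weightedModulus, Finset.mul_sum]
      refine Finset.sum_le_sum fun l _ => ?_
      rw [mul_left_comm]
      exact mul_le_mul_right (by simpa using vZ l f) _
    have key := sobolevNorm_smoothing_le hT hζ hs
      (fun i g hg t ht => h i g hg t fun k => ⟨(ht k).1, (ht k).2.trans hss⟩) (Z f) r hφ
      (Y := C₃ * (ENNReal.ofReal (s⁻¹ ^ r) * weightedModulus T r s (Z f))) fun I hI => by
        refine (hC₂ I s hs hs1 (Z f)).trans ?_
        have h2 : weightedModulus T I.length s (Z f) ≤ ENNReal.ofReal (s ^ I.length) *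
            (ENNReal.ofReal (s⁻¹ ^ r) * weightedModulus T r s (Z f)) := by
          rw [weightedModulus, weightedModulus, Finset.mul_sum, Finset.mul_sum]
          refine (Finset.sum_le_sum fun l hl => ?_).trans
            (Finset.sum_le_sum_of_subset (Finset.range_mono (Nat.succ_le_succ hI)))
          have hl' : l ≤ I.length := Nat.lt_succ_iff.1 (Finset.mem_range.1 hl)
          rw [← mul_assoc, ← mul_assoc, ← ENNReal.ofReal_mul (by positivity),
            ← ENNReal.ofReal_mul (by positivity)]
          refine le_of_eq ?_
          congr 2
          have e1 : s ^ r = s ^ (I.length) * s ^ (r - I.length) := by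
            rw [← pow_add]; congr 1; omega
          have e2 : s ^ (r - l) = s ^ (I.length - l) * s ^ (r - I.length) := by
            rw [← pow_add]; congr 1; omega
          rw [inv_pow, e1, e2]
          field_simp
        calc (C₂ I : ℝ≥0∞) * weightedModulus T I.length s (Z f) ≤
              C₃ * (ENNReal.ofReal (s ^ I.length) *
            (ENNReal.ofReal (s⁻¹ ^ r) * weightedModulus T r s (Z f))) := by
              gcongr
              exact_mod_cast hC₃ I hI
          _ = _ := by ring
    calc _ ≤ ENNReal.ofReal (s ^ r) * ((1 + d) ^ r *
          (C₃ * (ENNReal.ofReal (s⁻¹ ^ r) * weightedModulus T r s (Z f)))) := by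
          gcongr
          exact key
      _ = (ENNReal.ofReal (s ^ r) * ENNReal.ofReal (s⁻¹ ^ r)) *
          ((1 + d) ^ r * C₃ * weightedModulus T r s (Z f)) := by ring
      _ ≤ ((1 + d) ^ r * C₃) * (c * weightedModulus T r s f) := by
          rw [hcancel, one_mul]
          gcongr
      _ = (((1 + d) ^ r * C₃ * c : NNReal) : ℝ≥0∞) * weightedModulus T r s f := by
          push_cast; ring
      _ ≤ _ := by
          gcongr
          exact le_add_self

end Estimates

/-! ### The K-functional and the modulus of continuity -/

section KFunctional

theorem le_kFunctional {A : Type*} [AddCommGroup A] {N₀ N₁ : A → ℝ≥0∞} {t : ℝ} {f : A} {B : ℝ≥0∞}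
    (h : ∀ f₀ f₁ : A, f₀ + f₁ = f → N₀ f₀ ≠ ⊤ → N₁ f₁ ≠ ⊤ →
      B ≤ N₀ f₀ + ENNReal.ofReal t * N₁ f₁) : B ≤ kFunctional N₀ N₁ t f :=
  le_iInf fun f₀ => le_iInf fun f₁ => le_iInf fun hf => le_iInf fun h₀ => le_iInf fun h₁ =>
    h f₀ f₁ hf h₀ h₁

/-- The bound by a decomposition holds also when one of the two norms is infinite, provided that
`t > 0`. -/
theorem kFunctional_le {A : Type*} [AddCommGroup A] {N₀ N₁ : A → ℝ≥0∞} {t : ℝ} {f f₀ f₁ : A}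
    (hf : f₀ + f₁ = f) (h : 0 < t ∨ N₁ f₁ ≠ ⊤) :
    kFunctional N₀ N₁ t f ≤ N₀ f₀ + ENNReal.ofReal t * N₁ f₁ := by
  by_cases h₀ : N₀ f₀ = ⊤
  · rw [h₀, top_add]; exact le_top
  by_cases h₁ : N₁ f₁ = ⊤
  · have ht : 0 < t := h.resolve_right (not_not.2 h₁)
    rw [h₁, ENNReal.mul_top (by simpa using ht), add_top]; exact le_top
  exact iInf_le_of_le f₀ (iInf_le_of_le f₁ (iInf_le_of_le hf (iInf_le_of_le h₀
    (iInf_le_of_le h₁ le_rfl))))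

/-- An estimate by all decompositions, up to a multiplicative and an additive constant, passes to
the K-functional. -/
theorem le_mul_kFunctional_add {A : Type*} [AddCommGroup A] {N₀ N₁ : A → ℝ≥0∞} {t : ℝ} {f : A}
    {B B' c : ℝ≥0∞} (hc : c ≠ 0) (hc' : c ≠ ⊤)
    (h : ∀ f₀ f₁ : A, f₀ + f₁ = f → N₀ f₀ ≠ ⊤ → N₁ f₁ ≠ ⊤ →
      B ≤ c * (N₀ f₀ + ENNReal.ofReal t * N₁ f₁) + B') : B ≤ c * kFunctional N₀ N₁ t f + B' := by
  have h1 : (B - B') / c ≤ kFunctional N₀ N₁ t f := le_kFunctional fun f₀ f₁ hf h₀ h₁ =>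
    ENNReal.div_le_of_le_mul' (tsub_le_iff_right.2 (h f₀ f₁ hf h₀ h₁))
  rw [ENNReal.div_le_iff hc hc', mul_comm] at h1
  exact tsub_le_iff_right.1 h1

theorem kFunctional_mono {A : Type*} [AddCommGroup A] (N₀ N₁ : A → ℝ≥0∞) {t t' : ℝ} (h : t ≤ t')
    (f : A) : kFunctional N₀ N₁ t f ≤ kFunctional N₀ N₁ t' f :=
  le_kFunctional fun f₀ f₁ hf _ h₁ => (kFunctional_le hf (Or.inr h₁)).trans (by gcongr)

theorem kFunctional_add_le {A : Type*} [AddCommGroup A] {N₀ N₁ : A → ℝ≥0∞}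
    (hN₀ : ∀ f g, N₀ (f + g) ≤ N₀ f + N₀ g) (hN₁ : ∀ f g, N₁ (f + g) ≤ N₁ f + N₁ g) (t : ℝ)
    (f g : A) :
    kFunctional N₀ N₁ t (f + g) ≤ kFunctional N₀ N₁ t f + kFunctional N₀ N₁ t g := by
  have h1 : ∀ f₀ f₁ : A, f₀ + f₁ = f → N₀ f₀ ≠ ⊤ → N₁ f₁ ≠ ⊤ → kFunctional N₀ N₁ t (f + g) ≤
      1 * kFunctional N₀ N₁ t g + (N₀ f₀ + ENNReal.ofReal t * N₁ f₁) := by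
    intro f₀ f₁ hf h₀ h₁
    refine le_mul_kFunctional_add one_ne_zero ENNReal.one_ne_top fun g₀ g₁ hg k₀ k₁ => ?_
    have hlt : N₁ (f₁ + g₁) ≠ ⊤ := ne_top_of_le_ne_top (ENNReal.add_ne_top.2 ⟨h₁, k₁⟩) (hN₁ _ _)
    refine (kFunctional_le (f₀ := f₀ + g₀) (f₁ := f₁ + g₁) (by rw [← hf, ← hg]; abel)
      (Or.inr hlt)).trans ((add_le_add (hN₀ _ _) (mul_le_mul_right (hN₁ _ _) _)).trans
      (le_of_eq ?_))
    ring
  have h2 := le_mul_kFunctional_add (N₀ := N₀) (N₁ := N₁) (t := t) (f := f)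
    (B := kFunctional N₀ N₁ t (f + g)) (B' := kFunctional N₀ N₁ t g) one_ne_zero
    ENNReal.one_ne_top fun f₀ f₁ hf h₀ h₁ => by
      have h3 := h1 f₀ f₁ hf h₀ h₁
      rw [one_mul] at h3 ⊢
      exact h3.trans (add_comm _ _).le
  simpa using h2

variable {E : Type*} [NormedAddCommGroup E] [NormedSpace ℝ E] {d : ℕ}
  (T : Fin d → ContractionSemigroup E)

theorem mixedDeriv_apply_zero {k : ℕ} (j : Fin k → Fin d) : mixedDeriv T j (0 : E) = 0 := by
  induction k with
  | zero => exact mixedDeriv_zero T j 0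
  | succ k ih =>
    have h := mixedDeriv_snoc T (Fin.init j) (j (Fin.last k)) 0
    rw [Fin.snoc_init_self] at h
    have h2 : (T (j (Fin.last k))).genApply 0 = 0 := by
      simpa using (T (j (Fin.last k))).genApply_smul 0 (Submodule.zero_mem _)
    rw [h, h2, ih]

theorem sobolevNorm_apply_zero (r : ℕ) : sobolevNorm T r (0 : E) = 0 := by
  rw [sobolevNorm_of_mem T (Submodule.zero_mem _)]
  refine Finset.sum_eq_zero fun l _ => Finset.sum_eq_zero fun j _ => ?_
  rw [mixedDeriv_apply_zero, enorm_zero]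

theorem kFunctional_le_enorm (r : ℕ) (t : ℝ) (f : E) :
    kFunctional (fun g : E => ‖g‖ₑ) (sobolevNorm T r) t f ≤ ‖f‖ₑ := by
  have h0 := sobolevNorm_apply_zero T r
  refine (kFunctional_le (f₀ := f) (f₁ := 0) (add_zero f) (Or.inr (by simp [h0]))).trans ?_
  simp [h0]

theorem tendsto_supModulus_one (f : E) :
    Tendsto (fun s : ℝ => supModulus T s 1 f) (𝓝[>] 0) (𝓝 0) := by
  rw [ENNReal.tendsto_nhds_zero]
  intro ε hε
  have hi : ∀ i, ∀ᶠ s : ℝ in 𝓝[>] 0, ∀ τ ∈ Icc 0 s, ‖(T i).op τ f - f‖ₑ ≤ ε := by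
    intro i
    have h1 : Tendsto (fun t => ‖(T i).op t f - f‖ₑ) (𝓝[≥] 0) (𝓝 0) := by
      have h2 := (T i).continuousOn_orbit f 0 (mem_Ici.2 le_rfl)
      have h3 := (h2.tendsto.sub_const f).enorm
      simpa [(T i).op_zero] using h3
    have h4 := (ENNReal.tendsto_nhds_zero.1 h1) ε hε
    obtain ⟨u, hu, hsub⟩ := mem_nhdsGE_iff_exists_Ico_subset.1 h4
    filter_upwards [Ioo_mem_nhdsGT hu] with s hs τ hτ
    exact hsub ⟨hτ.1, hτ.2.trans_lt hs.2⟩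
  filter_upwards [Filter.eventually_all.2 hi] with s hs
  exact supModulus_succ_le T fun i τ hτ => hs i τ hτ

variable [CompleteSpace E]

theorem supModulus_le_kFunctional (r : ℕ) {s : ℝ} (hs : 0 ≤ s) (f : E) :
    supModulus T s r f ≤
      3 ^ r * kFunctional (fun g : E => ‖g‖ₑ) (sobolevNorm T r) (s ^ r) f := by
  have h := le_mul_kFunctional_add (N₀ := fun g : E => ‖g‖ₑ) (N₁ := sobolevNorm T r)
    (t := s ^ r) (f := f) (B := supModulus T s r f) (B' := 0) (c := 3 ^ r)
    (by simp) (by simp) fun f₀ f₁ hf _ h₁ => by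
      rw [add_zero, ← hf]
      refine (supModulus_add_le T s r _ _).trans ?_
      rw [mul_add]
      refine add_le_add ((supModulus_le_enorm T s r f₀).trans ?_) ?_
      · gcongr
        norm_num
      · refine (supModulus_le_sobolevNorm T hs r (mem_of_sobolevNorm_ne_top T h₁)).trans ?_
        rw [mul_pow, ENNReal.ofReal_mul (by positivity), mul_assoc,
          ENNReal.ofReal_pow (by norm_num : (0 : ℝ) ≤ 3), ENNReal.ofReal_ofNat]
  simpa using h

/-- The weighted moduli of the orders strictly between `0` and `r` are absorbed by the K-functional
at small scales, at the cost of a multiple of the norm. -/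
theorem exists_absorption {r l : ℕ} (hl : l < r) {δ : ℝ} (hδ : 0 < δ) :
    ∃ C : NNReal, ∀ᶠ s : ℝ in 𝓝[>] 0, ∀ f : E,
      ENNReal.ofReal (s ^ (r - l)) * supModulus T s l f ≤
        ENNReal.ofReal δ * kFunctional (fun g : E => ‖g‖ₑ) (sobolevNorm T r) (s ^ r) f +
          C * (ENNReal.ofReal (s ^ r) * ‖f‖ₑ) := by
  obtain ⟨C, hC, hint⟩ := sobolevNorm_interp T r l hl.le
  have hC0 : 0 < C := by linarith
  -- the parameter of the interpolation inequality
  set ε : ℝ := min 1 (δ / (3 ^ l * C)) with hε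
  have hε0 : 0 < ε := by positivity
  have hε1 : ε ≤ 1 := min_le_left _ _
  set M : ℝ := 3 ^ l * C * ε⁻¹ ^ l with hM
  have hM0 : 0 < M := by positivity
  have hsmall : ∀ᶠ s : ℝ in 𝓝[>] 0, s ≤ min 1 (δ / (2 ^ l + M)) := by
    have : (0 : ℝ) < min 1 (δ / (2 ^ l + M)) := by positivity
    exact (eventually_le_nhds this).filter_mono nhdsWithin_le_nhds
  refine ⟨M.toNNReal, ?_⟩
  filter_upwards [hsmall, self_mem_nhdsWithin] with s hs1 (hs0 : 0 < s) f
  have hs1' : s ≤ 1 := hs1.trans (min_le_left _ _)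
  refine le_mul_kFunctional_add (by simpa using hδ) ENNReal.ofReal_ne_top
    fun a b hf _ hb => ?_
  have hbm : sobolevNorm T l b ≠ ⊤ := ne_top_of_le_ne_top hb (sobolevNorm_mono T hl.le b)
  have h1 : supModulus T s l f ≤ ENNReal.ofReal (2 ^ l) * ‖a‖ₑ +
      ENNReal.ofReal ((3 * s) ^ l) * (ENNReal.ofReal C * (ENNReal.ofReal (ε⁻¹ ^ l) * ‖b‖ₑ +
        ENNReal.ofReal (ε ^ (r - l)) * sobolevNorm T r b)) := by
    rw [← hf]
    refine (supModulus_add_le T s l a b).trans (add_le_add ?_ ?_)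
    · rw [ENNReal.ofReal_pow zero_le_two, ENNReal.ofReal_ofNat]
      exact supModulus_le_enorm T s l a
    · exact (supModulus_le_sobolevNorm T hs0.le l (mem_of_sobolevNorm_ne_top T hbm)).trans
        (mul_le_mul_right (hint ε hε0 hε1 b) _)
  have hbf : ‖b‖ₑ ≤ ‖f‖ₑ + ‖a‖ₑ := by
    rw [show b = f - a by rw [← hf]; abel]; exact enorm_sub_le
  have hlr : r - l + l = r := Nat.sub_add_cancel hl.le
  have hc : (M.toNNReal : ℝ≥0∞) = ENNReal.ofReal M := rfl
  -- the remaining estimates are inequalities between real coefficients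
  have e1 : s ^ (r - l) * (2 ^ l + (3 * s) ^ l * C * ε⁻¹ ^ l) ≤ δ := by
    have h2 : s ^ (r - l) ≤ s := by
      simpa using pow_le_pow_of_le_one hs0.le hs1' (show 1 ≤ r - l by omega)
    have h3 : (3 * s) ^ l * C * ε⁻¹ ^ l ≤ M := by
      rw [hM, mul_pow]
      have : s ^ l ≤ 1 := pow_le_one₀ hs0.le hs1'
      have : (3 : ℝ) ^ l * s ^ l ≤ 3 ^ l := mul_le_of_le_one_right (by positivity) this
      gcongr
    have h4 : s * (2 ^ l + M) ≤ δ := by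
      have := hs1.trans (min_le_right _ _)
      rwa [le_div_iff₀ (by positivity)] at this
    calc _ ≤ s * (2 ^ l + M) := by gcongr
      _ ≤ δ := h4
  have e2 : s ^ (r - l) * ((3 * s) ^ l * C * ε ^ (r - l)) ≤ δ * s ^ r := by
    have h2 : ε ^ (r - l) ≤ ε := by
      simpa using pow_le_pow_of_le_one hε0.le hε1 (show 1 ≤ r - l by omega)
    have h3 : 3 ^ l * C * ε ≤ δ := by
      have := min_le_right 1 (δ / (3 ^ l * C))
      rw [← hε, le_div_iff₀ (by positivity)] at this
      linarith
    calc _ = s ^ (r - l + l) * (3 ^ l * C * ε ^ (r - l)) := by rw [mul_pow, pow_add]; ring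
      _ ≤ s ^ r * (3 ^ l * C * ε) := by rw [hlr]; gcongr
      _ ≤ s ^ r * δ := by gcongr
      _ = _ := mul_comm _ _
  have e3 : s ^ (r - l) * ((3 * s) ^ l * C * ε⁻¹ ^ l) = M * s ^ r := by
    rw [mul_pow, hM, ← hlr, pow_add, hlr]; ring
  have e3' : ENNReal.ofReal (s ^ (r - l)) * (ENNReal.ofReal ((3 * s) ^ l) *
      (ENNReal.ofReal C * ENNReal.ofReal (ε⁻¹ ^ l))) = ENNReal.ofReal M * ENNReal.ofReal (s ^ r) := by
    rw [← ENNReal.ofReal_mul (by positivity), ← ENNReal.ofReal_mul (by positivity),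
      ← ENNReal.ofReal_mul (by positivity), ← ENNReal.ofReal_mul (by positivity), ← e3]
    congr 1; ring
  have e2' : ENNReal.ofReal (s ^ (r - l)) * (ENNReal.ofReal ((3 * s) ^ l) *
      (ENNReal.ofReal C * ENNReal.ofReal (ε ^ (r - l)))) ≤
      ENNReal.ofReal δ * ENNReal.ofReal (s ^ r) := by
    rw [← ENNReal.ofReal_mul (by positivity), ← ENNReal.ofReal_mul (by positivity),
      ← ENNReal.ofReal_mul (by positivity), ← ENNReal.ofReal_mul (by positivity)]
    refine ENNReal.ofReal_le_ofReal (le_trans (le_of_eq ?_) e2); ring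
  have e1' : ENNReal.ofReal (s ^ (r - l)) * (ENNReal.ofReal (2 ^ l) + ENNReal.ofReal ((3 * s) ^ l) *
      (ENNReal.ofReal C * ENNReal.ofReal (ε⁻¹ ^ l))) ≤ ENNReal.ofReal δ := by
    rw [← ENNReal.ofReal_mul (by positivity), ← ENNReal.ofReal_mul (by positivity),
      ← ENNReal.ofReal_add (by positivity) (by positivity), ← ENNReal.ofReal_mul (by positivity)]
    refine ENNReal.ofReal_le_ofReal (le_trans (le_of_eq ?_) e1); ring
  calc _ ≤ ENNReal.ofReal (s ^ (r - l)) * (ENNReal.ofReal (2 ^ l) * ‖a‖ₑ +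
        ENNReal.ofReal ((3 * s) ^ l) * (ENNReal.ofReal C *
          (ENNReal.ofReal (ε⁻¹ ^ l) * (‖f‖ₑ + ‖a‖ₑ) +
            ENNReal.ofReal (ε ^ (r - l)) * sobolevNorm T r b))) := by
        gcongr
        refine h1.trans ?_
        gcongr
    _ = ENNReal.ofReal (s ^ (r - l)) * (ENNReal.ofReal (2 ^ l) + ENNReal.ofReal ((3 * s) ^ l) *
          (ENNReal.ofReal C * ENNReal.ofReal (ε⁻¹ ^ l))) * ‖a‖ₑ +
        ENNReal.ofReal (s ^ (r - l)) * (ENNReal.ofReal ((3 * s) ^ l) *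
          (ENNReal.ofReal C * ENNReal.ofReal (ε ^ (r - l)))) * sobolevNorm T r b +
        ENNReal.ofReal (s ^ (r - l)) * (ENNReal.ofReal ((3 * s) ^ l) *
          (ENNReal.ofReal C * ENNReal.ofReal (ε⁻¹ ^ l))) * ‖f‖ₑ := by ring
    _ ≤ ENNReal.ofReal δ * ‖a‖ₑ + ENNReal.ofReal δ * ENNReal.ofReal (s ^ r) * sobolevNorm T r b +
        ENNReal.ofReal M * ENNReal.ofReal (s ^ r) * ‖f‖ₑ := by
        rw [e3']; gcongr
    _ = _ := by rw [hc]; ring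

variable {T}

/-- The upper bound of the K-functional by the modulus of continuity, at small scales. -/
theorem exists_kFunctional_le_of_small (hT : SemigroupAssumption T) {r : ℕ} (hr : 1 ≤ r) :
    ∃ (C : NNReal) (s₀ : ℝ), 0 < s₀ ∧ s₀ ≤ 1 ∧ ∀ s : ℝ, 0 < s → s ≤ s₀ → ∀ f : E,
      kFunctional (fun g : E => ‖g‖ₑ) (sobolevNorm T r) (s ^ r) f ≤
        C * (supModulus T s r f + ENNReal.ofReal (s ^ r) * ‖f‖ₑ) := by
  obtain ⟨C, s₁, hs₁, hs₁1, hdec⟩ := exists_decomposition hT r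
  -- the constant is chosen so that the sum of the lower order terms is at most half of the
  -- K-functional
  have hr0 : (0 : ℝ) < r := by exact_mod_cast hr
  obtain ⟨δ, hδ0, h2⟩ : ∃ δ : ℝ, 0 < δ ∧ 2 * (C : ℝ) * (r * δ) ≤ 2⁻¹ := by
    refine ⟨1 / (4 * (C + 1) * r), by positivity, ?_⟩
    have hC0 : (0 : ℝ) ≤ (C : ℝ) := C.2
    generalize (C : ℝ) = c at hC0 ⊢
    field_simp
    linarith
  have habs : ∀ l : ℕ, ∃ C' : NNReal, l < r → ∀ᶠ s : ℝ in 𝓝[>] 0, ∀ f : E,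
      ENNReal.ofReal (s ^ (r - l)) * supModulus T s l f ≤
        ENNReal.ofReal δ * kFunctional (fun g : E => ‖g‖ₑ) (sobolevNorm T r) (s ^ r) f +
          C' * (ENNReal.ofReal (s ^ r) * ‖f‖ₑ) := by
    intro l
    by_cases hl : l < r
    · obtain ⟨C', h⟩ := exists_absorption T hl hδ0
      exact ⟨C', fun _ => h⟩
    · exact ⟨0, fun h => absurd h hl⟩
  choose C' hC' using habs
  have hall : ∀ᶠ s : ℝ in 𝓝[>] 0, ∀ l ∈ Finset.range r, ∀ f : E,
      ENNReal.ofReal (s ^ (r - l)) * supModulus T s l f ≤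
        ENNReal.ofReal δ * kFunctional (fun g : E => ‖g‖ₑ) (sobolevNorm T r) (s ^ r) f +
          C' l * (ENNReal.ofReal (s ^ r) * ‖f‖ₑ) :=
    (Filter.eventually_all_finset _).2 fun l hl => hC' l (Finset.mem_range.1 hl)
  obtain ⟨s₂, hs₂, hsub⟩ := mem_nhdsGT_iff_exists_Ioc_subset.1 hall
  refine ⟨2 * (2 * C * (1 + ∑ l ∈ Finset.range r, C' l)), min s₁ s₂, lt_min hs₁ hs₂,
    (min_le_left _ _).trans hs₁1, fun s hs hss f => ?_⟩
  set K := kFunctional (fun g : E => ‖g‖ₑ) (sobolevNorm T r) (s ^ r) f with hK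
  have hKt : K ≠ ⊤ := ne_top_of_le_ne_top enorm_ne_top (kFunctional_le_enorm T r _ f)
  obtain ⟨f₀, f₁, hf, h0, h1⟩ := hdec s hs (hss.trans (min_le_left _ _)) f
  have hlow := hsub ⟨hs, hss.trans (min_le_right _ _)⟩
  set X := supModulus T s r f with hX
  set Y := ENNReal.ofReal (s ^ r) * ‖f‖ₑ with hY
  have hw : weightedModulus T r s f ≤
      X + ∑ l ∈ Finset.range r, (ENNReal.ofReal δ * K + C' l * Y) := by
    rw [weightedModulus, Finset.sum_range_succ, add_comm]
    refine add_le_add (by simp [hX]) (Finset.sum_le_sum fun l hl => hlow l hl f)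
  have hKle : K ≤ 2 * C * (X + ∑ l ∈ Finset.range r, (ENNReal.ofReal δ * K + C' l * Y)) := by
    refine (kFunctional_le hf (Or.inl (by positivity))).trans ((add_le_add h0 h1).trans ?_)
    rw [two_mul, add_mul]
    gcongr
    exact le_self_add
  have hcoef : 2 * (C : ℝ≥0∞) * (r * ENNReal.ofReal δ) ≤ 2⁻¹ := by
    have h3 := ENNReal.ofReal_le_ofReal h2
    rwa [ENNReal.ofReal_mul (by positivity), ENNReal.ofReal_mul (by positivity),
      ENNReal.ofReal_mul (by positivity), ENNReal.ofReal_inv_of_pos (by norm_num),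
      ENNReal.ofReal_ofNat, ENNReal.ofReal_coe_nnreal, ENNReal.ofReal_natCast] at h3
  rw [Finset.sum_add_distrib, Finset.sum_const, Finset.card_range, nsmul_eq_mul,
    ← Finset.sum_mul] at hKle
  have hfin : K ≤ 2⁻¹ * K + 2 * C * (X + (∑ l ∈ Finset.range r, (C' l : ℝ≥0∞)) * Y) := by
    refine hKle.trans ?_
    calc _ = 2 * (C : ℝ≥0∞) * (r * ENNReal.ofReal δ) * K +
          2 * C * (X + (∑ l ∈ Finset.range r, (C' l : ℝ≥0∞)) * Y) := by ring
      _ ≤ _ := by gcongr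
  have hhalf : 2⁻¹ * K ≤ 2 * C * (X + (∑ l ∈ Finset.range r, (C' l : ℝ≥0∞)) * Y) := by
    have h2 : 2⁻¹ * K + 2⁻¹ * K = K := by rw [← add_mul, ENNReal.inv_two_add_inv_two, one_mul]
    rw [← h2] at hfin
    have hne : 2⁻¹ * K ≠ ⊤ := ENNReal.mul_ne_top (by simp) hKt
    rw [h2] at hfin
    nth_rewrite 1 [← h2] at hfin
    exact (ENNReal.add_le_add_iff_left hne).1 hfin
  calc K = 2 * (2⁻¹ * K) := by
        rw [← mul_assoc, ENNReal.mul_inv_cancel two_ne_zero ENNReal.ofNat_ne_top, one_mul]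
    _ ≤ 2 * (2 * C * (X + (∑ l ∈ Finset.range r, (C' l : ℝ≥0∞)) * Y)) := by gcongr
    _ ≤ 2 * (2 * C * ((1 + ∑ l ∈ Finset.range r, (C' l : ℝ≥0∞)) * (X + Y))) := by
        gcongr
        rw [mul_add]
        refine add_le_add (le_mul_of_one_le_left' le_self_add) ?_
        gcongr
        exact le_add_self
    _ = _ := by push_cast; ring

/-- The modulus of continuity and the K-functional, for all scales. -/
theorem exists_kFunctional_equiv (hT : SemigroupAssumption T) {r : ℕ} (hr : 1 ≤ r) :
    ∃ C : NNReal, ∀ (f : E) (s : ℝ), 0 ≤ s →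
      mixedModulus T r s f ≤
        C * kFunctional (fun g : E => ‖g‖ₑ) (sobolevNorm T r) (s ^ r) f ∧
      kFunctional (fun g : E => ‖g‖ₑ) (sobolevNorm T r) (s ^ r) f ≤
        C * (mixedModulus T r s f + ENNReal.ofReal (min (s ^ r) 1) * ‖f‖ₑ) := by
  obtain ⟨C, s₀, hs₀, hs₀1, hsmall⟩ := exists_kFunctional_le_of_small hT hr
  refine ⟨(d : NNReal) ^ r * 3 ^ r + C + ((s₀ ^ r)⁻¹).toNNReal, fun f s hs => ⟨?_, ?_⟩⟩
  · calc _ ≤ (d : ℝ≥0∞) ^ r * (3 ^ r *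
          kFunctional (fun g : E => ‖g‖ₑ) (sobolevNorm T r) (s ^ r) f) :=
          (mixedModulus_le T s r f).trans (mul_le_mul_right (supModulus_le_kFunctional T r hs f) _)
      _ ≤ _ := by
          rw [← mul_assoc]
          push_cast
          gcongr
          rw [add_assoc]
          exact le_self_add
  · have key : ∀ s : ℝ, 0 < s → s ≤ s₀ →
        kFunctional (fun g : E => ‖g‖ₑ) (sobolevNorm T r) (s ^ r) f ≤
          C * (supModulus T s r f + ENNReal.ofReal (s ^ r) * ‖f‖ₑ) := fun s h1 h2 =>
      hsmall s h1 h2 f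
    rcases hs.eq_or_lt with rfl | hs'
    · -- at `s = 0` the right-hand side vanishes, and `E^r` is dense
      have h1 : Tendsto (fun s : ℝ => C * (2 ^ (r - 1) * supModulus T s 1 f +
          ENNReal.ofReal (s ^ r) * ‖f‖ₑ)) (𝓝[>] 0) (𝓝 (C * (2 ^ (r - 1) * 0 + 0 * ‖f‖ₑ))) := by
        refine ENNReal.Tendsto.const_mul (Tendsto.add (ENNReal.Tendsto.const_mul
          (tendsto_supModulus_one T f) (Or.inr (by simp))) (ENNReal.Tendsto.mul_const ?_
          (Or.inr enorm_ne_top))) (Or.inr ENNReal.coe_ne_top)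
        have h2 : Tendsto (fun s : ℝ => ENNReal.ofReal (s ^ r)) (𝓝 0)
            (𝓝 (ENNReal.ofReal (0 ^ r))) :=
          ENNReal.tendsto_ofReal ((continuous_pow r).tendsto 0)
        rw [zero_pow (by omega), ENNReal.ofReal_zero] at h2
        exact h2.mono_left nhdsWithin_le_nhds
      have h0 : kFunctional (fun g : E => ‖g‖ₑ) (sobolevNorm T r) (0 ^ r) f ≤
          C * (2 ^ (r - 1) * 0 + 0 * ‖f‖ₑ) := by
        refine ge_of_tendsto h1 ?_
        filter_upwards [Ioc_mem_nhdsGT hs₀] with s hs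
        refine (kFunctional_mono _ _ (by gcongr; exact hs.1.le) f).trans
          ((key s hs.1 hs.2).trans ?_)
        gcongr
        have := supModulus_add_right_le T s 1 (r - 1) f
        rwa [show 1 + (r - 1) = r by omega] at this
      simp only [mul_zero, zero_mul, add_zero] at h0
      exact h0.trans zero_le
    · rcases le_total s s₀ with h | h
      · refine (key s hs' h).trans ?_
        have hs1 : min (s ^ r) 1 = s ^ r := min_eq_left (pow_le_one₀ hs (h.trans hs₀1))
        rw [hs1]
        have hle := supModulus_le_mixedModulus T s r f
        push_cast
        gcongr
        refine le_trans ?_ le_self_add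
        exact le_add_self
      · refine (kFunctional_le_enorm T r _ f).trans ?_
        have h1 : s₀ ^ r ≤ min (s ^ r) 1 :=
          le_min (by gcongr) (pow_le_one₀ hs₀.le hs₀1)
        have h2 : (1 : ℝ≥0∞) ≤ ENNReal.ofReal (s₀ ^ r)⁻¹ * ENNReal.ofReal (min (s ^ r) 1) := by
          rw [← ENNReal.ofReal_mul (by positivity), ← ENNReal.ofReal_one]
          refine ENNReal.ofReal_le_ofReal ?_
          rw [inv_mul_eq_div, le_div_iff₀ (by positivity), one_mul]
          exact h1
        calc ‖f‖ₑ ≤ (ENNReal.ofReal (s₀ ^ r)⁻¹ * ENNReal.ofReal (min (s ^ r) 1)) * ‖f‖ₑ :=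
              le_mul_of_one_le_left' h2
          _ = ENNReal.ofReal (s₀ ^ r)⁻¹ * (ENNReal.ofReal (min (s ^ r) 1) * ‖f‖ₑ) := by ring
          _ ≤ _ := by
              push_cast
              gcongr
              · exact le_add_self
              · exact le_add_self

end KFunctional

/-! ### The weighted Lebesgue norms -/

section HaarNorm

/-- The measure `ds/s` on `(0, ∞)`. -/
noncomputable def haarMeasure : Measure ℝ :=
  (volume.restrict (Ioi (0 : ℝ))).withDensity fun s => (ENNReal.ofReal s)⁻¹

theorem lintegral_haarMeasure (F : ℝ → ℝ≥0∞) :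
    ∫⁻ s, F s ∂haarMeasure = ∫⁻ s in Ioi (0 : ℝ), F s / ENNReal.ofReal s := by
  rw [haarMeasure, lintegral_withDensity_eq_lintegral_mul_non_measurable _
    (f := fun s => (ENNReal.ofReal s)⁻¹) (ENNReal.measurable_ofReal.inv)]
  · refine setLIntegral_congr_fun measurableSet_Ioi fun s _ => ?_
    rw [Pi.mul_apply, mul_comm, div_eq_mul_inv]
  · refine (ae_restrict_iff' measurableSet_Ioi).2 (ae_of_all _ fun s (hs : 0 < s) => ?_)
    simpa [ENNReal.inv_lt_top] using hs

theorem haarNorm_of_ne_top {q : ℝ≥0∞} (hq : q ≠ ⊤) (φ : ℝ → ℝ≥0∞) :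
    haarNorm q φ = (∫⁻ s, φ s ^ q.toReal ∂haarMeasure) ^ (1 / q.toReal) := by
  rw [haarNorm, if_neg hq, lintegral_haarMeasure]

theorem haarNorm_top (φ : ℝ → ℝ≥0∞) : haarNorm ⊤ φ = ⨆ (s : ℝ) (_ : 0 < s), φ s := by
  rw [haarNorm, if_pos rfl]

variable {q : ℝ≥0∞}

theorem haarNorm_mono {φ ψ : ℝ → ℝ≥0∞} (h : ∀ s : ℝ, 0 < s → φ s ≤ ψ s) :
    haarNorm q φ ≤ haarNorm q ψ := by
  by_cases hq : q = ⊤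
  · subst hq
    rw [haarNorm_top, haarNorm_top]
    exact iSup₂_mono h
  · rw [haarNorm, haarNorm, if_neg hq, if_neg hq]
    refine ENNReal.rpow_le_rpow (setLIntegral_mono' measurableSet_Ioi fun s hs => ?_) (by positivity)
    gcongr
    exact h s hs

theorem haarNorm_congr {φ ψ : ℝ → ℝ≥0∞} (h : ∀ s : ℝ, 0 < s → φ s = ψ s) :
    haarNorm q φ = haarNorm q ψ :=
  le_antisymm (haarNorm_mono fun s hs => (h s hs).le) (haarNorm_mono fun s hs => (h s hs).ge)

theorem one_le_toReal (hq : 1 ≤ q) (hq' : q ≠ ⊤) : 1 ≤ q.toReal := by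
  simpa using ENNReal.toReal_mono hq' hq

theorem haarNorm_const_mul (hq : 1 ≤ q) (c : ℝ≥0∞) {φ : ℝ → ℝ≥0∞} (hφ : Measurable φ) :
    haarNorm q (fun s => c * φ s) = c * haarNorm q φ := by
  by_cases hq' : q = ⊤
  · subst hq'
    simp only [haarNorm_top, ENNReal.mul_iSup]
  · have h1 := one_le_toReal hq hq'
    rw [haarNorm_of_ne_top hq', haarNorm_of_ne_top hq']
    simp only [ENNReal.mul_rpow_of_nonneg _ _ (zero_le_one.trans h1)]
    rw [lintegral_const_mul _ (hφ.pow_const _), ENNReal.mul_rpow_of_nonneg _ _ (by positivity),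
      ← ENNReal.rpow_mul, mul_one_div_cancel (by positivity), ENNReal.rpow_one]

theorem haarNorm_add_le (hq : 1 ≤ q) {φ ψ : ℝ → ℝ≥0∞} (hφ : Measurable φ) (hψ : Measurable ψ) :
    haarNorm q (fun s => φ s + ψ s) ≤ haarNorm q φ + haarNorm q ψ := by
  by_cases hq' : q = ⊤
  · subst hq'
    simp only [haarNorm_top]
    refine iSup₂_le fun s hs => add_le_add ?_ ?_
    · exact le_iSup₂_of_le s hs le_rfl
    · exact le_iSup₂_of_le s hs le_rfl
  · rw [haarNorm_of_ne_top hq', haarNorm_of_ne_top hq', haarNorm_of_ne_top hq']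
    exact ENNReal.lintegral_Lp_add_le hφ.aemeasurable hψ.aemeasurable (one_le_toReal hq hq')

theorem haarNorm_zero (hq : 1 ≤ q) : haarNorm q (fun _ => 0) = 0 := by
  simpa using haarNorm_const_mul hq 0 (φ := fun _ => 0) measurable_const

theorem haarNorm_sum_le (hq : 1 ≤ q) {ι : Type*} (u : Finset ι) {φ : ι → ℝ → ℝ≥0∞}
    (hφ : ∀ i, Measurable (φ i)) :
    haarNorm q (fun s => ∑ i ∈ u, φ i s) ≤ ∑ i ∈ u, haarNorm q (φ i) := by
  classical
  induction u using Finset.induction_on with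
  | empty => simp [haarNorm_zero hq]
  | insert i u hi ih =>
    simp only [Finset.sum_insert hi]
    exact (haarNorm_add_le hq (hφ i) (Finset.measurable_sum _ fun i _ => hφ i)).trans
      (add_le_add le_rfl ih)

/-- Minkowski's inequality for series. -/
theorem haarNorm_tsum_le (hq : 1 ≤ q) {φ : ℕ → ℝ → ℝ≥0∞} (hφ : ∀ n, Measurable (φ n)) :
    haarNorm q (fun s => ∑' n, φ n s) ≤ ∑' n, haarNorm q (φ n) := by
  by_cases hq' : q = ⊤
  · subst hq'
    simp only [haarNorm_top]
    exact iSup₂_le fun s hs => ENNReal.tsum_le_tsum fun n => le_iSup₂_of_le s hs le_rfl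
  · have h1 := one_le_toReal hq hq'
    have hlim : Tendsto (fun N : ℕ => haarNorm q fun s => ∑ n ∈ Finset.range N, φ n s) atTop
        (𝓝 (haarNorm q fun s => ∑' n, φ n s)) := by
      simp only [haarNorm_of_ne_top hq']
      refine (ENNReal.continuous_rpow_const.tendsto _).comp ?_
      refine lintegral_tendsto_of_tendsto_of_monotone (fun N =>
        ((Finset.measurable_sum _ fun n _ => hφ n).pow_const _).aemeasurable)
        (ae_of_all _ fun s N M hNM => ?_) (ae_of_all _ fun s => ?_)
      · dsimp only
        gcongr
      · exact (ENNReal.continuous_rpow_const.tendsto _).comp ENNReal.summable.tendsto_sum_tsum_nat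
    exact le_of_tendsto hlim (Eventually.of_forall fun N =>
      (haarNorm_sum_le hq _ hφ).trans (ENNReal.sum_le_tsum _))

/-- The substitution `u = λ s^p` in the measure `du/u`. -/
theorem lintegral_haarMeasure_comp {l : ℝ} (hl : 0 < l) {p : ℕ} (hp : p ≠ 0) (F : ℝ → ℝ≥0∞) :
    ∫⁻ u, F u ∂haarMeasure = p * ∫⁻ s, F (l * s ^ p) ∂haarMeasure := by
  have himg : (fun s : ℝ => l * s ^ p) '' Ioi 0 = Ioi 0 := by
    ext u
    constructor
    · rintro ⟨s, hs, rfl⟩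
      have : (0 : ℝ) < s := hs
      exact mem_Ioi.2 (by positivity)
    · intro hu
      have hu0 : (0 : ℝ) < u := hu
      refine ⟨(u / l) ^ ((p : ℝ)⁻¹), mem_Ioi.2 (by positivity), ?_⟩
      dsimp only
      rw [Real.rpow_inv_natCast_pow (by positivity) hp]
      field_simp
  have hinj : InjOn (fun s : ℝ => l * s ^ p) (Ioi 0) := by
    intro a ha b hb hab
    exact (pow_left_inj₀ (mem_Ioi.1 ha).le (mem_Ioi.1 hb).le hp).1 (mul_left_cancel₀ hl.ne' hab)
  have hder : ∀ s ∈ Ioi (0 : ℝ), HasDerivWithinAt (fun s : ℝ => l * s ^ p)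
      (l * (p * s ^ (p - 1))) (Ioi 0) s := fun s _ =>
    ((hasDerivAt_pow p s).const_mul l).hasDerivWithinAt
  rw [lintegral_haarMeasure, lintegral_haarMeasure]
  nth_rewrite 1 [← himg]
  rw [lintegral_image_eq_lintegral_abs_deriv_mul measurableSet_Ioi hder hinj,
    ← lintegral_const_mul' _ _ (ENNReal.natCast_ne_top p)]
  refine setLIntegral_congr_fun measurableSet_Ioi fun s (hs : 0 < s) => ?_
  have hpos : (0 : ℝ) < p := by exact_mod_cast Nat.pos_of_ne_zero hp
  have key : ENNReal.ofReal |l * (p * s ^ (p - 1))| / ENNReal.ofReal (l * s ^ p) =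
      p / ENNReal.ofReal s := by
    rw [abs_of_pos (by positivity), ← ENNReal.ofReal_div_of_pos (by positivity),
      ← ENNReal.ofReal_natCast p, ← ENNReal.ofReal_div_of_pos hs]
    congr 1
    obtain ⟨m, rfl⟩ := Nat.exists_eq_succ_of_ne_zero hp
    rw [Nat.succ_sub_one, pow_succ]
    field_simp
  calc _ = ENNReal.ofReal |l * (p * s ^ (p - 1))| / ENNReal.ofReal (l * s ^ p) * F (l * s ^ p) := by
        simp only [div_eq_mul_inv]; ring
    _ = _ := by rw [key]; simp only [div_eq_mul_inv]; ring

theorem haarNorm_comp_top {l : ℝ} (hl : 0 < l) {p : ℕ} (hp : p ≠ 0) (φ : ℝ → ℝ≥0∞) :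
    haarNorm ⊤ (fun s => φ (l * s ^ p)) = haarNorm ⊤ φ := by
  rw [haarNorm_top, haarNorm_top]
  refine le_antisymm (iSup₂_le fun s hs => le_iSup₂_of_le (l * s ^ p) (by positivity) le_rfl)
    (iSup₂_le fun u hu => le_iSup₂_of_le ((u / l) ^ ((p : ℝ)⁻¹)) (by positivity) (le_of_eq ?_))
  rw [Real.rpow_inv_natCast_pow (by positivity) hp]
  congr 1
  field_simp

theorem haarNorm_comp_mul (l : ℝ) (hl : 0 < l) (φ : ℝ → ℝ≥0∞) :
    haarNorm q (fun s => φ (l * s)) = haarNorm q φ := by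
  by_cases hq' : q = ⊤
  · subst hq'
    simpa using haarNorm_comp_top hl one_ne_zero φ
  · rw [haarNorm_of_ne_top hq', haarNorm_of_ne_top hq',
      lintegral_haarMeasure_comp hl one_ne_zero fun u => φ u ^ q.toReal]
    simp

theorem haarNorm_comp_pow_le (hq : 1 ≤ q) {p : ℕ} (hp : p ≠ 0) (φ : ℝ → ℝ≥0∞) :
    haarNorm q (fun s => φ (s ^ p)) ≤ haarNorm q φ := by
  by_cases hq' : q = ⊤
  · subst hq'
    simpa using (haarNorm_comp_top one_pos hp φ).le
  · rw [haarNorm_of_ne_top hq', haarNorm_of_ne_top hq',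
      lintegral_haarMeasure_comp one_pos hp fun u => φ u ^ q.toReal]
    simp only [one_mul]
    refine ENNReal.rpow_le_rpow (le_mul_of_one_le_left' ?_) (by positivity)
    exact_mod_cast Nat.one_le_iff_ne_zero.2 hp

theorem haarNorm_le_comp_pow (hq : 1 ≤ q) {p : ℕ} (hp : p ≠ 0) (φ : ℝ → ℝ≥0∞) :
    haarNorm q φ ≤ p * haarNorm q (fun s => φ (s ^ p)) := by
  have hp1 : (1 : ℝ≥0∞) ≤ p := by exact_mod_cast Nat.one_le_iff_ne_zero.2 hp
  by_cases hq' : q = ⊤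
  · subst hq'
    have h := (haarNorm_comp_top one_pos hp φ).ge
    simp only [one_mul] at h
    exact h.trans (le_mul_of_one_le_left' hp1)
  · have h1 := one_le_toReal hq hq'
    rw [haarNorm_of_ne_top hq', haarNorm_of_ne_top hq',
      lintegral_haarMeasure_comp one_pos hp fun u => φ u ^ q.toReal,
      ENNReal.mul_rpow_of_nonneg _ _ (by positivity)]
    simp only [one_mul]
    gcongr
    refine (ENNReal.rpow_le_rpow_of_exponent_le hp1 ?_).trans_eq (ENNReal.rpow_one _)
    rw [div_le_one (by positivity)]
    exact h1

theorem haarNorm_ne_zero {φ : ℝ → ℝ≥0∞} (hφ : Measurable φ) (h : ∀ s : ℝ, 0 < s → φ s ≠ 0) :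
    haarNorm q φ ≠ 0 := by
  by_cases hq' : q = ⊤
  · subst hq'
    rw [haarNorm_top]
    intro h0
    have := (le_iSup₂_of_le (f := fun (s : ℝ) (_ : 0 < s) => φ s) 1 one_pos le_rfl).trans_eq h0
    exact h 1 one_pos (le_antisymm this zero_le)
  · rw [haarNorm, if_neg hq']
    intro h0
    have h1 : ∫⁻ s in Ioi (0 : ℝ), φ s ^ q.toReal / ENNReal.ofReal s = 0 := by
      by_contra hne
      rcases ENNReal.rpow_eq_zero_iff.1 h0 with ⟨h2, _⟩ | ⟨_, h2⟩
      · exact hne h2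
      · exact absurd h2 (not_lt.2 (by positivity))
    have hm : Measurable fun s => φ s ^ q.toReal / ENNReal.ofReal s :=
      (hφ.pow_const _).div ENNReal.measurable_ofReal
    rw [lintegral_eq_zero_iff hm,
      Filter.EventuallyEq, ae_restrict_iff' measurableSet_Ioi] at h1
    have h2 : (volume : Measure ℝ) (Ioi 0) = 0 := by
      refine measure_mono_null (fun s (hs : 0 < s) => ?_) h1
      intro hs'
      have := hs' hs
      simp only [Pi.zero_apply, ENNReal.div_eq_zero_iff, ENNReal.ofReal_ne_top, or_false] at this
      rcases ENNReal.rpow_eq_zero_iff.1 this with ⟨h2, _⟩ | ⟨_, h2⟩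
      · exact h s hs h2
      · exact absurd h2 (not_lt.2 (by positivity))
    simp at h2

theorem measurable_ofReal_rpow_mul (β : ℝ) {φ : ℝ → ℝ≥0∞} (hφ : Measurable φ) :
    Measurable fun s : ℝ => ENNReal.ofReal (s ^ β) * φ s :=
  (ENNReal.measurable_ofReal.comp (measurable_id.pow_const β)).mul hφ

/-- The weight `min(s^r, 1)` belongs to the space with the power weight `s^{-α}`. -/
theorem haarNorm_rpow_mul_min_ne_top (hq : 1 ≤ q) {r : ℕ} {α : ℝ} (hα : 0 < α) (hαr : α < r) :
    haarNorm q (fun s => ENNReal.ofReal (s ^ (-α)) * ENNReal.ofReal (min (s ^ r) 1)) ≠ ⊤ := by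
  have hle0 : ∀ s : ℝ, 0 < s → s ≤ 1 → ENNReal.ofReal (s ^ (-α)) * ENNReal.ofReal (min (s ^ r) 1) ≤
      ENNReal.ofReal (s ^ (r - α)) := by
    intro s hs hs1
    rw [← ENNReal.ofReal_mul (by positivity), sub_eq_neg_add, Real.rpow_add hs, Real.rpow_natCast]
    exact ENNReal.ofReal_le_ofReal (by gcongr; exact min_le_left _ _)
  have hle1 : ∀ s : ℝ, 0 < s → ENNReal.ofReal (s ^ (-α)) * ENNReal.ofReal (min (s ^ r) 1) ≤
      ENNReal.ofReal (s ^ (-α)) := by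
    intro s hs
    refine mul_le_of_le_one_right' ?_
    rw [← ENNReal.ofReal_one]
    exact ENNReal.ofReal_le_ofReal (min_le_right _ _)
  by_cases hq' : q = ⊤
  · subst hq'
    rw [haarNorm_top]
    refine ne_top_of_le_ne_top ENNReal.one_ne_top (iSup₂_le fun s hs => ?_)
    rw [← ENNReal.ofReal_one]
    rcases le_total s 1 with h | h
    · exact (hle0 s hs h).trans (ENNReal.ofReal_le_ofReal
        (Real.rpow_le_one hs.le h (by linarith)))
    · exact (hle1 s hs).trans (ENNReal.ofReal_le_ofReal
        (Real.rpow_le_one_of_one_le_of_nonpos h (by linarith)))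
  · have h1 := one_le_toReal hq hq'
    set p := q.toReal with hp
    rw [haarNorm, if_neg hq']
    refine ENNReal.rpow_ne_top_of_nonneg (by positivity) ?_
    rw [← Ioc_union_Ioi_eq_Ioi zero_le_one]
    refine ne_top_of_le_ne_top ?_ (lintegral_union_le _ _ _)
    have hpow : ∀ (s β : ℝ), 0 < s → ENNReal.ofReal (s ^ β) ^ p / ENNReal.ofReal s =
        ENNReal.ofReal (s ^ (β * p - 1)) := by
      intro s β hs
      rw [ENNReal.ofReal_rpow_of_nonneg (by positivity) (by positivity),
        ← ENNReal.ofReal_div_of_pos hs, ← Real.rpow_mul hs.le, Real.rpow_sub_one hs.ne']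
    refine ENNReal.add_ne_top.2 ⟨?_, ?_⟩
    · have hint : IntegrableOn (fun s : ℝ => s ^ ((r - α) * p - 1)) (Ioc 0 1) := by
        have : -1 < (r - α) * p - 1 := by nlinarith
        exact (intervalIntegrable_iff_integrableOn_Ioc_of_le zero_le_one).1
          (intervalIntegral.intervalIntegrable_rpow' this)
      refine ne_top_of_le_ne_top hint.lintegral_lt_top.ne
        (setLIntegral_mono' measurableSet_Ioc fun s hs => ?_)
      rw [← hpow s _ hs.1]
      gcongr
      exact hle0 s hs.1 hs.2
    · have hint : IntegrableOn (fun s : ℝ => s ^ (-α * p - 1)) (Ioi 1) :=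
        integrableOn_Ioi_rpow_of_lt (by nlinarith) one_pos
      refine ne_top_of_le_ne_top hint.lintegral_lt_top.ne
        (setLIntegral_mono' measurableSet_Ioi fun s (hs : 1 < s) => ?_)
      rw [← hpow s _ (by linarith)]
      gcongr
      exact hle1 s (by linarith)

end HaarNorm

/-! ### Domination of extended norms -/

section Domination

variable {A : Type*}

/-- The extended norm `N` is at most a finite constant times `N'`. -/
def IsDominated (N N' : A → ℝ≥0∞) : Prop :=
  ∃ C : NNReal, ∀ f, N f ≤ C * N' f

theorem IsDominated.trans {N₁ N₂ N₃ : A → ℝ≥0∞} (h : IsDominated N₁ N₂) (h' : IsDominated N₂ N₃) :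
    IsDominated N₁ N₃ := by
  obtain ⟨C, hC⟩ := h
  obtain ⟨C', hC'⟩ := h'
  refine ⟨C * C', fun f => (hC f).trans ?_⟩
  rw [ENNReal.coe_mul, mul_assoc]
  exact mul_le_mul_right (hC' f) _

theorem IsDominated.add {N₁ N₂ N : A → ℝ≥0∞} (h : IsDominated N₁ N) (h' : IsDominated N₂ N) :
    IsDominated (fun f => N₁ f + N₂ f) N := by
  obtain ⟨C, hC⟩ := h
  obtain ⟨C', hC'⟩ := h'
  refine ⟨C + C', fun f => (add_le_add (hC f) (hC' f)).trans ?_⟩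
  rw [ENNReal.coe_add, add_mul]

theorem IsDominated.sum {ι : Type*} (u : Finset ι) {N : ι → A → ℝ≥0∞} {N' : A → ℝ≥0∞}
    (h : ∀ i, IsDominated (N i) N') : IsDominated (fun f => ∑ i ∈ u, N i f) N' := by
  choose C hC using h
  refine ⟨∑ i ∈ u, C i, fun f => ?_⟩
  rw [ENNReal.ofNNReal_finsetSum, Finset.sum_mul]
  exact Finset.sum_le_sum fun i _ => hC i f

theorem IsDominated.normsEquivalent [AddCommGroup A] {N N' : A → ℝ≥0∞} (h : IsDominated N N')
    (h' : IsDominated N' N) : NormsEquivalent N N' := by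
  obtain ⟨C, hC⟩ := h
  obtain ⟨C', hC'⟩ := h'
  refine ⟨((C : ℝ) + 1)⁻¹, C' + 1, by positivity, by positivity, fun f => ⟨?_, ?_⟩⟩
  · rw [ENNReal.ofReal_inv_of_pos (by positivity), mul_comm, ← div_eq_mul_inv]
    refine ENNReal.div_le_of_le_mul' ((hC f).trans (mul_le_mul_left ?_ _))
    rw [← ENNReal.ofReal_coe_nnreal]
    exact ENNReal.ofReal_le_ofReal (by linarith)
  · refine (hC' f).trans (mul_le_mul_left ?_ _)
    rw [← ENNReal.ofReal_coe_nnreal]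
    exact ENNReal.ofReal_le_ofReal (by linarith)

end Domination

/-! ### The interpolation norm in the scale of the modulus of continuity -/

section Rescaling

variable {A : Type*} [AddCommGroup A] {q : ℝ≥0∞}

theorem measurable_kFunctional (N₀ N₁ : A → ℝ≥0∞) (f : A) :
    Measurable fun t => kFunctional N₀ N₁ t f :=
  Monotone.measurable fun _ _ h => kFunctional_mono N₀ N₁ h f

theorem measurable_kFunctional_pow (N₀ N₁ : A → ℝ≥0∞) (p : ℕ) (f : A) :
    Measurable fun s : ℝ => kFunctional N₀ N₁ (s ^ p) f :=
  (measurable_kFunctional N₀ N₁ f).comp (measurable_id.pow_const p)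

/-- The interpolation norm after the substitution `t = s^p`. -/
noncomputable def rescaledInterpNorm (N₀ N₁ : A → ℝ≥0∞) (p : ℕ) (β : ℝ) (q : ℝ≥0∞) (f : A) :
    ℝ≥0∞ :=
  haarNorm q fun s => ENNReal.ofReal (s ^ (-β)) * kFunctional N₀ N₁ (s ^ p) f

theorem rescaledInterpNorm_eq (N₀ N₁ : A → ℝ≥0∞) {p : ℕ} (hp : p ≠ 0) (β : ℝ) (f : A) :
    rescaledInterpNorm N₀ N₁ p β q f = haarNorm q fun s =>
      (fun t => ENNReal.ofReal (t ^ (-(β / p))) * kFunctional N₀ N₁ t f) (s ^ p) := by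
  refine haarNorm_congr fun s hs => ?_
  dsimp only
  rw [← Real.rpow_natCast s p, ← Real.rpow_mul hs.le]
  congr 3
  have : (p : ℝ) ≠ 0 := by exact_mod_cast hp
  field_simp

theorem isDominated_rescaledInterpNorm_interpNorm (N₀ N₁ : A → ℝ≥0∞) (hq : 1 ≤ q) {p : ℕ}
    (hp : p ≠ 0) (β : ℝ) :
    IsDominated (rescaledInterpNorm N₀ N₁ p β q) (interpNorm N₀ N₁ (β / p) q) :=
  ⟨1, fun f => by
    rw [rescaledInterpNorm_eq N₀ N₁ hp, ENNReal.coe_one, one_mul]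
    exact haarNorm_comp_pow_le hq hp _⟩

theorem isDominated_interpNorm_rescaledInterpNorm (N₀ N₁ : A → ℝ≥0∞) (hq : 1 ≤ q) {p : ℕ}
    (hp : p ≠ 0) (β : ℝ) :
    IsDominated (interpNorm N₀ N₁ (β / p) q) (rescaledInterpNorm N₀ N₁ p β q) :=
  ⟨p, fun f => by
    rw [rescaledInterpNorm_eq N₀ N₁ hp]
    exact haarNorm_le_comp_pow hq hp _⟩

theorem min_mul_le_kFunctional {N₀ N₁ : A → ℝ≥0∞} (hN : ∀ f, N₀ f ≤ N₁ f)
    (hadd : ∀ f g, N₀ (f + g) ≤ N₀ f + N₀ g) (t : ℝ) (f : A) :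
    ENNReal.ofReal (min t 1) * N₀ f ≤ kFunctional N₀ N₁ t f := by
  refine le_kFunctional fun f₀ f₁ hf _ _ => ?_
  have h1 : ENNReal.ofReal (min t 1) ≤ 1 := by
    rw [← ENNReal.ofReal_one]; exact ENNReal.ofReal_le_ofReal (min_le_right _ _)
  calc _ ≤ ENNReal.ofReal (min t 1) * N₀ f₀ + ENNReal.ofReal (min t 1) * N₀ f₁ := by
        rw [← mul_add, ← hf]; exact mul_le_mul_right (hadd _ _) _
    _ ≤ _ := by
        refine add_le_add (mul_le_of_le_one_left' h1) (mul_le_mul' ?_ (hN _))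
        exact ENNReal.ofReal_le_ofReal (min_le_left _ _)

/-- The norm of the larger space is dominated by the interpolation norm. -/
theorem isDominated_rescaledInterpNorm {N₀ N₁ : A → ℝ≥0∞} (hN : ∀ f, N₀ f ≤ N₁ f)
    (hadd : ∀ f g, N₀ (f + g) ≤ N₀ f + N₀ g) (hq : 1 ≤ q) {p : ℕ} {β : ℝ}
    (hβ : 0 < β) (hβp : β < p) : IsDominated N₀ (rescaledInterpNorm N₀ N₁ p β q) := by
  have hm : Measurable fun s : ℝ => ENNReal.ofReal (s ^ (-β)) * ENNReal.ofReal (min (s ^ p) 1) :=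
    measurable_ofReal_rpow_mul _
      (ENNReal.measurable_ofReal.comp ((measurable_id.pow_const p).min measurable_const))
  set c := haarNorm q fun s : ℝ => ENNReal.ofReal (s ^ (-β)) * ENNReal.ofReal (min (s ^ p) 1)
    with hc
  have hc0 : c ≠ 0 := by
    refine haarNorm_ne_zero hm fun s hs => ?_
    have h1 : 0 < s ^ (-β) := by positivity
    have h2 : 0 < min (s ^ p) 1 := by positivity
    exact mul_ne_zero (ENNReal.ofReal_pos.2 h1).ne' (ENNReal.ofReal_pos.2 h2).ne'
  refine ⟨(c⁻¹).toNNReal, fun f => ?_⟩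
  rw [ENNReal.coe_toNNReal (ENNReal.inv_ne_top.2 hc0), mul_comm, ← div_eq_mul_inv]
  have hle : N₀ f * c ≤ rescaledInterpNorm N₀ N₁ p β q f := by
    rw [hc, ← haarNorm_const_mul hq _ hm]
    refine haarNorm_mono fun s hs => ?_
    calc _ = ENNReal.ofReal (s ^ (-β)) * (ENNReal.ofReal (min (s ^ p) 1) * N₀ f) := by ring
      _ ≤ _ := mul_le_mul_right (min_mul_le_kFunctional hN hadd _ f) _
  rwa [ENNReal.le_div_iff_mul_le (Or.inl hc0)
    (Or.inl (haarNorm_rpow_mul_min_ne_top hq hβ hβp))]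

end Rescaling

/-! ### The scale of abstract Sobolev spaces -/

section Scale

variable {E : Type*} [NormedAddCommGroup E] [NormedSpace ℝ E] {d : ℕ}
  {T : Fin d → ContractionSemigroup E} {q : ℝ≥0∞}

theorem measurable_mixedModulus (T : Fin d → ContractionSemigroup E) (r : ℕ) (f : E) :
    Measurable fun s => mixedModulus T r s f :=
  Monotone.measurable fun _ _ h => mixedModulus_mono T h r f

/-- The K-functional is attained up to the factor `2`; for `f ≠ 0` it is positive. -/
theorem exists_near_optimal (T : Fin d → ContractionSemigroup E) (r : ℕ) {s : ℝ} (hs : 0 < s)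
    (f : E) : ∃ a b : E, a + b = f ∧ ‖a‖ₑ + ENNReal.ofReal (s ^ r) * sobolevNorm T r b ≤
      2 * kFunctional (fun g : E => ‖g‖ₑ) (sobolevNorm T r) (s ^ r) f := by
  by_contra! h
  have h1 : 2 * kFunctional (fun g : E => ‖g‖ₑ) (sobolevNorm T r) (s ^ r) f ≤
      kFunctional (fun g : E => ‖g‖ₑ) (sobolevNorm T r) (s ^ r) f :=
    le_kFunctional fun a b hab _ _ => (h a b hab).le
  set K := kFunctional (fun g : E => ‖g‖ₑ) (sobolevNorm T r) (s ^ r) f with hK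
  have hKt : K ≠ ⊤ := ne_top_of_le_ne_top enorm_ne_top (kFunctional_le_enorm T r _ f)
  have hK0 : K = 0 := by
    rw [two_mul] at h1
    by_contra h0
    exact absurd h1 (not_le.2 (ENNReal.lt_add_right hKt h0))
  have hmin := min_mul_le_kFunctional (N₀ := fun g : E => ‖g‖ₑ) (enorm_le_sobolevNorm T r)
    enorm_add_le (s ^ r) f
  rw [← hK, hK0, nonpos_iff_eq_zero, mul_eq_zero, ENNReal.ofReal_eq_zero, enorm_eq_zero] at hmin
  rcases hmin with h2 | h2
  · exact absurd h2 (not_le.2 (by positivity))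
  · subst h2
    have := h 0 0 (add_zero 0)
    have h0 : sobolevNorm T r (0 : E) = 0 := sobolevNorm_apply_zero T r
    simp [hK0, h0] at this

variable [CompleteSpace E]

/-- The Jackson type inequality: on `E^k` the K-functional has order `s^k`. -/
theorem exists_kFunctional_le_sobolevNorm (hT : SemigroupAssumption T) {r k : ℕ} (hr : 1 ≤ r)
    (hk : k ≤ r) : ∃ C : NNReal, ∀ (s : ℝ), 0 < s → ∀ f : E,
      kFunctional (fun g : E => ‖g‖ₑ) (sobolevNorm T r) (s ^ r) f ≤
        C * (ENNReal.ofReal (s ^ k) * sobolevNorm T k f) := by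
  obtain ⟨C, hC⟩ := exists_kFunctional_equiv hT hr
  set M : NNReal := (d : NNReal) ^ r * (2 ^ (r - k) * 3 ^ k) + 1 with hM
  refine ⟨C * M, fun s hs f => ?_⟩
  by_cases hf : f ∈ sobolevSpace T k
  · have h1 : mixedModulus T r s f ≤
        (d : ℝ≥0∞) ^ r * (2 ^ (r - k) * 3 ^ k) * (ENNReal.ofReal (s ^ k) * sobolevNorm T k f) := by
      have h2 := supModulus_add_right_le T s k (r - k) f
      rw [Nat.add_sub_cancel' hk] at h2
      calc _ ≤ (d : ℝ≥0∞) ^ r * (2 ^ (r - k) * (ENNReal.ofReal ((3 * s) ^ k) *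
            sobolevNorm T k f)) :=
            (mixedModulus_le T s r f).trans (mul_le_mul_right (h2.trans
              (mul_le_mul_right (supModulus_le_sobolevNorm T hs.le k hf) _)) _)
        _ = _ := by
            rw [mul_pow, ENNReal.ofReal_mul (by positivity),
              ENNReal.ofReal_pow (by norm_num : (0 : ℝ) ≤ 3), ENNReal.ofReal_ofNat]
            ring
    have h3 : ENNReal.ofReal (min (s ^ r) 1) * ‖f‖ₑ ≤
        1 * (ENNReal.ofReal (s ^ k) * sobolevNorm T k f) := by
      rw [one_mul]
      refine mul_le_mul' (ENNReal.ofReal_le_ofReal ?_) (enorm_le_sobolevNorm T k f)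
      rcases le_total s 1 with h | h
      · exact (min_le_left _ _).trans (pow_le_pow_of_le_one hs.le h hk)
      · exact (min_le_right _ _).trans (one_le_pow₀ h)
    refine ((hC f s hs.le).2.trans (mul_le_mul_right (add_le_add h1 h3) _)).trans_eq ?_
    rw [← add_mul, ← mul_assoc, hM]
    push_cast
    ring
  · by_cases hC0 : C = 0
    · simpa [hC0] using (hC f s hs.le).2
    · have h0 : (C * M : NNReal) ≠ 0 := mul_ne_zero hC0 (by rw [hM]; positivity)
      rw [sobolevNorm_of_notMem T hf, ENNReal.mul_top (by simpa using pow_pos hs k),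
        ENNReal.mul_top (by exact_mod_cast h0)]
      exact le_top

/-- The Bernstein type inequality, in the form used for near-optimal decompositions: the norm of `E^k`
is bounded by the norms of `E` and `E^r`. -/
theorem exists_sobolevNorm_le (T : Fin d → ContractionSemigroup E) {r k : ℕ} (hk : k ≤ r) :
    ∃ C : NNReal, ∀ (s : ℝ), 0 < s → ∀ f : E,
      ENNReal.ofReal (s ^ k) * sobolevNorm T k f ≤
        C * (‖f‖ₑ + ENNReal.ofReal (s ^ r) * sobolevNorm T r f) := by
  obtain ⟨C, hC1, hC⟩ := sobolevNorm_interp T r k hk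
  have hpow : ∀ s : ℝ, s ^ k * s ^ (r - k) = s ^ r := fun s => by
    rw [← pow_add, Nat.add_sub_cancel' hk]
  refine ⟨C.toNNReal, fun s hs f => ?_⟩
  change _ ≤ ENNReal.ofReal C * _
  rcases le_total s 1 with h | h
  · refine (mul_le_mul_right (hC s hs h f) _).trans_eq ?_
    have e1 : ENNReal.ofReal (s ^ k) * ENNReal.ofReal (s⁻¹ ^ k) = 1 := by
      rw [← ENNReal.ofReal_mul (by positivity), ← mul_pow, mul_inv_cancel₀ hs.ne', one_pow,
        ENNReal.ofReal_one]
    have e2 : ENNReal.ofReal (s ^ k) * ENNReal.ofReal (s ^ (r - k)) = ENNReal.ofReal (s ^ r) := by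
      rw [← ENNReal.ofReal_mul (by positivity), hpow]
    calc _ = ENNReal.ofReal C * (ENNReal.ofReal (s ^ k) * ENNReal.ofReal (s⁻¹ ^ k) * ‖f‖ₑ +
          ENNReal.ofReal (s ^ k) * ENNReal.ofReal (s ^ (r - k)) * sobolevNorm T r f) := by ring
      _ = _ := by rw [e1, e2, one_mul]
  · calc _ ≤ ENNReal.ofReal (s ^ r) * sobolevNorm T r f :=
          mul_le_mul' (ENNReal.ofReal_le_ofReal (pow_le_pow_right₀ h hk)) (sobolevNorm_mono T hk f)
      _ ≤ ‖f‖ₑ + ENNReal.ofReal (s ^ r) * sobolevNorm T r f := le_add_self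
      _ ≤ _ := le_mul_of_one_le_left' (by
          rw [← ENNReal.ofReal_one]; exact ENNReal.ofReal_le_ofReal hC1)

theorem tendsto_kFunctional_pow (hT : SemigroupAssumption T) {r : ℕ} (hr : 1 ≤ r) (f : E) :
    Tendsto (fun s : ℝ => kFunctional (fun g : E => ‖g‖ₑ) (sobolevNorm T r) (s ^ r) f)
      (𝓝[>] 0) (𝓝 0) := by
  obtain ⟨C, hC⟩ := exists_kFunctional_equiv hT hr
  have h1 : Tendsto (fun s : ℝ => C * ((d : ℝ≥0∞) ^ r * (2 ^ (r - 1) * supModulus T s 1 f) +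
      ENNReal.ofReal (s ^ r) * ‖f‖ₑ)) (𝓝[>] 0)
      (𝓝 (C * ((d : ℝ≥0∞) ^ r * (2 ^ (r - 1) * 0) + 0 * ‖f‖ₑ))) := by
    refine ENNReal.Tendsto.const_mul (Tendsto.add (ENNReal.Tendsto.const_mul
      (ENNReal.Tendsto.const_mul (tendsto_supModulus_one T f) (Or.inr (by simp)))
      (Or.inr (by simp))) (ENNReal.Tendsto.mul_const ?_
      (Or.inr enorm_ne_top))) (Or.inr ENNReal.coe_ne_top)
    have h2 : Tendsto (fun s : ℝ => ENNReal.ofReal (s ^ r)) (𝓝 0)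
        (𝓝 (ENNReal.ofReal (0 ^ r))) :=
      ENNReal.tendsto_ofReal ((continuous_pow r).tendsto 0)
    rw [zero_pow (by omega), ENNReal.ofReal_zero] at h2
    exact h2.mono_left nhdsWithin_le_nhds
  simp only [mul_zero, zero_mul, add_zero] at h1
  refine tendsto_of_tendsto_of_tendsto_of_le_of_le' tendsto_const_nhds h1
    (Eventually.of_forall fun _ => zero_le) ?_
  filter_upwards [self_mem_nhdsWithin] with s hs
  refine (hC f s (mem_Ioi.1 hs).le).2.trans ?_
  gcongr
  · refine (mixedModulus_le T s r f).trans ?_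
    gcongr
    have := supModulus_add_right_le T s 1 (r - 1) f
    rwa [show 1 + (r - 1) = r by omega] at this
  · exact min_le_left _ _

end Scale

/-! ### Reiteration -/

section Reiteration

variable {E : Type*} [NormedAddCommGroup E] [NormedSpace ℝ E] {d : ℕ}
  {T : Fin d → ContractionSemigroup E} {q : ℝ≥0∞}

theorem kFunctional_mul_le {A : Type*} [AddCommGroup A] (N₀ N₁ : A → ℝ≥0∞) {c : ℝ} (hc : 1 ≤ c)
    (t : ℝ) (f : A) :
    kFunctional N₀ N₁ (c * t) f ≤ ENNReal.ofReal c * kFunctional N₀ N₁ t f := by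
  have h := le_mul_kFunctional_add (N₀ := N₀) (N₁ := N₁) (t := t) (f := f)
    (B := kFunctional N₀ N₁ (c * t) f) (B' := 0) (c := ENNReal.ofReal c)
    (ENNReal.ofReal_pos.2 (by linarith)).ne' ENNReal.ofReal_ne_top fun f₀ f₁ hf _ h₁ => by
      refine (kFunctional_le hf (Or.inr h₁)).trans ?_
      rw [add_zero, mul_add, ← mul_assoc, ← ENNReal.ofReal_mul (by linarith)]
      gcongr
      refine le_mul_of_one_le_left' ?_
      rw [← ENNReal.ofReal_one]
      exact ENNReal.ofReal_le_ofReal hc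
  simpa using h

variable [CompleteSpace E]

/-- Between `E` and `E^r`, the K-functional is controlled by the one of an intermediate pair. -/
theorem isDominated_rescaledInterpNorm_of_le (hT : SemigroupAssumption T) {r k₁ k₂ : ℕ}
    (hr : 1 ≤ r) (hk : k₁ ≤ k₂) (hk₂ : k₂ ≤ r) (hq : 1 ≤ q) (α : ℝ) :
    IsDominated (rescaledInterpNorm (fun g : E => ‖g‖ₑ) (sobolevNorm T r) r α q)
      (rescaledInterpNorm (sobolevNorm T k₁) (sobolevNorm T k₂) (k₂ - k₁) (α - k₁) q) := by
  obtain ⟨C₁, h₁⟩ := exists_kFunctional_le_sobolevNorm hT hr (hk.trans hk₂)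
  obtain ⟨C₂, h₂⟩ := exists_kFunctional_le_sobolevNorm hT hr hk₂
  refine ⟨C₁ + C₂ + 1, fun f => ?_⟩
  have hm := measurable_ofReal_rpow_mul (-(α - k₁))
    (measurable_kFunctional_pow (sobolevNorm T k₁) (sobolevNorm T k₂) (k₂ - k₁) f)
  rw [rescaledInterpNorm, rescaledInterpNorm, ← haarNorm_const_mul hq _ hm]
  refine haarNorm_mono fun s hs => ?_
  have key : kFunctional (fun g : E => ‖g‖ₑ) (sobolevNorm T r) (s ^ r) f ≤
      (C₁ + C₂ + 1 : NNReal) * ENNReal.ofReal (s ^ k₁) *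
        kFunctional (sobolevNorm T k₁) (sobolevNorm T k₂) (s ^ (k₂ - k₁)) f := by
    have hc0 : ((C₁ + C₂ + 1 : NNReal) : ℝ≥0∞) * ENNReal.ofReal (s ^ k₁) ≠ 0 := by
      refine mul_ne_zero ?_ (ENNReal.ofReal_pos.2 (by positivity)).ne'
      exact_mod_cast (by positivity : (C₁ + C₂ + 1 : NNReal) ≠ 0)
    have h := le_mul_kFunctional_add (N₀ := sobolevNorm T k₁) (N₁ := sobolevNorm T k₂)
      (t := s ^ (k₂ - k₁)) (f := f) (B' := 0) hc0
      (ENNReal.mul_ne_top ENNReal.coe_ne_top ENNReal.ofReal_ne_top)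
      (B := kFunctional (fun g : E => ‖g‖ₑ) (sobolevNorm T r) (s ^ r) f)
      fun f₀ f₁ hf _ _ => by
        rw [add_zero, ← hf]
        refine (kFunctional_add_le enorm_add_le (sobolevNorm_add_le T r) _ f₀ f₁).trans
          ((add_le_add (h₁ s hs f₀) (h₂ s hs f₁)).trans ?_)
        have hpow : ENNReal.ofReal (s ^ k₂) =
            ENNReal.ofReal (s ^ k₁) * ENNReal.ofReal (s ^ (k₂ - k₁)) := by
          rw [← ENNReal.ofReal_mul (by positivity), ← pow_add, Nat.add_sub_cancel' hk]
        have hc₁ : (C₁ : ℝ≥0∞) ≤ (C₁ + C₂ + 1 : NNReal) := by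
          exact_mod_cast le_add_right le_self_add
        have hc₂ : (C₂ : ℝ≥0∞) ≤ (C₁ + C₂ + 1 : NNReal) := by
          exact_mod_cast le_add_right le_add_self
        calc _ ≤ ((C₁ + C₂ + 1 : NNReal) : ℝ≥0∞) * (ENNReal.ofReal (s ^ k₁) * sobolevNorm T k₁ f₀) +
              ((C₁ + C₂ + 1 : NNReal) : ℝ≥0∞) * (ENNReal.ofReal (s ^ k₂) * sobolevNorm T k₂ f₁) :=
              add_le_add (mul_le_mul_left hc₁ _) (mul_le_mul_left hc₂ _)
          _ = _ := by rw [hpow]; ring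
    simpa using h
  calc _ ≤ ENNReal.ofReal (s ^ (-α)) * ((C₁ + C₂ + 1 : NNReal) * ENNReal.ofReal (s ^ k₁) *
        kFunctional (sobolevNorm T k₁) (sobolevNorm T k₂) (s ^ (k₂ - k₁)) f) :=
        mul_le_mul_right key _
    _ = (C₁ + C₂ + 1 : NNReal) * ((ENNReal.ofReal (s ^ (-α)) * ENNReal.ofReal (s ^ k₁)) *
        kFunctional (sobolevNorm T k₁) (sobolevNorm T k₂) (s ^ (k₂ - k₁)) f) := by ring
    _ = _ := by
        rw [← ENNReal.ofReal_mul (by positivity), ← Real.rpow_natCast s k₁, ← Real.rpow_add hs,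
          show -α + (k₁ : ℝ) = -(α - k₁) by ring]

/-- The K-functional of an intermediate pair is bounded by the values of the K-functional of
`(E, E^r)` at all dyadic multiples of the scale. -/
theorem exists_kFunctional_le_tsum (hT : SemigroupAssumption T) {r k₁ k₂ : ℕ}
    (hr : 1 ≤ r) (hk₁ : k₁ ≤ r) (hk₂ : k₂ ≤ r) : ∃ C : NNReal, ∀ (s : ℝ), 0 < s → ∀ f : E,
      kFunctional (sobolevNorm T k₁) (sobolevNorm T k₂) (s ^ (k₂ - k₁)) f ≤
        C * ((∑' n : ℕ, ENNReal.ofReal (((2⁻¹ ^ (n + 1) * s) ^ k₁)⁻¹) *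
            kFunctional (fun g : E => ‖g‖ₑ) (sobolevNorm T r) ((2⁻¹ ^ (n + 1) * s) ^ r) f) +
          ENNReal.ofReal (s ^ (k₂ - k₁)) * ∑' n : ℕ, ENNReal.ofReal (((2 ^ n * s) ^ k₂)⁻¹) *
            kFunctional (fun g : E => ‖g‖ₑ) (sobolevNorm T r) ((2 ^ n * s) ^ r) f) := by
  obtain ⟨C₁, h₁⟩ := exists_sobolevNorm_le T hk₁
  obtain ⟨C₂, h₂⟩ := exists_sobolevNorm_le T hk₂
  set B : NNReal := 2 ^ (r + 1) + 2 with hB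
  refine ⟨(C₁ + C₂) * B, fun s hs f => ?_⟩
  set K : ℝ → ℝ≥0∞ := fun σ => kFunctional (fun g : E => ‖g‖ₑ) (sobolevNorm T r) (σ ^ r) f with hK
  have hdec : ∀ σ : ℝ, ∃ a b : E, 0 < σ → a + b = f ∧
      ‖a‖ₑ + ENNReal.ofReal (σ ^ r) * sobolevNorm T r b ≤ 2 * K σ := by
    intro σ
    by_cases hσ : 0 < σ
    · obtain ⟨a, b, h⟩ := exists_near_optimal T r hσ f
      exact ⟨a, b, fun _ => h⟩
    · exact ⟨0, 0, fun h => absurd h hσ⟩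
  choose a b hab using hdec
  have hK2 : ∀ σ : ℝ, K (2 * σ) ≤ 2 ^ r * K σ := by
    intro σ
    have h := kFunctional_mul_le (fun g : E => ‖g‖ₑ) (sobolevNorm T r)
      (one_le_pow₀ (one_le_two : (1 : ℝ) ≤ 2) : (1 : ℝ) ≤ 2 ^ r) (σ ^ r) f
    rwa [← mul_pow, ENNReal.ofReal_pow zero_le_two, ENNReal.ofReal_ofNat] at h
  -- the consecutive differences of the decompositions
  have hdiff : ∀ σ : ℝ, 0 < σ → a (2 * σ) - a σ = b σ - b (2 * σ) := by
    intro σ hσ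
    rw [sub_eq_sub_iff_add_eq_add, (hab (2 * σ) (by positivity)).1, add_comm, (hab σ hσ).1]
  have hu : ∀ σ : ℝ, 0 < σ → ‖a (2 * σ) - a σ‖ₑ +
      ENNReal.ofReal (σ ^ r) * sobolevNorm T r (a (2 * σ) - a σ) ≤ B * K σ := by
    intro σ hσ
    have e1 := (hab σ hσ).2
    have e2 := (hab (2 * σ) (by positivity)).2
    have e3 : ENNReal.ofReal (σ ^ r) * sobolevNorm T r (a (2 * σ) - a σ) ≤
        ENNReal.ofReal (σ ^ r) * sobolevNorm T r (b σ) +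
          ENNReal.ofReal ((2 * σ) ^ r) * sobolevNorm T r (b (2 * σ)) := by
      rw [hdiff σ hσ]
      refine (mul_le_mul_right (sobolevNorm_sub_le T r _ _) _).trans ?_
      rw [mul_add]
      gcongr
      linarith
    calc _ ≤ (‖a (2 * σ)‖ₑ + ‖a σ‖ₑ) + (ENNReal.ofReal (σ ^ r) * sobolevNorm T r (b σ) +
          ENNReal.ofReal ((2 * σ) ^ r) * sobolevNorm T r (b (2 * σ))) :=
          add_le_add enorm_sub_le e3
      _ = (‖a (2 * σ)‖ₑ + ENNReal.ofReal ((2 * σ) ^ r) * sobolevNorm T r (b (2 * σ))) +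
          (‖a σ‖ₑ + ENNReal.ofReal (σ ^ r) * sobolevNorm T r (b σ)) := by ring
      _ ≤ 2 * (2 ^ r * K σ) + 2 * K σ :=
          add_le_add (e2.trans (mul_le_mul_right (hK2 σ) _)) e1
      _ = _ := by rw [hB]; push_cast; ring
  have hN : ∀ {k : ℕ} {C : NNReal}, (∀ (s : ℝ), 0 < s → ∀ f : E,
      ENNReal.ofReal (s ^ k) * sobolevNorm T k f ≤
        C * (‖f‖ₑ + ENNReal.ofReal (s ^ r) * sobolevNorm T r f)) → ∀ σ : ℝ, 0 < σ →
      sobolevNorm T k (a (2 * σ) - a σ) ≤ C * B * (ENNReal.ofReal ((σ ^ k)⁻¹) * K σ) := by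
    intro k C h σ hσ
    have h3 := (h σ hσ _).trans (mul_le_mul_right (hu σ hσ) _)
    calc _ = ENNReal.ofReal ((σ ^ k)⁻¹) *
          (ENNReal.ofReal (σ ^ k) * sobolevNorm T k (a (2 * σ) - a σ)) := by
          rw [← mul_assoc, ← ENNReal.ofReal_mul (by positivity),
            inv_mul_cancel₀ (by positivity), ENNReal.ofReal_one, one_mul]
      _ ≤ _ := mul_le_mul_right h3 _
      _ = _ := by ring
  -- the part of `f` in the first space is the sum of the differences at the smaller scales
  have ha : sobolevNorm T k₁ (a s) ≤ C₁ * B * ∑' n : ℕ,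
      ENNReal.ofReal (((2⁻¹ ^ (n + 1) * s) ^ k₁)⁻¹) * K (2⁻¹ ^ (n + 1) * s) := by
    have hs0 : Tendsto (fun n : ℕ => (2 : ℝ)⁻¹ ^ n * s) atTop (𝓝[>] 0) := by
      refine tendsto_nhdsWithin_iff.2 ⟨?_, Eventually.of_forall fun n => mem_Ioi.2 (by positivity)⟩
      simpa using (tendsto_pow_atTop_nhds_zero_of_lt_one (by norm_num : (0 : ℝ) ≤ 2⁻¹)
        (by norm_num)).mul_const s
    have ha0 : Tendsto (fun n : ℕ => a (2⁻¹ ^ n * s)) atTop (𝓝 0) := by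
      rw [tendsto_zero_iff_enorm_tendsto_zero]
      have h3 := ENNReal.Tendsto.const_mul (a := 2) ((tendsto_kFunctional_pow hT hr f).comp hs0)
        (Or.inr (by simp))
      rw [mul_zero] at h3
      exact tendsto_of_tendsto_of_tendsto_of_le_of_le tendsto_const_nhds h3 (fun _ => zero_le)
        fun n => le_self_add.trans (hab (2⁻¹ ^ n * s) (by positivity)).2
    have hsum : Tendsto (fun N : ℕ => ∑ n ∈ Finset.range N,
        (a (2⁻¹ ^ n * s) - a (2⁻¹ ^ (n + 1) * s))) atTop (𝓝 (a s)) := by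
      simp only [Finset.sum_range_sub' (fun n : ℕ => a (2⁻¹ ^ n * s))]
      simpa using ha0.const_sub (a s)
    refine (sobolevNorm_le_tsum T k₁ hsum).trans ?_
    rw [← ENNReal.tsum_mul_left]
    refine ENNReal.tsum_le_tsum fun n => ?_
    have h3 := hN h₁ (2⁻¹ ^ (n + 1) * s) (by positivity)
    rwa [show 2 * ((2 : ℝ)⁻¹ ^ (n + 1) * s) = 2⁻¹ ^ n * s by rw [pow_succ]; ring] at h3
  -- the part in the second space is the sum of the differences at the larger scales
  have hb : sobolevNorm T k₂ (b s) ≤ C₂ * B * ∑' n : ℕ,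
      ENNReal.ofReal (((2 ^ n * s) ^ k₂)⁻¹) * K (2 ^ n * s) := by
    have hb0 : Tendsto (fun n : ℕ => b (2 ^ n * s)) atTop (𝓝 0) := by
      rw [tendsto_zero_iff_enorm_tendsto_zero]
      have h3 : Tendsto (fun n : ℕ => ENNReal.ofReal (((2 ^ n * s) ^ r)⁻¹) * (2 * ‖f‖ₑ)) atTop
          (𝓝 (ENNReal.ofReal 0 * (2 * ‖f‖ₑ))) := by
        refine ENNReal.Tendsto.mul_const (ENNReal.tendsto_ofReal ?_)
          (Or.inr (ENNReal.mul_ne_top (by simp) enorm_ne_top))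
        refine tendsto_inv_atTop_zero.comp ((tendsto_pow_atTop (by omega)).comp ?_)
        exact (tendsto_pow_atTop_atTop_of_one_lt one_lt_two).atTop_mul_const hs
      rw [ENNReal.ofReal_zero, zero_mul] at h3
      refine tendsto_of_tendsto_of_tendsto_of_le_of_le tendsto_const_nhds h3 (fun _ => zero_le)
        fun n => ?_
      have h4 := le_add_self.trans (hab (2 ^ n * s) (by positivity)).2
      calc ‖b (2 ^ n * s)‖ₑ ≤ sobolevNorm T r (b (2 ^ n * s)) := enorm_le_sobolevNorm T r _
        _ = ENNReal.ofReal (((2 ^ n * s) ^ r)⁻¹) *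
            (ENNReal.ofReal ((2 ^ n * s) ^ r) * sobolevNorm T r (b (2 ^ n * s))) := by
            rw [← mul_assoc, ← ENNReal.ofReal_mul (by positivity),
              inv_mul_cancel₀ (by positivity), ENNReal.ofReal_one, one_mul]
        _ ≤ _ := mul_le_mul_right (h4.trans
            (mul_le_mul_right (kFunctional_le_enorm T r _ f) _)) _
    have hsum : Tendsto (fun N : ℕ => ∑ n ∈ Finset.range N,
        (b (2 ^ n * s) - b (2 ^ (n + 1) * s))) atTop (𝓝 (b s)) := by
      simp only [Finset.sum_range_sub' (fun n : ℕ => b (2 ^ n * s))]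
      simpa using hb0.const_sub (b s)
    refine (sobolevNorm_le_tsum T k₂ hsum).trans ?_
    rw [← ENNReal.tsum_mul_left]
    refine ENNReal.tsum_le_tsum fun n => ?_
    have h3 := hN h₂ (2 ^ n * s) (by positivity)
    rwa [hdiff _ (by positivity), show 2 * ((2 : ℝ) ^ n * s) = 2 ^ (n + 1) * s by
      rw [pow_succ]; ring] at h3
  refine (kFunctional_le (hab s hs).1 (Or.inl (by positivity))).trans ?_
  refine (add_le_add ha (mul_le_mul_right hb _)).trans ?_
  set S₁ := ∑' n : ℕ, ENNReal.ofReal (((2⁻¹ ^ (n + 1) * s) ^ k₁)⁻¹) * K (2⁻¹ ^ (n + 1) * s)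
  set S₂ := ∑' n : ℕ, ENNReal.ofReal (((2 ^ n * s) ^ k₂)⁻¹) * K (2 ^ n * s)
  calc _ ≤ ((C₁ + C₂ : ℝ≥0∞) * B) * S₁ +
        ENNReal.ofReal (s ^ (k₂ - k₁)) * ((C₁ + C₂ : ℝ≥0∞) * B * S₂) := by
        gcongr
        · exact le_self_add
        · exact le_add_self
    _ = _ := by push_cast; ring

/-- The reverse of `isDominated_rescaledInterpNorm_of_le`: the dyadic sum is weighted by two
geometric series, which converge since `k₁ < α < k₂`. -/
theorem isDominated_rescaledInterpNorm_of_lt (hT : SemigroupAssumption T) {r k₁ k₂ : ℕ}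
    (hr : 1 ≤ r) (hk₂ : k₂ ≤ r) (hq : 1 ≤ q) {α : ℝ} (hα₁ : k₁ < α) (hα₂ : α < k₂) :
    IsDominated (rescaledInterpNorm (sobolevNorm T k₁) (sobolevNorm T k₂) (k₂ - k₁) (α - k₁) q)
      (rescaledInterpNorm (fun g : E => ‖g‖ₑ) (sobolevNorm T r) r α q) := by
  have hk : k₁ ≤ k₂ := by exact_mod_cast (hα₁.trans hα₂).le
  obtain ⟨C, hC⟩ := exists_kFunctional_le_tsum hT hr (hk.trans hk₂) hk₂
  -- the ratios of the two geometric series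
  set ρ₁ : ℝ := 2⁻¹ ^ (α - k₁) with hρ₁
  set ρ₂ : ℝ := 2 ^ (α - k₂) with hρ₂
  have hρ₁1 : ρ₁ < 1 := Real.rpow_lt_one (by norm_num) (by norm_num) (by linarith)
  have hρ₂1 : ρ₂ < 1 := Real.rpow_lt_one_of_one_lt_of_neg (by norm_num) (by linarith)
  have hgeo : ∀ {ρ : ℝ}, ρ < 1 → ∑' n : ℕ, ENNReal.ofReal ρ ^ n ≠ ⊤ := by
    intro ρ hρ
    rw [ENNReal.tsum_geometric]
    refine ENNReal.inv_ne_top.2 (tsub_pos_iff_lt.2 ?_).ne'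
    rw [← ENNReal.ofReal_one]
    exact (ENNReal.ofReal_lt_ofReal_iff one_pos).2 hρ
  set S := (∑' n : ℕ, ENNReal.ofReal ρ₁ ^ n) + ∑' n : ℕ, ENNReal.ofReal ρ₂ ^ n with hS
  have hSt : S ≠ ⊤ := ENNReal.add_ne_top.2 ⟨hgeo hρ₁1, hgeo hρ₂1⟩
  refine ⟨C * S.toNNReal, fun f => ?_⟩
  set φ : ℝ → ℝ≥0∞ := fun s => ENNReal.ofReal (s ^ (-α)) *
    kFunctional (fun g : E => ‖g‖ₑ) (sobolevNorm T r) (s ^ r) f with hφ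
  have hφm : Measurable φ := measurable_ofReal_rpow_mul _ (measurable_kFunctional_pow _ _ r f)
  have hφl : ∀ l : ℝ, Measurable fun s => φ (l * s) := fun l =>
    hφm.comp (measurable_const.mul measurable_id)
  have hpow : ∀ (l s : ℝ) (k : ℕ), 0 < l → 0 < s →
      s ^ (k - α) * ((l * s) ^ k)⁻¹ = l ^ (α - k) * (l * s) ^ (-α) := by
    intro l s k hl hs
    rw [Real.mul_rpow hl.le hs.le, mul_pow, Real.rpow_sub hs, Real.rpow_sub hl, Real.rpow_neg hl.le,
      Real.rpow_neg hs.le, Real.rpow_natCast, Real.rpow_natCast]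
    have := (Real.rpow_pos_of_pos hl α).ne'
    have := (Real.rpow_pos_of_pos hs α).ne'
    field_simp
  have hpt : ∀ s : ℝ, 0 < s → ENNReal.ofReal (s ^ (-(α - k₁))) *
      kFunctional (sobolevNorm T k₁) (sobolevNorm T k₂) (s ^ (k₂ - k₁)) f ≤
      C * ((∑' n : ℕ, ENNReal.ofReal ρ₁ ^ (n + 1) * φ (2⁻¹ ^ (n + 1) * s)) +
        ∑' n : ℕ, ENNReal.ofReal ρ₂ ^ n * φ (2 ^ n * s)) := by
    intro s hs
    refine (mul_le_mul_right (hC s hs f) _).trans_eq ?_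
    rw [mul_left_comm, mul_add]
    congr 2
    · rw [← ENNReal.tsum_mul_left]
      refine tsum_congr fun n => ?_
      have h := hpow (2⁻¹ ^ (n + 1)) s k₁ (by positivity) hs
      have h2 : ((2 : ℝ)⁻¹ ^ (n + 1)) ^ (α - k₁) = ρ₁ ^ (n + 1) := by
        rw [hρ₁, ← Real.rpow_natCast, ← Real.rpow_natCast, ← Real.rpow_mul (by norm_num),
          ← Real.rpow_mul (by norm_num), mul_comm]
      rw [neg_sub, ← mul_assoc, ← ENNReal.ofReal_mul (by positivity), h, h2, hφ,
        ENNReal.ofReal_mul (by positivity), ENNReal.ofReal_pow (by positivity), mul_assoc]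
    · rw [← mul_assoc, ← ENNReal.tsum_mul_left]
      refine tsum_congr fun n => ?_
      have h := hpow (2 ^ n) s k₂ (by positivity) hs
      have h2 : ((2 : ℝ) ^ n) ^ (α - k₂) = ρ₂ ^ n := by
        rw [hρ₂, ← Real.rpow_natCast, ← Real.rpow_natCast, ← Real.rpow_mul (by norm_num),
          ← Real.rpow_mul (by norm_num), mul_comm]
      have h3 : s ^ (-(α - k₁)) * s ^ (k₂ - k₁) = s ^ (k₂ - α) := by
        rw [← Real.rpow_natCast, ← Real.rpow_add hs, Nat.cast_sub hk]
        congr 1; ring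
      rw [← ENNReal.ofReal_mul (by positivity), h3, ← mul_assoc,
        ← ENNReal.ofReal_mul (by positivity), h, h2, hφ,
        ENNReal.ofReal_mul (by positivity), ENNReal.ofReal_pow (by positivity), mul_assoc]
  have hm₁ : ∀ n : ℕ, Measurable fun s => ENNReal.ofReal ρ₁ ^ (n + 1) * φ (2⁻¹ ^ (n + 1) * s) :=
    fun n => measurable_const.mul (hφl _)
  have hm₂ : ∀ n : ℕ, Measurable fun s => ENNReal.ofReal ρ₂ ^ n * φ (2 ^ n * s) :=
    fun n => measurable_const.mul (hφl _)
  have hterm : ∀ (c : ℝ≥0∞) (l : ℝ), 0 < l →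
      haarNorm q (fun s => c * φ (l * s)) = c * haarNorm q φ := fun c l hl => by
    rw [haarNorm_const_mul hq c (hφl l), haarNorm_comp_mul l hl]
  calc _ ≤ haarNorm q fun s => C *
        ((∑' n : ℕ, ENNReal.ofReal ρ₁ ^ (n + 1) * φ (2⁻¹ ^ (n + 1) * s)) +
        ∑' n : ℕ, ENNReal.ofReal ρ₂ ^ n * φ (2 ^ n * s)) := haarNorm_mono hpt
    _ ≤ C * ((∑' n : ℕ, ENNReal.ofReal ρ₁ ^ (n + 1) * haarNorm q φ) +
        ∑' n : ℕ, ENNReal.ofReal ρ₂ ^ n * haarNorm q φ) := by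
        have hs₁ : Measurable fun s => ∑' n : ℕ, ENNReal.ofReal ρ₁ ^ (n + 1) *
            φ (2⁻¹ ^ (n + 1) * s) := Measurable.tsum hm₁
        have hs₂ : Measurable fun s => ∑' n : ℕ, ENNReal.ofReal ρ₂ ^ n * φ (2 ^ n * s) :=
          Measurable.tsum hm₂
        refine (haarNorm_const_mul hq C (hs₁.add hs₂)).trans_le ?_
        refine mul_le_mul_right ((haarNorm_add_le hq hs₁ hs₂).trans (add_le_add ?_ ?_)) _
        · refine (haarNorm_tsum_le hq hm₁).trans_eq (tsum_congr fun n => ?_)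
          exact hterm _ _ (by positivity)
        · refine (haarNorm_tsum_le hq hm₂).trans_eq (tsum_congr fun n => ?_)
          exact hterm _ _ (by positivity)
    _ ≤ C * (S * haarNorm q φ) := by
        rw [ENNReal.tsum_mul_right, ENNReal.tsum_mul_right, ← add_mul, hS]
        refine mul_le_mul_right (mul_le_mul_left (add_le_add ?_ le_rfl) _) _
        exact ENNReal.tsum_comp_le_tsum_of_injective (add_left_injective 1)
          fun n => ENNReal.ofReal ρ₁ ^ n
    _ = _ := by
        rw [ENNReal.coe_mul, ENNReal.coe_toNNReal hSt, mul_assoc]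
        rfl

end Reiteration

/-! ### Besov norms -/

section BesovNorms

variable {E : Type*} [NormedAddCommGroup E] [NormedSpace ℝ E] {d : ℕ}
  {T : Fin d → ContractionSemigroup E} {q : ℝ≥0∞}

theorem measurable_rpow_mul_mixedModulus (T : Fin d → ContractionSemigroup E) (r : ℕ) (β : ℝ)
    (f : E) : Measurable fun s : ℝ => ENNReal.ofReal (s ^ β) * mixedModulus T r s f :=
  measurable_ofReal_rpow_mul β (measurable_mixedModulus T r f)

variable [CompleteSpace E]

theorem isDominated_modulusNorm_rescaledInterpNorm (hT : SemigroupAssumption T) {r : ℕ}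
    (hr : 1 ≤ r) (hq : 1 ≤ q) {α : ℝ} (hα : 0 < α) (hαr : α < r) :
    IsDominated (modulusNorm T r α q)
      (rescaledInterpNorm (fun g : E => ‖g‖ₑ) (sobolevNorm T r) r α q) := by
  refine IsDominated.add
    (isDominated_rescaledInterpNorm (enorm_le_sobolevNorm T r) enorm_add_le hq hα hαr) ?_
  obtain ⟨C, hC⟩ := exists_kFunctional_equiv hT hr
  refine ⟨C, fun f => ?_⟩
  rw [rescaledInterpNorm, ← haarNorm_const_mul hq _
    (measurable_ofReal_rpow_mul _ (measurable_kFunctional_pow _ _ r f))]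
  refine haarNorm_mono fun s hs => ?_
  rw [mul_left_comm]
  exact mul_le_mul_right (hC f s hs.le).1 _

theorem isDominated_rescaledInterpNorm_modulusNorm (hT : SemigroupAssumption T) {r : ℕ}
    (hr : 1 ≤ r) (hq : 1 ≤ q) {α : ℝ} (hα : 0 < α) (hαr : α < r) :
    IsDominated (rescaledInterpNorm (fun g : E => ‖g‖ₑ) (sobolevNorm T r) r α q)
      (modulusNorm T r α q) := by
  obtain ⟨C, hC⟩ := exists_kFunctional_equiv hT hr
  have hm : Measurable fun s : ℝ => ENNReal.ofReal (s ^ (-α)) * ENNReal.ofReal (min (s ^ r) 1) :=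
    measurable_ofReal_rpow_mul _
      (ENNReal.measurable_ofReal.comp ((measurable_id.pow_const r).min measurable_const))
  set c := haarNorm q fun s : ℝ => ENNReal.ofReal (s ^ (-α)) * ENNReal.ofReal (min (s ^ r) 1)
    with hc
  have hct : c ≠ ⊤ := haarNorm_rpow_mul_min_ne_top hq hα hαr
  refine ⟨C * (1 + c.toNNReal), fun f => ?_⟩
  have hΩ := measurable_rpow_mul_mixedModulus T r (-α) f
  have hf : Measurable fun s : ℝ => ‖f‖ₑ *
      (ENNReal.ofReal (s ^ (-α)) * ENNReal.ofReal (min (s ^ r) 1)) := measurable_const.mul hm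
  calc _ ≤ haarNorm q fun s : ℝ => C * (ENNReal.ofReal (s ^ (-α)) * mixedModulus T r s f +
        ‖f‖ₑ * (ENNReal.ofReal (s ^ (-α)) * ENNReal.ofReal (min (s ^ r) 1))) := by
        refine haarNorm_mono fun s hs => ?_
        refine (mul_le_mul_right (hC f s hs.le).2 _).trans_eq ?_
        ring
    _ ≤ C * (haarNorm q (fun s : ℝ => ENNReal.ofReal (s ^ (-α)) * mixedModulus T r s f) +
        ‖f‖ₑ * c) := by
        refine (haarNorm_const_mul hq C (hΩ.add hf)).trans_le (mul_le_mul_right ?_ _)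
        refine (haarNorm_add_le hq hΩ hf).trans_eq ?_
        rw [haarNorm_const_mul hq _ hm]
    _ ≤ C * ((1 + c) * modulusNorm T r α q f) := by
        rw [modulusNorm]
        refine mul_le_mul_right ?_ _
        rw [add_mul, one_mul, mul_comm c]
        exact add_le_add le_add_self (mul_le_mul_left le_self_add _)
    _ = _ := by
        push_cast
        rw [ENNReal.coe_toNNReal hct, mul_assoc]

/-- The modulus of the derivatives of order `k` is controlled by the K-functional of the pair
`(E^k, E^{k+l})`. -/
theorem mixedModulus_mixedDeriv_le (T : Fin d → ContractionSemigroup E) {k : ℕ} (l : ℕ)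
    (j : Fin k → Fin d) {s : ℝ} (hs : 0 < s) (f : E) :
    mixedModulus T l s (mixedDeriv T j f) ≤ ((d ^ l * 3 ^ l : ℕ) : ℝ≥0∞) *
      kFunctional (sobolevNorm T k) (sobolevNorm T (k + l)) (s ^ l) f := by
  have h := le_mul_kFunctional_add (N₀ := sobolevNorm T k) (N₁ := sobolevNorm T (k + l))
    (t := s ^ l) (f := f) (B := supModulus T s l (mixedDeriv T j f)) (B' := 0) (c := 3 ^ l)
    (by simp) (by simp) fun f₀ f₁ hf h₀ h₁ => by
      have m₀ := mem_of_sobolevNorm_ne_top T h₀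
      have m₁ := mem_of_sobolevNorm_ne_top T h₁
      have m₁' := sobolevSpace_antitone T (Nat.le_add_right k l) m₁
      have hd₁ := sobolevNorm_mixedDeriv_le T (l := l) j m₁'
      have hd₀ := sobolevNorm_mixedDeriv_le T (l := 0) j m₀
      rw [sobolevNorm_zero, Nat.add_zero] at hd₀
      have hmem := mem_of_sobolevNorm_ne_top T (ne_top_of_le_ne_top h₁ hd₁)
      rw [add_zero, ← hf, mixedDeriv_add T j m₀ m₁', mul_add]
      refine (supModulus_add_le T s l _ _).trans (add_le_add ?_ ?_)
      · refine (supModulus_le_enorm T s l _).trans (mul_le_mul' ?_ hd₀)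
        gcongr
        norm_num
      · refine (supModulus_le_sobolevNorm T hs.le l hmem).trans ?_
        rw [mul_pow, ENNReal.ofReal_mul (by positivity), mul_assoc,
          ENNReal.ofReal_pow (by norm_num : (0 : ℝ) ≤ 3), ENNReal.ofReal_ofNat]
        gcongr
  rw [add_zero] at h
  refine (mixedModulus_le T s l _).trans ((mul_le_mul_right h _).trans_eq ?_)
  push_cast
  ring

theorem isDominated_derivModulusNorm_rescaledInterpNorm (T : Fin d → ContractionSemigroup E)
    (hq : 1 ≤ q) {k l : ℕ} {β : ℝ} (hβ : 0 < β) (hβl : β < l) :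
    IsDominated (derivModulusNorm T k l β q)
      (rescaledInterpNorm (sobolevNorm T k) (sobolevNorm T (k + l)) l β q) := by
  refine IsDominated.add (isDominated_rescaledInterpNorm
    (sobolevNorm_mono T (Nat.le_add_right k l)) (sobolevNorm_add_le T k) hq hβ hβl)
    (IsDominated.sum _ fun j => ⟨((d ^ l * 3 ^ l : ℕ) : NNReal), fun f => ?_⟩)
  rw [rescaledInterpNorm, ← haarNorm_const_mul hq _
    (measurable_ofReal_rpow_mul _ (measurable_kFunctional_pow _ _ l f))]
  refine haarNorm_mono fun s hs => ?_
  rw [mul_left_comm]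
  exact mul_le_mul_right (mixedModulus_mixedDeriv_le T l j hs f) _

/-- The modulus of order `k + l` is at most `s^k` times the moduli of order `l` of the derivatives
of order `k`. -/
theorem isDominated_modulusNorm_derivModulusNorm (T : Fin d → ContractionSemigroup E)
    (hq : 1 ≤ q) (k l : ℕ) (α : ℝ) :
    IsDominated (modulusNorm T (k + l) α q) (derivModulusNorm T k l (α - k) q) := by
  set c : NNReal := (d : NNReal) ^ (l + k) * 3 ^ k with hc
  refine ⟨1 + c, fun f => ?_⟩
  by_cases hf : f ∈ sobolevSpace T k
  · have hΩ : ∀ j : Fin k → Fin d, Measurable fun s : ℝ =>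
        ENNReal.ofReal (s ^ (-(α - k))) * mixedModulus T l s (mixedDeriv T j f) := fun j =>
      measurable_rpow_mul_mixedModulus T l _ _
    have hpt : ∀ s : ℝ, 0 < s → ENNReal.ofReal (s ^ (-α)) * mixedModulus T (k + l) s f ≤
        c * ∑ j : Fin k → Fin d,
          ENNReal.ofReal (s ^ (-(α - k))) * mixedModulus T l s (mixedDeriv T j f) := by
      intro s hs
      have h1 : mixedModulus T (k + l) s f ≤ (d : ℝ≥0∞) ^ (l + k) *
          (ENNReal.ofReal ((3 * s) ^ k) *
            ∑ j : Fin k → Fin d, mixedModulus T l s (mixedDeriv T j f)) := by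
        rw [add_comm k l]
        refine (mixedModulus_le T s (l + k) f).trans (mul_le_mul_right
          ((supModulus_add_le_mixedDeriv T hs.le l k hf).trans (mul_le_mul_right ?_ _)) _)
        exact Finset.sum_le_sum fun j _ => supModulus_le_mixedModulus T s l _
      have h2 : ENNReal.ofReal (s ^ (-(α - k))) =
          ENNReal.ofReal (s ^ (-α)) * ENNReal.ofReal (s ^ k) := by
        rw [← ENNReal.ofReal_mul (by positivity), ← Real.rpow_natCast s k, ← Real.rpow_add hs,
          show -α + (k : ℝ) = -(α - k) by ring]
      refine (mul_le_mul_right h1 _).trans_eq ?_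
      rw [← Finset.mul_sum, h2, mul_pow, ENNReal.ofReal_mul (by positivity),
        ENNReal.ofReal_pow (by norm_num : (0 : ℝ) ≤ 3), ENNReal.ofReal_ofNat, hc]
      push_cast
      ring
    rw [modulusNorm, derivModulusNorm]
    have h3 : haarNorm q (fun s => ENNReal.ofReal (s ^ (-α)) * mixedModulus T (k + l) s f) ≤
        c * ∑ j : Fin k → Fin d, haarNorm q fun s =>
          ENNReal.ofReal (s ^ (-(α - k))) * mixedModulus T l s (mixedDeriv T j f) := by
      refine (haarNorm_mono hpt).trans ?_
      rw [haarNorm_const_mul hq _ (Finset.measurable_sum _ fun j _ => hΩ j)]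
      exact mul_le_mul_right (haarNorm_sum_le hq _ hΩ) _
    refine (add_le_add (enorm_le_sobolevNorm T k f) h3).trans ?_
    rw [mul_add]
    push_cast
    exact add_le_add (le_mul_of_one_le_left' le_self_add) (mul_le_mul_left le_add_self _)
  · rw [derivModulusNorm, sobolevNorm_of_notMem T hf, top_add, ENNReal.mul_top]
    · exact le_top
    · exact_mod_cast (by positivity : (1 + c : NNReal) ≠ 0)

theorem normsEquivalent_interpNorm_modulusNorm (hT : SemigroupAssumption T) {r : ℕ}
    (hr : 1 ≤ r) (hq : 1 ≤ q) {α : ℝ} (hα : 0 < α) (hαr : α < r) :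
    NormsEquivalent (interpNorm (fun g : E => ‖g‖ₑ) (sobolevNorm T r) (α / r) q)
      (modulusNorm T r α q) := by
  have hr0 : r ≠ 0 := by omega
  exact ((isDominated_interpNorm_rescaledInterpNorm _ _ hq hr0 α).trans
      (isDominated_rescaledInterpNorm_modulusNorm hT hr hq hα hαr)).normsEquivalent
    ((isDominated_modulusNorm_rescaledInterpNorm hT hr hq hα hαr).trans
      (isDominated_rescaledInterpNorm_interpNorm _ _ hq hr0 α))

/-- The reiteration theorem for the scale `E^k`. -/
theorem normsEquivalent_interpNorm (hT : SemigroupAssumption T) {r k₁ k₂ : ℕ}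
    (hr : 1 ≤ r) (hk₂ : k₂ ≤ r) (hq : 1 ≤ q) {α : ℝ} (hα₁ : k₁ < α) (hα₂ : α < k₂) :
    NormsEquivalent (interpNorm (fun g : E => ‖g‖ₑ) (sobolevNorm T r) (α / r) q)
      (interpNorm (sobolevNorm T k₁) (sobolevNorm T k₂) ((α - k₁) / ((k₂ : ℝ) - k₁)) q) := by
  have hr0 : r ≠ 0 := by omega
  have hk : k₁ < k₂ := by exact_mod_cast hα₁.trans hα₂
  have hk0 : k₂ - k₁ ≠ 0 := by omega
  rw [← Nat.cast_sub hk.le]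
  exact ((isDominated_interpNorm_rescaledInterpNorm _ _ hq hr0 α).trans
      ((isDominated_rescaledInterpNorm_of_le hT hr hk.le hk₂ hq α).trans
        (isDominated_rescaledInterpNorm_interpNorm _ _ hq hk0 _))).normsEquivalent
    ((isDominated_interpNorm_rescaledInterpNorm _ _ hq hk0 _).trans
      ((isDominated_rescaledInterpNorm_of_lt hT hr hk₂ hq hα₁ hα₂).trans
        (isDominated_rescaledInterpNorm_interpNorm _ _ hq hr0 α)))

/-- The Besov norm in terms of the moduli of continuity of order `l` of the derivatives of
order `k`, for `k < α < k + l`. -/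
theorem normsEquivalent_modulusNorm_derivModulusNorm (hT : SemigroupAssumption T) {r k l : ℕ}
    (hkl : k + l ≤ r) (hq : 1 ≤ q) {α : ℝ} (hα : 0 < α) (hα₁ : k < α) (hα₂ : α < (k + l : ℕ)) :
    NormsEquivalent (modulusNorm T r α q) (derivModulusNorm T k l (α - k) q) := by
  have hkl0 : 1 ≤ k + l := by
    have : (0 : ℝ) < (k + l : ℕ) := hα.trans hα₂
    exact_mod_cast this
  have hr : 1 ≤ r := hkl0.trans hkl
  have hαr : α < r := hα₂.trans_le (by exact_mod_cast hkl)
  -- the order of the modulus is lowered from `r` to `k + l` by reiteration with the pair `E`,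
  -- `E^{k+l}`
  have hlow := isDominated_rescaledInterpNorm_of_le hT (k₁ := 0) hr (Nat.zero_le _) hkl hq α
  rw [sobolevNorm_zero_eq, Nat.sub_zero, Nat.cast_zero, sub_zero] at hlow
  have hup := isDominated_rescaledInterpNorm_of_lt hT hr hkl hq hα₁ hα₂
  rw [Nat.add_sub_cancel_left] at hup
  exact ((isDominated_modulusNorm_rescaledInterpNorm hT hr hq hα hαr).trans (hlow.trans
      ((isDominated_rescaledInterpNorm_modulusNorm hT hkl0 hq hα hα₂).trans
        (isDominated_modulusNorm_derivModulusNorm T hq k l α)))).normsEquivalent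
    ((isDominated_derivModulusNorm_rescaledInterpNorm T hq (by linarith)
      (by push_cast at hα₂; linarith)).trans
      (hup.trans (isDominated_rescaledInterpNorm_modulusNorm hT hr hq hα hαr)))

end BesovNorms

theorem theorem1p1 {E : Type*} [NormedAddCommGroup E] [NormedSpace ℝ E] [CompleteSpace E] {d : ℕ}
    (T : Fin d → ContractionSemigroup E) (hT : SemigroupAssumption T) (r : ℕ) (hr : 1 ≤ r) :
    -- (1) the K-functional and the mixed modulus of continuity
    (∃ c C : ℝ, 0 < c ∧ 0 < C ∧ ∀ (f : E) (s : ℝ), 0 ≤ s →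
      ENNReal.ofReal c * mixedModulus T r s f
          ≤ kFunctional (fun g : E => ‖g‖ₑ) (sobolevNorm T r) (s ^ r) f ∧
      kFunctional (fun g : E => ‖g‖ₑ) (sobolevNorm T r) (s ^ r) f
          ≤ ENNReal.ofReal C *
            (mixedModulus T r s f + ENNReal.ofReal (min (s ^ r) 1) * ‖f‖ₑ)) ∧
    ∀ (α : ℝ) (q : ℝ≥0∞), 0 < α → α < r → 1 ≤ q →
      -- (2) the norm of the Besov space through the modulus of continuity
      NormsEquivalent (interpNorm (fun g : E => ‖g‖ₑ) (sobolevNorm T r) (α / r) q)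
        (modulusNorm T r α q) ∧
      -- (3) reiteration
      (∀ k₁ k₂ : ℕ, (k₁ : ℝ) < α → α < k₂ → k₂ ≤ r →
        NormsEquivalent (interpNorm (fun g : E => ‖g‖ₑ) (sobolevNorm T r) (α / r) q)
          (interpNorm (sobolevNorm T k₁) (sobolevNorm T k₂) ((α - k₁) / ((k₂ : ℝ) - k₁)) q)) ∧
      -- (4) non-integer smoothness
      ((∀ n : ℕ, α ≠ n) →
        NormsEquivalent (modulusNorm T r α q)
          (derivModulusNorm T ⌊α⌋₊ 1 (α - ⌊α⌋₊) q)) ∧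
      -- (5) integer smoothness, Zygmund condition
      (∀ k : ℕ, α = k →
        NormsEquivalent (modulusNorm T r α q) (derivModulusNorm T (k - 1) 2 1 q)) := by
  refine ⟨?_, fun α q hα hαr hq => ⟨normsEquivalent_interpNorm_modulusNorm hT hr hq hα hαr,
    fun k₁ k₂ h₁ h₂ h => normsEquivalent_interpNorm hT hr h hq h₁ h₂, fun hn => ?_,
    fun k hk => ?_⟩⟩
  · obtain ⟨C, hC⟩ := exists_kFunctional_equiv hT hr
    refine ⟨((C : ℝ) + 1)⁻¹, C + 1, by positivity, by positivity, fun f s hs => ⟨?_, ?_⟩⟩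
    · rw [ENNReal.ofReal_inv_of_pos (by positivity), mul_comm, ← div_eq_mul_inv]
      refine ENNReal.div_le_of_le_mul' ((hC f s hs).1.trans (mul_le_mul_left ?_ _))
      rw [← ENNReal.ofReal_coe_nnreal]
      exact ENNReal.ofReal_le_ofReal (by linarith)
    · refine (hC f s hs).2.trans (mul_le_mul_left ?_ _)
      rw [← ENNReal.ofReal_coe_nnreal]
      exact ENNReal.ofReal_le_ofReal (by linarith)
  · have h1 : (⌊α⌋₊ : ℝ) < α := lt_of_le_of_ne (Nat.floor_le hα.le) (hn _).symm
    have h2 : α < (⌊α⌋₊ + 1 : ℕ) := by exact_mod_cast Nat.lt_floor_add_one α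
    have h3 : ⌊α⌋₊ + 1 ≤ r := by
      have : (⌊α⌋₊ : ℝ) < r := h1.trans hαr
      exact_mod_cast this
    exact normsEquivalent_modulusNorm_derivModulusNorm hT h3 hq hα h1 h2
  · subst hk
    obtain ⟨m, rfl⟩ : ∃ m, k = m + 1 := ⟨k - 1, by
      have : 0 < k := by exact_mod_cast hα
      omega⟩
    have h3 : m + 2 ≤ r := by
      have : m + 1 < r := by exact_mod_cast hαr
      omega
    have h := normsEquivalent_modulusNorm_derivModulusNorm hT (k := m) (l := 2) h3 hq hα
      (by push_cast; linarith) (by push_cast; linarith)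
    rw [Nat.add_sub_cancel]
    rwa [show ((m + 1 : ℕ) : ℝ) - m = 1 by push_cast; ring] at h
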